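/- Let $k\ge 1$ be divisible by $6$; indices $i$ are taken in $\mathbb Z/k\mathbb Z$. Write $\mathbb T^3=\mathbb T^2\times S^1$ with coordinates $(x,t)$ and its flat metric; $B_r(z)$ is the open ball of radius $r$. The stable (unstable) set of a fixed point is the set of points whose forward (backward) orbit converges to it; for a hyperbolic fixed point it is the stable (unstable) manifold. **The map $f_0$.** Let $A\in SL(2,\mathbb Z)$ have eigenvalues $\lambda>5$ and $\lambda^{-1}$, let $g_A$ be the induced automorphism of $\mathbb T^2$, $W^s_A$ its stable foliation, and $W^s_A(x,r)$ the interval of length $r$ centred at $x$ in $W^s_A(x)$. Let $t_1,\dots,t_k\in S^1$ be circularly ordered points. Let $f_0(x,t)=(g_A(x),\varphi_x(t))$ be a $C^\infty$ diffeomorphism of $\mathbb T^3$ such that: 1. $\varphi_x(t_i)=t_i$ for all $x$ and $i$; 2. $\frac12<|\varphi_x'(t)|<\frac32$ for all $(x,t)$; 3. for each $i$ there are five distinct fixed points $\hat p^i,\hat q^i,\hat r^i_{-1},\hat r^i_0,\hat r^i_1$ of $g_A$ with $\hat p^i=\hat q^{i+1}=\hat p^{i+2}$ and $\hat r^i_1=\hat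 r^{i+1}_0=\hat r^{i+2}_{-1}=\hat r^{i+3}_1$; write $p^i=(\hat p^i,t_i)$, $q^i=(\hat q^i,t_i)$, $r^i_j=(\hat r^i_j,t_i)$; moreover $|\varphi'_{\hat p^i}(t_i)|>1$, $|\varphi'_{\hat r^i_1}(t_i)|>1$, $|\varphi'_{\hat q^i}(t_i)|<1$, $|\varphi'_{\hat r^i_{-1}}(t_i)|<1$; 4. for every $t$ in the arc $(t_i,t_{i+1})$: $(\hat p^i,t)$ is in the unstable set of $p^i$ and the stable set of $q^{i+1}$; $(\hat q^i,t)$ is in the stable set of $q^i$ and the unstable set of $p^{i+1}$; $(\hat r^i_0,t)$ is in the unstable set of $r^i_0$ and the stable set of $r^{i+1}_{-1}$; $(\hat r^i_1,t)$ is in the unstable set of $r^i_1$ and the stable set of $r^{i+1}_0$; 5. there are $\nu>0$ and $\sigma>0$, with $2\sigma$ smaller than the distance between any two of the five points of item 3, such that for every $i$, $\log|\varphi_x'(t_i)|\le\nu/2$ for all $x$, and $\log|\varphi_x'(t_i)|<-\nu$ for all $x$ outside the disks of radius $\sigma$ around $\hat p^i,\hat r^i_1,\hat r^i_0$. **The map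 $f_1$.** Let $\varepsilon>0$ be such that $10\varepsilon$ is smaller than the distance between any two of the tori $\mathbb T^2\times\{t_i\}$ and between any two of the five points of item 3, and let $0<\varepsilon'\le\varepsilon/2$. Let $f_1$ be a $C^\infty$ diffeomorphism of $\mathbb T^3$ that coincides with $f_0$ outside $\bigcup_iB_\varepsilon(r^i_0)$ and such that: 1. $f_1$ preserves the foliation $\mathcal W^{cs}$ with leaves $W^s_A(x)\times S^1$; 2. $f_1$ preserves each torus $\mathbb T^2\times\{t_i\}$, and $f_1=f_0$ on each circle $\{\hat r^i_0\}\times S^1$; 3. there is a continuous $Df_1$-invariant cone field (around a one-dimensional direction) transverse to $\mathcal W^{cs}$ whose vectors are expanded by $Df_1$ by a factor at least $3$, and there is $L>0$ such that every regular curve tangent to it of length $\ge L$ meets $W^s_A(x,2\varepsilon)\times S^1$ for every $x\in\mathbb T^2$, while no such curve of length $<L$ joins $\mathbb T^2\times\{t_i+\varepsilon\}$ to $\mathbb T^2\times\{t_{i+1}-\varepsilon\}$; 4. the maximal invariant set of $f_1$ in $B_\varepsilon(r^i_0)\cap(\mathbb T^2\times\{t_i\})$ consists of two segments of $W^s_A(\hat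 r^i_0)\times\{t_i\}$ which join $r^i_0$ to two fixed points, one on each side, lying outside $B_{\varepsilon'}(r^i_0)$; for the restriction of $f_1$ to $\mathbb T^2\times\{t_i\}$, $r^i_0$ is a hyperbolic source and these two fixed points are hyperbolic saddles; and the maximal invariant set of $f_1$ in $(\mathbb T^2\times\{t_i\})\setminus B_{\varepsilon'}(r^i_0)$ is the complement in $\mathbb T^2\times\{t_i\}$ of the unstable set of $r^i_0$. **The map $f$.** For $j=1,\dots,k$ let $\eta^j:\mathbb T^3\to[0,1]$ be a $C^\infty$ function equal to $1$ in $B_{\varepsilon'/2}(r^j_0)$ and to $0$ outside $B_{\varepsilon'}(r^j_0)$. For $\delta>0$ let $\rho$ be the composition of the time-one maps $\rho^j$ of the flows of $\delta\eta^j\,\partial/\partial t$ (they have disjoint supports), and let $f=\rho\circ f_1$ or $f=f_1\circ\rho$. **Proposition.** There is $\delta_0>0$ such that for every $0<\delta<\delta_0$ and every $i=1,\dots,k$, the stable manifold of $q^i$ for $f$ is dense in $\mathbb T^3$. -/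

import Mathlib

open Set Filter Topology
open scoped ContDiff Matrix

noncomputable section

namespace IntermingledBasins

/-! ### The flat torus and its diffeomorphisms -/

/-- The circle `ℝ / ℤ`. -/
abbrev S1 := UnitAddCircle

/-- The 2-torus. -/
abbrev T2 := Fin 2 → S1

/-- The 3-torus `T² × S¹`, with coordinates `(x, t)`. -/
abbrev T3 := T2 × S1

/-- The universal cover of `T2`. -/
abbrev E2 := Fin 2 → ℝ

/-- The universal cover of `T3`; it also serves as the tangent space of `T3` at every point. -/
abbrev E3 := E2 × ℝ

/-- The covering map `ℝ² → T²`. -/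
def proj2 (v : E2) : T2 := fun i => (v i : S1)

/-- The covering map `ℝ³ → T³`. -/
def proj (v : E3) : T3 := (proj2 v.1, (v.2 : S1))

/-- The flat Riemannian distance of `T²`. -/
def dist2 (x y : T2) : ℝ := √(∑ i, ‖x i - y i‖ ^ 2)

/-- The flat Riemannian distance of `T³`. -/
def dist3 (z w : T3) : ℝ := √((∑ i, ‖z.1 i - w.1 i‖ ^ 2) + ‖z.2 - w.2‖ ^ 2)

/-- The open ball of the flat metric of `T³`. -/
def ball3 (z : T3) (r : ℝ) : Set T3 := {w | dist3 w z < r}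

/-- The Euclidean norm of a tangent vector of `T³`. -/
def norm3 (v : E3) : ℝ := √((∑ i, v.1 i ^ 2) + v.2 ^ 2)

/-- A `C^∞` diffeomorphism of `T³`, with a smooth lift to `ℝ³`. The lift is determined up to an
integer translation, so its derivative at `v` is the derivative of the diffeomorphism at
`proj v`. -/
structure TorusDiffeo where
  /-- the underlying bijection -/
  toPerm : Equiv.Perm T3
  /-- a lift to the universal cover -/
  lift : E3 → E3
  lift_smooth : ContDiff ℝ ∞ lift
  proj_lift : ∀ v, proj (lift v) = toPerm (proj v)
  inv_smooth : ∃ G : E3 → E3, ContDiff ℝ ∞ G ∧ ∀ v, proj (G v) = toPerm.symm (proj v)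

instance : CoeFun TorusDiffeo (fun _ => T3 → T3) := ⟨fun f => f.toPerm⟩

/-- The derivative at `proj v`, in the coordinates given by the covering map. -/
def TorusDiffeo.D (f : TorusDiffeo) (v : E3) : E3 →L[ℝ] E3 := fderiv ℝ f.lift v

/-- The derivative along the circle `{x} × S¹`: for a map `(x, t) ↦ (g x, φ_x t)`, this is
`φ_x'(t)` at `(x, t) = proj v`. -/
def TorusDiffeo.fiberDeriv (f : TorusDiffeo) (v : E3) : ℝ := (f.D v (0, 1)).2

/-- The derivative at `proj v` of the restriction to the torus `T² × {t}` through `proj v`, for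
a diffeomorphism that preserves this torus. -/
def TorusDiffeo.horizDeriv (f : TorusDiffeo) (v : E3) : E2 →ₗ[ℝ] E2 :=
  LinearMap.fst ℝ E2 ℝ ∘ₗ (f.D v : E3 →ₗ[ℝ] E3) ∘ₗ LinearMap.inl ℝ E2 ℝ

/-- The stable set (the stable manifold, for a hyperbolic fixed point) of the fixed point `q`. -/
def stableSet (f : T3 → T3) (q : T3) : Set T3 :=
  {z | Tendsto (fun n : ℕ => f^[n] z) atTop (𝓝 q)}

/-- The unstable set of the fixed point `q`. -/
def unstableSet (f : TorusDiffeo) (q : T3) : Set T3 := stableSet f.toPerm.symm q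

/-- The maximal invariant set of `f` in `S`. -/
def maxInvariant (f : TorusDiffeo) (S : Set T3) : Set T3 :=
  {z | ∀ n : ℤ, (f.toPerm ^ n) z ∈ S}

/-- The fixed point `z` is a hyperbolic source of the restriction to the horizontal torus. -/
def IsHorizSource (f : TorusDiffeo) (z : T3) : Prop :=
  f z = z ∧ ∀ v, proj v = z →
    ∀ μ ∈ spectrum ℂ ((LinearMap.toMatrix' (f.horizDeriv v)).map (algebraMap ℝ ℂ)), 1 < ‖μ‖

/-- The fixed point `z` is a hyperbolic saddle of the restriction to the horizontal torus. -/
def IsHorizSaddle (f : TorusDiffeo) (z : T3) : Prop :=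
  f z = z ∧ ∀ v, proj v = z → ∃ a b : ℝ, |a| < 1 ∧ 1 < |b| ∧
    Module.End.HasEigenvalue (f.horizDeriv v) a ∧ Module.End.HasEigenvalue (f.horizDeriv v) b

/-! ### The linear Anosov map -/

/-- A hyperbolic matrix of `SL(2, ℤ)` with unstable eigenvalue `lam > 5`, and unit vectors
`es`, `eu` spanning its stable and unstable lines. -/
structure ToralAnosov where
  A : Matrix.SpecialLinearGroup (Fin 2) ℤ
  lam : ℝ
  eu : E2
  es : E2
  lam_gt : 5 < lam
  eu_unit : ∑ i, eu i ^ 2 = 1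
  es_unit : ∑ i, es i ^ 2 = 1
  A_eu : (A.1.map (Int.cast : ℤ → ℝ)) *ᵥ eu = lam • eu
  A_es : (A.1.map (Int.cast : ℤ → ℝ)) *ᵥ es = lam⁻¹ • es

namespace ToralAnosov

variable (N : ToralAnosov)

/-- The induced automorphism `g_A` of `T²`. -/
def g (x : T2) : T2 := fun i => ∑ j, N.A.1 i j • x j

/-- The point at signed distance `s` from `x` on the stable leaf of `x`. -/
def along (x : T2) (s : ℝ) : T2 := x + proj2 (s • N.es)

/-- The interval of length `r` centred at `x` in the stable leaf `W^s_A(x)`. -/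
def stableInterval (x : T2) (r : ℝ) : Set T2 := {y | ∃ s : ℝ, |s| ≤ r / 2 ∧ y = N.along x s}

/-- The leaf `W^s_A(x) × S¹` through `z = (x, t)` of the centre-stable foliation. -/
def csLeaf (z : T3) : Set T3 := {w | ∃ s : ℝ, w.1 = N.along z.1 s}

end ToralAnosov

/-! ### The fibered map with several invariant tori -/

/-- The positively oriented open arc of the circle between the images of `a` and `b`, for
`a < b ≤ a + 1`. -/
def arc (a b : ℝ) : Set S1 := (fun s : ℝ => (s : S1)) '' Ioo a b

/-- The fibered diffeomorphism `f₀ (x, t) = (g_A x, φ_x t)`. The circularly ordered points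
`t_i`, `i ∈ ℤ/k`, are the images in the circle of a strictly increasing sequence `τ` with
`τ (i + k) = τ i + 1`. All families are indexed by `ℤ`; the relations `p_q`, `q_p`, `r1_r0`,
`r0_rm`, `rm_r1` make the families of points of `T²` periodic of period 6, hence indexed by
`ℤ/k` when 6 divides `k`. The letters `p`, `q`, `rm`, `r0`, `r1` are the points of `T²` below the
fixed points `p^i`, `q^i`, `r^i_{-1}`, `r^i_0`, `r^i_1`. -/
structure KanMap (k : ℕ) where
  N : ToralAnosov
  τ : ℤ → ℝ
  τ_strictMono : StrictMono τ
  τ_period : ∀ i, τ (i + k) = τ i + 1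
  f₀ : TorusDiffeo
  φ : T2 → S1 → S1
  fibered : ∀ x t, f₀ (x, t) = (N.g x, φ x t)
  /-- the tori `T² × {t_i}` are invariant -/
  φ_fix : ∀ x i, φ x (τ i : S1) = (τ i : S1)
  fiberDeriv_bounds : ∀ v, 1 / 2 < |f₀.fiberDeriv v| ∧ |f₀.fiberDeriv v| < 3 / 2
  p : ℤ → T2
  q : ℤ → T2
  rm : ℤ → T2
  r0 : ℤ → T2
  r1 : ℤ → T2
  named_fixed : ∀ i, ∀ x ∈ [p i, q i, rm i, r0 i, r1 i], N.g x = x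
  named_distinct : ∀ i, [p i, q i, rm i, r0 i, r1 i].Nodup
  p_q : ∀ i, p i = q (i + 1)
  q_p : ∀ i, q (i + 1) = p (i + 2)
  r1_r0 : ∀ i, r1 i = r0 (i + 1)
  r0_rm : ∀ i, r0 (i + 1) = rm (i + 2)
  rm_r1 : ∀ i, rm (i + 2) = r1 (i + 3)
  deriv_p : ∀ i v, proj v = (p i, (τ i : S1)) → 1 < |f₀.fiberDeriv v|
  deriv_r1 : ∀ i v, proj v = (r1 i, (τ i : S1)) → 1 < |f₀.fiberDeriv v|
  deriv_q : ∀ i v, proj v = (q i, (τ i : S1)) → |f₀.fiberDeriv v| < 1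
  deriv_rm : ∀ i v, proj v = (rm i, (τ i : S1)) → |f₀.fiberDeriv v| < 1
  connect_a : ∀ i, ∀ t ∈ arc (τ i) (τ (i + 1)),
    (p i, t) ∈ unstableSet f₀ (p i, (τ i : S1)) ∩ stableSet f₀ (q (i + 1), (τ (i + 1) : S1))
  connect_b : ∀ i, ∀ t ∈ arc (τ i) (τ (i + 1)),
    (q i, t) ∈ stableSet f₀ (q i, (τ i : S1)) ∩ unstableSet f₀ (p (i + 1), (τ (i + 1) : S1))
  connect_c : ∀ i, ∀ t ∈ arc (τ i) (τ (i + 1)),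
    (r0 i, t) ∈ unstableSet f₀ (r0 i, (τ i : S1)) ∩ stableSet f₀ (rm (i + 1), (τ (i + 1) : S1))
  connect_d : ∀ i, ∀ t ∈ arc (τ i) (τ (i + 1)),
    (r1 i, t) ∈ unstableSet f₀ (r1 i, (τ i : S1)) ∩ stableSet f₀ (r0 (i + 1), (τ (i + 1) : S1))
  /-- contraction along the circles at `T² × {t_i}`, outside small disjoint disks of radius `σ`
  around `p i`, `r1 i`, `r0 i` -/
  mostly_contracting : ∃ ν > 0, ∃ σ > 0,
    (∀ i, [p i, q i, rm i, r0 i, r1 i].Pairwise (fun x y => 2 * σ < dist2 x y)) ∧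
    ∀ i v, (v.2 : S1) = (τ i : S1) →
      ((∀ x ∈ [p i, r1 i, r0 i], σ ≤ dist2 (proj2 v.1) x) →
        Real.log |f₀.fiberDeriv v| < -ν) ∧
      Real.log |f₀.fiberDeriv v| ≤ ν / 2

namespace KanMap

variable {k : ℕ} (K : KanMap k)

/-- The point `t_i` of the circle. -/
def t (i : ℤ) : S1 := (K.τ i : S1)

/-- The fixed point `q^i`. -/
def Q (i : ℤ) : T3 := (K.q i, K.t i)

/-- The fixed point `r^i_0`. -/
def R0 (i : ℤ) : T3 := (K.r0 i, K.t i)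

/-- The torus `T² × {t_i}`. -/
def torus (i : ℤ) : Set T3 := {z | z.2 = K.t i}

end KanMap

/-! ### Cone fields -/

/-- A continuous cone field `C(z) = {w | 0 ≤ B z w w}` around a one-dimensional direction,
transverse to the planes spanned by `(es, 0)` and `(0, 1)` (the tangent planes of the
centre-stable foliation), given by a continuous field of quadratic forms. -/
def IsConeField (N : ToralAnosov) (B : T3 → E3 →L[ℝ] E3 →L[ℝ] ℝ) : Prop :=
  Continuous B ∧ (∀ z v w, B z v w = B z w v) ∧
  (∀ z, ∀ a c : ℝ, (a, c) ≠ 0 → B z (a • N.es, c) (a • N.es, c) < 0) ∧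
  ∀ z, ∃ w, 0 < B z w w

/-- A regular `C¹` curve `proj ∘ γ`, parametrized by `[0, 1]`, tangent to the cone field `B`. -/
def IsTangentCurve (B : T3 → E3 →L[ℝ] E3 →L[ℝ] ℝ) (γ : ℝ → E3) : Prop :=
  ContDiff ℝ 1 γ ∧ ∀ s ∈ Icc (0 : ℝ) 1,
    deriv γ s ≠ 0 ∧ 0 ≤ B (proj (γ s)) (deriv γ s) (deriv γ s)

/-- The length of the curve `γ` on `[0, 1]`. -/
def curveLength (γ : ℝ → E3) : ℝ := ∫ s in (0 : ℝ)..1, norm3 (deriv γ s)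

/-! ### The modification of DA type -/

/-- The diffeomorphism `f₁`, which differs from `f₀` only in the balls of radius `ε` around the
points `r^i_0`. The radius `ε'` is that of the smaller balls in which the final perturbation will
be supported. -/
structure FirstModification {k : ℕ} (K : KanMap k) where
  ε : ℝ
  ε' : ℝ
  ε'_pos : 0 < ε'
  ε'_le : ε' ≤ ε / 2
  ε_tori : ∀ i, 10 * ε < K.τ (i + 1) - K.τ i
  ε_points : ∀ i,
    [K.p i, K.q i, K.rm i, K.r0 i, K.r1 i].Pairwise (fun x y => 10 * ε < dist2 x y)
  f₁ : TorusDiffeo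
  eq_outside : ∀ z, (∀ i, z ∉ ball3 (K.R0 i) ε) → f₁ z = K.f₀ z
  /-- the foliation by the leaves `W^s_A(x) × S¹` is preserved -/
  leaf : ∀ z, f₁ '' K.N.csLeaf z = K.N.csLeaf (f₁ z)
  torus_inv : ∀ i, f₁ '' K.torus i = K.torus i
  circle : ∀ i t, f₁ (K.r0 i, t) = K.f₀ (K.r0 i, t)
  /-- the invariant, expanded, narrow cone field -/
  cone : ∃ B, IsConeField K.N B ∧
    (∀ v w, 0 ≤ B (proj v) w w →
      0 ≤ B (f₁ (proj v)) (f₁.D v w) (f₁.D v w) ∧ 3 * norm3 w ≤ norm3 (f₁.D v w)) ∧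
    ∃ L > 0,
      (∀ x γ, IsTangentCurve B γ → L ≤ curveLength γ →
        ∃ s ∈ Icc (0 : ℝ) 1, (proj (γ s)).1 ∈ K.N.stableInterval x (2 * ε)) ∧
      ∀ i γ, IsTangentCurve B γ → curveLength γ < L →
        ¬ ((proj (γ 0)).2 = ((K.τ i + ε : ℝ) : S1) ∧
          (proj (γ 1)).2 = ((K.τ (i + 1) - ε : ℝ) : S1))
  /-- The maximal invariant set in the horizontal disk of radius `ε` around `r^i_0` consists of
  two segments of the leaf through `r^i_0`, which join this hyperbolic source to two hyperbolic
  saddles, outside the ball of radius `ε'`. -/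
  local_invariant : ∀ i, ∃ a b : ℝ, a < 0 ∧ 0 < b ∧
    maxInvariant f₁ (ball3 (K.R0 i) ε ∩ K.torus i) =
      (fun s : ℝ => ((K.N.along (K.r0 i) s, K.t i) : T3)) '' Icc a b ∧
    IsHorizSource f₁ (K.R0 i) ∧
    ∀ c ∈ [a, b], IsHorizSaddle f₁ (K.N.along (K.r0 i) c, K.t i) ∧
      (K.N.along (K.r0 i) c, K.t i) ∉ ball3 (K.R0 i) ε'
  /-- The maximal invariant set in the torus minus the ball of radius `ε'` (the DA attractor) is
  the complement of the basin of repulsion of `r^i_0` in the torus. -/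
  attractor : ∀ i, maxInvariant f₁ (K.torus i \ ball3 (K.R0 i) ε') =
    K.torus i \ unstableSet f₁ (K.R0 i)

/-! ### The final perturbation -/

/-- A smooth function `T³ → [0, 1]`, equal to `1` in the ball of radius `r / 2` around `c` and
to `0` outside the ball of radius `r`. -/
def IsBump (c : T3) (r : ℝ) (η : T3 → ℝ) : Prop :=
  ContDiff ℝ ∞ (fun v : E3 => η (proj v)) ∧ (∀ z, η z ∈ Icc (0 : ℝ) 1) ∧
  (∀ z ∈ ball3 c (r / 2), η z = 1) ∧ ∀ z, z ∉ ball3 c r → η z = 0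

/-- `ρ` is the time-one map of the flow of the vector field `X ∂/∂t` on `T³`. -/
def IsVerticalTimeOneMap (X : T3 → ℝ) (ρ : T3 → T3) : Prop :=
  ∀ (x : T2) (s : ℝ), ∃ c : ℝ → ℝ, c 0 = s ∧
    (∀ u, HasDerivAt c (X (x, (c u : S1))) u) ∧ ρ (x, (s : S1)) = (x, (c 1 : S1))

end IntermingledBasins

end

open Set Filter Topology
open scoped ContDiff Matrix

noncomputable section

namespace IntermingledBasins

/-! ### The flat distances -/

/-! Since `f` is an open map, every forward image of a nonempty open set `U` is open. It therefore
suffices to show that some forward image of `U` meets a piece of the stable set of `q^i`. The piece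
used is the strip over the stable interval of half-length `2ε` at `q i`, between the levels `τ (i -
1)` and `τ (i + 1)`. The strip avoids all the modified balls. Over `q i` the circle dynamics tends
to `τ i`, and the two end levels repel because `q i = p (i ± 1)`, so the whole strip is stable
(`tendsto_strip`).

Everything is done on the cyclic cover `T² × ℝ`, where `f` has a lift `F` (`exists_isLift`) under
which points above a level `τ i` stay above it. In the base, `f` is `g_A` followed by a displacement
of at most `2ε/5` along the stable leaf (`exists_drift`). As `g_A` contracts this leaf by more than
`5`, the accumulated displacement never exceeds `ε/2` (`iterate_drift`). Hence stable leaves of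
fixed points of `g_A` can be followed for all time.

Some image of `U` meets a strip, because the stable leaf of a fixed point is dense
(`exists_reaches`). The strip index can then be raised by one (`reaches_succ`). An open set meeting
the local stable set of `q^j` spreads along the unstable leaf of `q^j` in the torus at level `τ j`.
This leaf stays in the attractor, so its height is kept, and it crosses the stable leaf of any fixed
point of `g_A` (`IsSink.exists_push`). Push it to the leaf of `p j = q (j + 1) = q (j - 1)`. At
height at least `τ j` one is, up to a small upward shift, in the strip of `q (j + 1)`. Below `τ j`
one is above `τ (j - 1)` in the strip of `q (j - 1)`, and the torus at level `τ j` must be crossed.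

The perturbation `ρ` makes this crossing possible. On the circle over `r0 j` the map `f₀` moves
points up on both sides of `τ j` and fixes only `τ j`. The upward push removes this fixed point, so
orbits rise from just above `τ (j - 1)` to `τ (j + 1)` (`tendsto_circle`). At its ends this circle
carries `r1 (j - 1)`, which repels vertically, and `rm (j + 1)`, which attracts. So an open set just
above `q^(j-1)` is pushed to the leaf of `r1 (j - 1)`, climbs to the sink over `rm (j + 1)`
(`exists_exit`), and from there is pushed to the strip of `q (j + 1)` (`reaches_add_two`).
Iterating, all larger indices are reached, among them one congruent to `i` modulo `k`. -/

theorem sqrt_sum_sq_add_le {ι : Type*} [Fintype ι] (a b c : ι → ℝ) (hc : ∀ i, 0 ≤ c i)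
    (h : ∀ i, c i ≤ a i + b i) :
    √(∑ i, c i ^ 2) ≤ √(∑ i, a i ^ 2) + √(∑ i, b i ^ 2) := by
  have h1 := norm_add_le (WithLp.toLp 2 a : EuclideanSpace ℝ ι) (WithLp.toLp 2 b)
  simp only [EuclideanSpace.norm_eq, PiLp.add_apply, Real.norm_eq_abs, sq_abs] at h1
  refine le_trans (Real.sqrt_le_sqrt (Finset.sum_le_sum fun i _ => ?_)) h1
  have := hc i
  have := h i
  gcongr

/-- A single sum over `Fin 3` lets the same Minkowski inequality serve both distances. -/
theorem dist3_eq (z w : T3) :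
    dist3 z w = √(∑ i : Fin 3, (![‖z.1 0 - w.1 0‖, ‖z.1 1 - w.1 1‖, ‖z.2 - w.2‖] i) ^ 2) := by
  simp [dist3, Fin.sum_univ_three]

theorem dist2_comm (x y : T2) : dist2 x y = dist2 y x := by
  simp only [dist2, norm_sub_rev]

theorem dist3_comm (z w : T3) : dist3 z w = dist3 w z := by
  simp only [dist3, norm_sub_rev]

theorem dist2_triangle (x y z : T2) : dist2 x z ≤ dist2 x y + dist2 y z :=
  sqrt_sum_sq_add_le _ _ _ (fun _ => norm_nonneg _) fun _ => norm_sub_le_norm_sub_add_norm_sub _ _ _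

theorem dist3_triangle (x y z : T3) : dist3 x z ≤ dist3 x y + dist3 y z := by
  simp only [dist3_eq]
  refine sqrt_sum_sq_add_le _ _ _ (fun i => ?_) fun i => ?_
  · fin_cases i <;> exact norm_nonneg _
  · fin_cases i <;> exact norm_sub_le_norm_sub_add_norm_sub _ _ _

theorem dist2_le_dist3 (z w : T3) : dist2 z.1 w.1 ≤ dist3 z w :=
  Real.sqrt_le_sqrt (by nlinarith [sq_nonneg ‖z.2 - w.2‖])

theorem norm_snd_le_dist3 (z w : T3) : ‖z.2 - w.2‖ ≤ dist3 z w := by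
  refine Real.le_sqrt_of_sq_le ?_
  have : 0 ≤ ∑ i, ‖z.1 i - w.1 i‖ ^ 2 := Finset.sum_nonneg fun _ _ => sq_nonneg _
  linarith

theorem dist3_same_height (x y : T2) (t : S1) : dist3 (x, t) (y, t) = dist2 x y := by
  simp [dist3, dist2]

theorem continuous_dist3 (w : T3) : Continuous fun z => dist3 z w := by
  unfold dist3; fun_prop

theorem continuous_dist2 (w : T2) : Continuous fun z => dist2 z w := by
  unfold dist2; fun_prop

theorem dist2_self (x : T2) : dist2 x x = 0 := by simp [dist2]

theorem dist3_self (x : T3) : dist3 x x = 0 := by simp [dist3]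

/-! ### The covering maps -/

theorem isOpenQuotientMap_coe : IsOpenQuotientMap (fun a : ℝ => (a : S1)) :=
  QuotientAddGroup.isOpenQuotientMap_mk

theorem isOpenQuotientMap_proj2 : IsOpenQuotientMap proj2 :=
  IsOpenQuotientMap.piMap (fun _ : Fin 2 => isOpenQuotientMap_coe)

theorem isOpenQuotientMap_proj : IsOpenQuotientMap proj :=
  isOpenQuotientMap_proj2.prodMap isOpenQuotientMap_coe

/-- The cyclic covering `T² × ℝ → T³`. -/
def cyc (z : T2 × ℝ) : T3 := (z.1, (z.2 : S1))

theorem isOpenQuotientMap_cyc : IsOpenQuotientMap cyc :=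
  IsOpenQuotientMap.id.prodMap isOpenQuotientMap_coe

theorem continuous_proj2 : Continuous proj2 := isOpenQuotientMap_proj2.continuous

theorem continuous_cyc : Continuous cyc := isOpenQuotientMap_cyc.continuous

theorem proj2_add (v w : E2) : proj2 (v + w) = proj2 v + proj2 w := by
  ext i; simp [proj2]

theorem proj2_zero : proj2 0 = 0 := by
  ext i; simp [proj2]

theorem coe_eq_coe_iff {a b : ℝ} : (a : S1) = (b : S1) ↔ ∃ n : ℤ, a = b + n := by
  rw [← sub_eq_zero, ← AddCircle.coe_sub, AddCircle.coe_eq_zero_iff]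
  constructor
  · rintro ⟨n, hn⟩
    exact ⟨n, by simp at hn; linarith⟩
  · rintro ⟨n, hn⟩
    exact ⟨n, by simp; linarith⟩

theorem proj2_eq_iff {v w : E2} : proj2 v = proj2 w ↔ ∃ n : Fin 2 → ℤ, v = w + fun i => (n i : ℝ) := by
  constructor
  · intro h
    have h' : ∀ i, ∃ n : ℤ, v i = w i + n := fun i => coe_eq_coe_iff.1 (congrFun h i)
    choose n hn using h'
    exact ⟨n, funext hn⟩
  · rintro ⟨n, rfl⟩
    exact funext fun i => coe_eq_coe_iff.2 ⟨n i, rfl⟩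

theorem coe_injOn {a b : ℝ} (h : (a : S1) = (b : S1)) (hab : |a - b| < 1) : a = b := by
  obtain ⟨n, hn⟩ := coe_eq_coe_iff.1 h
  have : |(n : ℝ)| < 1 := by rw [hn] at hab; simpa using hab
  have : n = 0 := by
    have : |n| < 1 := by exact_mod_cast this
    exact Int.abs_lt_one_iff.1 this
  simp [hn, this]

theorem norm_coe_le_abs (a : ℝ) : ‖(a : S1)‖ ≤ |a| := by
  rw [UnitAddCircle.norm_eq]
  simpa using round_le a 0

theorem norm_coe_of_abs_le {a : ℝ} (h : |a| ≤ 1 / 2) : ‖(a : S1)‖ = |a| :=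
  (AddCircle.norm_coe_eq_abs_iff (p := (1 : ℝ)) one_ne_zero).2 (by simpa using h)

theorem dist2_add_left (x y z : T2) : dist2 (x + y) (x + z) = dist2 y z := by
  simp [dist2]

/-! ### The linear Anosov map -/

namespace ToralAnosov

variable (N : ToralAnosov)

theorem lam_pos : 0 < N.lam := by linarith [N.lam_gt]

theorem lam_inv_lt : N.lam⁻¹ < 1 / 5 := by
  have := N.lam_gt
  rw [one_div]; gcongr

theorem lam_inv_pos : 0 < N.lam⁻¹ := inv_pos.2 N.lam_pos

/-- The point at signed distance `u` from `x` on the unstable leaf of `x`. -/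
def alongU (x : T2) (u : ℝ) : T2 := x + proj2 (u • N.eu)

theorem g_proj2 (v : E2) : N.g (proj2 v) = proj2 ((N.A.1.map (Int.cast : ℤ → ℝ)) *ᵥ v) := by
  ext i
  simp [g, proj2, Matrix.mulVec, dotProduct]

theorem g_add (x y : T2) : N.g (x + y) = N.g x + N.g y := by
  ext i
  simp [g]
  abel

theorem g_es (s : ℝ) : N.g (proj2 (s • N.es)) = proj2 ((N.lam⁻¹ * s) • N.es) := by
  rw [g_proj2, Matrix.mulVec_smul, N.A_es, smul_smul, mul_comm]

theorem g_eu (s : ℝ) : N.g (proj2 (s • N.eu)) = proj2 ((N.lam * s) • N.eu) := by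
  rw [g_proj2, Matrix.mulVec_smul, N.A_eu, smul_smul, mul_comm]

theorem g_along (x : T2) (s : ℝ) : N.g (N.along x s) = N.along (N.g x) (N.lam⁻¹ * s) := by
  simp [along, g_add, g_es]

theorem g_alongU (x : T2) (s : ℝ) : N.g (N.alongU x s) = N.alongU (N.g x) (N.lam * s) := by
  simp [alongU, g_add, g_eu]

theorem iterate_g_along (x : T2) (s : ℝ) (n : ℕ) :
    N.g^[n] (N.along x s) = N.along (N.g^[n] x) (N.lam⁻¹ ^ n * s) := by
  induction n with
  | zero => simp
  | succ n ih => rw [Function.iterate_succ_apply', ih, g_along, Function.iterate_succ_apply', pow_succ']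
                 ring_nf

theorem iterate_g_alongU (x : T2) (s : ℝ) (n : ℕ) :
    N.g^[n] (N.alongU x s) = N.alongU (N.g^[n] x) (N.lam ^ n * s) := by
  induction n with
  | zero => simp
  | succ n ih => rw [Function.iterate_succ_apply', ih, g_alongU, Function.iterate_succ_apply', pow_succ']
                 ring_nf

theorem along_along (x : T2) (s r : ℝ) : N.along (N.along x s) r = N.along x (s + r) := by
  simp [along, add_smul, proj2_add, add_assoc]

theorem along_zero (x : T2) : N.along x 0 = x := by simp [along, proj2_zero]

theorem alongU_zero (x : T2) : N.alongU x 0 = x := by simp [alongU, proj2_zero]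

theorem continuous_along : Continuous fun z : T2 × ℝ => N.along z.1 z.2 := by
  unfold along
  exact continuous_fst.add (continuous_proj2.comp (by fun_prop))

theorem continuous_alongU : Continuous fun z : T2 × ℝ => N.alongU z.1 z.2 := by
  unfold alongU
  exact continuous_fst.add (continuous_proj2.comp (by fun_prop))

theorem dist2_proj2_smul_le {e : E2} (he : ∑ i, e i ^ 2 = 1) (s : ℝ) :
    dist2 (proj2 (s • e)) 0 ≤ |s| := by
  have h : |s| = √(∑ i, (s * e i) ^ 2) := by
    simp only [mul_pow, ← Finset.mul_sum, he, mul_one, Real.sqrt_sq_eq_abs]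
  rw [h, dist2]
  refine Real.sqrt_le_sqrt (Finset.sum_le_sum fun i _ => ?_)
  rw [← sq_abs (s * e i)]
  have := norm_coe_le_abs (s * e i)
  simp only [proj2, Pi.smul_apply, smul_eq_mul, Pi.zero_apply, sub_zero]
  gcongr

/-- The coordinates of a unit vector are at most `1`, so for `|s| ≤ 1 / 2` no coordinate of `s • e`
wraps around its circle and the flat distance is the Euclidean length. -/
theorem dist2_proj2_smul {e : E2} (he : ∑ i, e i ^ 2 = 1) {s : ℝ} (hs : |s| ≤ 1 / 2) :
    dist2 (proj2 (s • e)) 0 = |s| := by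
  have h : |s| = √(∑ i, (s * e i) ^ 2) := by
    simp only [mul_pow, ← Finset.mul_sum, he, mul_one, Real.sqrt_sq_eq_abs]
  rw [h, dist2]
  congr 1
  refine Finset.sum_congr rfl fun i _ => ?_
  have h1 : e i ^ 2 ≤ 1 := by
    rw [← he]; exact Finset.single_le_sum (f := fun i => e i ^ 2) (fun _ _ => sq_nonneg _) (Finset.mem_univ i)
  have h2 : |e i| ≤ 1 := by rwa [← sq_le_one_iff_abs_le_one]
  rw [← sq_abs (s * e i)]
  simp only [proj2, Pi.smul_apply, smul_eq_mul, Pi.zero_apply, sub_zero]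
  rw [norm_coe_of_abs_le]
  rw [abs_mul]
  nlinarith [abs_nonneg s, abs_nonneg (e i)]

theorem dist2_along_le (x : T2) (s : ℝ) : dist2 (N.along x s) x ≤ |s| := by
  have := dist2_add_left x (proj2 (s • N.es)) 0
  rw [add_zero] at this
  rw [along, this]
  exact dist2_proj2_smul_le N.es_unit s

theorem dist2_along (x : T2) {s : ℝ} (hs : |s| ≤ 1 / 2) : dist2 (N.along x s) x = |s| := by
  have := dist2_add_left x (proj2 (s • N.es)) 0
  rw [add_zero] at this
  rw [along, this]
  exact dist2_proj2_smul N.es_unit hs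

theorem dist2_alongU_le (x : T2) (s : ℝ) : dist2 (N.alongU x s) x ≤ |s| := by
  have := dist2_add_left x (proj2 (s • N.eu)) 0
  rw [add_zero] at this
  rw [alongU, this]
  exact dist2_proj2_smul_le N.eu_unit s

/-- If the two unit vectors were collinear, `es` would be `r • eu` with `r` their scalar product,
hence an eigenvector for both `lam` and `lam⁻¹`. -/
theorem det_ne_zero : N.eu 0 * N.es 1 - N.eu 1 * N.es 0 ≠ 0 := by
  intro h
  have hs := N.es_unit
  have hu := N.eu_unit
  rw [Fin.sum_univ_two] at hs hu
  set r := N.eu 0 * N.es 0 + N.eu 1 * N.es 1 with hr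
  have h0 : N.es = r • N.eu := by
    ext i
    fin_cases i
    · simp only [Fin.zero_eta, Pi.smul_apply, smul_eq_mul, hr]
      linear_combination (-N.es 0) * hu - N.eu 1 * h
    · simp only [Fin.mk_one, Pi.smul_apply, smul_eq_mul, hr]
      linear_combination (-N.es 1) * hu + N.eu 0 * h
  have h1 := N.A_es
  rw [h0, Matrix.mulVec_smul, N.A_eu] at h1
  have hl : N.lam - N.lam⁻¹ ≠ 0 := by
    have := N.lam_gt; have := N.lam_inv_lt; linarith
  have h2 : ∀ i, r * N.eu i = 0 := fun i => by
    have := congrFun h1 i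
    simp only [Pi.smul_apply, smul_eq_mul] at this
    have h3 : (N.lam - N.lam⁻¹) * (r * N.eu i) = 0 := by linarith
    exact (mul_eq_zero.1 h3).resolve_left hl
  have h3 : N.es = 0 := by rw [h0]; ext i; simpa using h2 i
  simp [h3] at hs

theorem exists_eq_eu_add_es (v : E2) : ∃ a b : ℝ, v = a • N.eu + b • N.es := by
  have h := N.det_ne_zero
  set d := N.eu 0 * N.es 1 - N.eu 1 * N.es 0 with hd
  refine ⟨(v 0 * N.es 1 - v 1 * N.es 0) / d, (N.eu 0 * v 1 - N.eu 1 * v 0) / d, ?_⟩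
  ext i
  fin_cases i
  · simp only [Fin.zero_eta, Pi.add_apply, Pi.smul_apply, smul_eq_mul]
    field_simp
    rw [hd]; ring
  · simp only [Fin.mk_one, Pi.add_apply, Pi.smul_apply, smul_eq_mul]
    field_simp
    rw [hd]; ring

/-- Any unstable leaf meets any stable leaf. -/
theorem exists_alongU_eq_along (x y : T2) : ∃ u s : ℝ, N.alongU x u = N.along y s := by
  obtain ⟨v, rfl⟩ := isOpenQuotientMap_proj2.surjective x
  obtain ⟨w, rfl⟩ := isOpenQuotientMap_proj2.surjective y
  obtain ⟨a, b, hab⟩ := N.exists_eq_eu_add_es (w - v)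
  refine ⟨a, -b, ?_⟩
  rw [alongU, along, ← proj2_add, ← proj2_add]
  congr 1
  rw [neg_smul, ← sub_eq_add_neg, eq_sub_iff_add_eq, add_assoc, ← hab]
  abel

/-- The linear functional whose kernel is the stable line. -/
def uCoord (v : E2) : ℝ := v 0 * N.es 1 - v 1 * N.es 0

theorem continuous_uCoord : Continuous N.uCoord := by
  unfold uCoord; fun_prop

theorem uCoord_add_smul (v : E2) (s : ℝ) : N.uCoord (v + s • N.es) = N.uCoord v := by
  simp [uCoord]; ring

/-- The difference lies on the stable line, so its coefficient is its scalar product with the unit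
vector `es`. The explicit formula gives the continuity of the leaf coordinate in `exists_leaf_path`.
-/
theorem eq_smul_of_uCoord_eq {v w : E2} (h : N.uCoord v = N.uCoord w) :
    v = w + ((v 0 - w 0) * N.es 0 + (v 1 - w 1) * N.es 1) • N.es := by
  have hs := N.es_unit
  rw [Fin.sum_univ_two] at hs
  unfold uCoord at h
  ext i
  fin_cases i
  · simp only [Fin.zero_eta, Pi.add_apply, Pi.smul_apply, smul_eq_mul]
    linear_combination (w 0 - v 0) * hs + N.es 1 * h
  · simp only [Fin.mk_one, Pi.add_apply, Pi.smul_apply, smul_eq_mul]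
    linear_combination (w 1 - v 1) * hs - N.es 0 * h

/-- Cramer's rule with integer coefficients and determinant `1`. -/
theorem g_injective : Function.Injective N.g := by
  intro x y h
  have h0 := congrFun h 0
  have h1 := congrFun h 1
  simp only [g, Fin.sum_univ_two] at h0 h1
  have hd := N.A.2
  rw [Matrix.det_fin_two] at hd
  set a := N.A.1 0 0
  set b := N.A.1 0 1
  set c := N.A.1 1 0
  set d := N.A.1 1 1
  ext i
  fin_cases i
  · have h2 : (a * d - b * c) • x 0 = (a * d - b * c) • y 0 := by
      have e : ∀ x : T2, (a * d - b * c) • x 0 = d • (a • x 0 + b • x 1) - b • (c • x 0 + d • x 1) := by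
        intro x; module
      rw [e, e, h0, h1]
    rw [hd, one_smul, one_smul] at h2
    exact h2
  · have h2 : (a * d - b * c) • x 1 = (a * d - b * c) • y 1 := by
      have e : ∀ x : T2, (a * d - b * c) • x 1 = a • (c • x 0 + d • x 1) - c • (a • x 0 + b • x 1) := by
        intro x; module
      rw [e, e, h0, h1]
    rw [hd, one_smul, one_smul] at h2
    exact h2

/-- Torsion points are periodic. -/
theorem exists_iterate_g_eq {D : ℕ} (hD : 0 < D) {x : T2} (hx : D • x = 0) :
    ∃ P : ℕ, 0 < P ∧ N.g^[P] x = x := by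
  -- The `D`-torsion is finite and invariant, so the orbit repeats. Injectivity of `g` then removes
  -- the preperiod.
  have hfin : {y : T2 | D • y = 0}.Finite := by
    have h1 : {u : S1 | D • u = 0}.Finite := AddCircle.finite_torsion (p := (1 : ℝ)) hD
    refine (Set.Finite.pi fun _ : Fin 2 => h1).subset fun y hy i _ => ?_
    exact congrFun hy i
  have hmem : ∀ n : ℕ, N.g^[n] x ∈ {y : T2 | D • y = 0} := by
    intro n
    induction n with
    | zero => exact hx
    | succ n ih =>
      rw [Function.iterate_succ_apply']
      have hh : ∀ y : T2, D • y = 0 → D • N.g y = 0 := by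
        intro y hy
        ext i
        have : ∀ j, D • y j = 0 := fun j => congrFun hy j
        simp only [g, Pi.smul_apply, Finset.smul_sum, smul_comm D, this, smul_zero,
          Finset.sum_const_zero, Pi.zero_apply]
      exact hh _ ih
  obtain ⟨m, n, hmn, he⟩ := hfin.exists_lt_map_eq_of_forall_mem hmem
  refine ⟨n - m, by omega, ?_⟩
  have h2 : N.g^[m] (N.g^[n - m] x) = N.g^[m] x := by
    rw [← Function.iterate_add_apply, Nat.add_sub_cancel' hmn.le]; exact he.symm
  exact N.g_injective.iterate m h2

theorem dense_torsion : Dense {x : T2 | ∃ D : ℕ, 0 < D ∧ D • x = 0} := by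
  have hd : Dense {v : E2 | ∀ i, v i ∈ range ((↑) : ℚ → ℝ)} := by
    have h : Dense (pi univ fun _ : Fin 2 => range ((↑) : ℚ → ℝ)) :=
      dense_pi univ fun _ _ => Rat.denseRange_cast
    exact h.mono (by intro v hv i; exact hv i (mem_univ i))
  have h2 := isOpenQuotientMap_proj2.surjective.denseRange.dense_image continuous_proj2 hd
  refine h2.mono ?_
  rintro _ ⟨v, hv, rfl⟩
  choose a ha using hv
  refine ⟨(a 0).den * (a 1).den, Nat.mul_pos (a 0).pos (a 1).pos, ?_⟩
  ext i
  have key : ∀ (a : ℚ) (m : ℕ), (m * a.den) • ((a : ℝ) : S1) = 0 := by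
    intro a m
    rw [← AddCircle.coe_nsmul, ← AddCircle.coe_zero, coe_eq_coe_iff]
    refine ⟨m * a.num, ?_⟩
    have : (a : ℝ) * a.den = a.num := by exact_mod_cast Rat.mul_den_eq_num a
    simp only [nsmul_eq_mul]
    push_cast
    rw [← this]; ring
  fin_cases i
  · simp only [Pi.smul_apply, proj2, ← ha]
    rw [mul_comm]; exact key _ _
  · simp only [Pi.smul_apply, proj2, ← ha]
    exact key _ _

/-- The stable leaf of a fixed point is dense. -/
theorem exists_along_mem {y : T2} (hy : N.g y = y) {U : Set T2} (hU : IsOpen U) (hne : U.Nonempty) :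
    ∃ s : ℝ, N.along y s ∈ U := by
  obtain ⟨x, hxU, D, hD, hx⟩ := dense_torsion.inter_open_nonempty U hU hne
  obtain ⟨P, hP, hPx⟩ := N.exists_iterate_g_eq hD hx
  -- The unstable leaf of the periodic point `x` crosses the stable leaf of `y`. Under `g⁻ᴾᵐ` the
  -- crossing point tends to `x` along the former leaf and stays in the latter, at coordinate `lam ^
  -- (P * m) * s`.
  obtain ⟨u, s, hus⟩ := N.exists_alongU_eq_along x y
  have hl := N.lam_pos
  have hlim : Tendsto (fun m : ℕ => N.alongU x ((N.lam⁻¹ ^ P) ^ m * u)) atTop (𝓝 x) := by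
    have h1 : Tendsto (fun m : ℕ => (N.lam⁻¹ ^ P) ^ m * u) atTop (𝓝 (0 * u)) := by
      refine Tendsto.mul_const _ (tendsto_pow_atTop_nhds_zero_of_lt_one ?_ ?_)
      · positivity
      · exact pow_lt_one₀ N.lam_inv_pos.le (by linarith [N.lam_inv_lt]) hP.ne'
    have h2 := (N.continuous_alongU.tendsto (x, 0 * u)).comp (tendsto_const_nhds.prodMk_nhds h1)
    simpa [alongU_zero, Function.comp_def] using h2
  obtain ⟨m, hm⟩ := (hlim.eventually (hU.mem_nhds hxU)).exists
  refine ⟨N.lam ^ (P * m) * s, ?_⟩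
  have hxm : N.g^[P * m] x = x := by
    rw [Function.iterate_mul]; exact Function.iterate_fixed hPx m
  have hym : N.g^[P * m] y = y := Function.iterate_fixed hy _
  have heq : N.along y (N.lam ^ (P * m) * s) = N.alongU x ((N.lam⁻¹ ^ P) ^ m * u) := by
    apply N.g_injective.iterate (P * m)
    rw [iterate_g_along, iterate_g_alongU, hxm, hym, ← mul_assoc, ← mul_assoc, ← mul_pow,
      ← pow_mul, ← mul_pow, inv_mul_cancel₀ hl.ne', mul_inv_cancel₀ hl.ne', one_pow, one_mul, one_mul, hus]
  rw [heq]; exact hm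

end ToralAnosov

/-! ### Torus diffeomorphisms as homeomorphisms -/

theorem TorusDiffeo.continuous (f : TorusDiffeo) : Continuous f := by
  rw [isOpenQuotientMap_proj.isQuotientMap.continuous_iff]
  have : (f : T3 → T3) ∘ proj = proj ∘ f.lift := funext fun v => (f.proj_lift v).symm
  rw [this]
  exact isOpenQuotientMap_proj.continuous.comp f.lift_smooth.continuous

theorem TorusDiffeo.isOpenMap (f : TorusDiffeo) : IsOpenMap f :=
  (f.continuous.homeoOfEquivCompactToT2 (f := f.toPerm)).isOpenMap

theorem TorusDiffeo.continuous_symm (f : TorusDiffeo) : Continuous f.toPerm.symm :=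
  (f.continuous.homeoOfEquivCompactToT2 (f := f.toPerm)).symm.continuous

/-! ### The sequence of levels -/

namespace KanMap

variable {k : ℕ} (K : KanMap k)

theorem τ_add_mul (i n : ℤ) : K.τ (i + n * k) = K.τ i + n := by
  induction n using Int.induction_on with
  | zero => simp
  | succ n ih =>
    have := K.τ_period (i + n * k)
    rw [ih] at this
    rw [show i + (n + 1 : ℤ) * k = i + n * k + k by ring, this]
    push_cast; ring
  | pred n ih =>
    have := K.τ_period (i + (-n - 1) * k)
    rw [show i + (-n - 1 : ℤ) * k + k = i + -n * k by ring, ih] at this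
    push_cast at this ⊢
    linarith

theorem t_add_mul (i n : ℤ) : K.t (i + n * k) = K.t i := by
  unfold t
  exact coe_eq_coe_iff.2 ⟨n, K.τ_add_mul i n⟩

/-- Every height lies in one of the intervals `[τ i, τ (i + 1))`. -/
theorem exists_τ_le (a : ℝ) : ∃ i, K.τ i ≤ a ∧ a < K.τ (i + 1) := by
  have hb : ∃ b : ℤ, ∀ z : ℤ, K.τ z ≤ a → z ≤ b := by
    refine ⟨0 + ⌈a - K.τ 0⌉ * k, fun z hz => ?_⟩
    rw [← K.τ_strictMono.le_iff_le, K.τ_add_mul]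
    linarith [Int.le_ceil (a - K.τ 0)]
  have hi : ∃ z : ℤ, K.τ z ≤ a := by
    refine ⟨0 + ⌊a - K.τ 0⌋ * k, ?_⟩
    rw [K.τ_add_mul]
    linarith [Int.floor_le (a - K.τ 0)]
  obtain ⟨i, hi, hmax⟩ := Int.exists_greatest_of_bdd hb hi
  refine ⟨i, hi, ?_⟩
  by_contra! h
  have := hmax _ h
  omega

theorem τ_lt_add_one (hk : 1 < k) (i : ℤ) : K.τ (i + 1) < K.τ i + 1 := by
  rw [← K.τ_period]
  apply K.τ_strictMono
  omega

theorem τ_lt_succ (i : ℤ) : K.τ i < K.τ (i + 1) := K.τ_strictMono (by omega)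

theorem coe_eq_t_iff {a : ℝ} {i : ℤ} : (a : S1) = K.t i ↔ ∃ n : ℤ, a = K.τ (i + n * k) := by
  unfold t
  simp_rw [coe_eq_coe_iff, K.τ_add_mul]

end KanMap

/-- `h` is a lift to `T² × ℝ` of the second coordinate of `f`, that preserves the order with respect
to all levels `τ i`. -/
structure IsHeightLift {k : ℕ} (K : KanMap k) (f : T3 → T3) (h : T2 × ℝ → ℝ) : Prop where
  continuous : Continuous h
  coe_eq : ∀ z, (h z : S1) = (f (cyc z)).2
  fix : ∀ x i, h (x, K.τ i) = K.τ i
  lt_of_lt : ∀ z i, z.2 < K.τ i → h z < K.τ i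
  lt_of_gt : ∀ z i, K.τ i < z.2 → K.τ i < h z

/-- A height lift maps each interval `[τ i, τ (i + 1))` into itself, and this interval is shorter
than `1`. So its value is determined by the image point in the circle. This identifies the lifts of
`f₀` and `f₁` wherever the two maps agree. -/
theorem IsHeightLift.eq_of_eq {k : ℕ} (hk : 1 < k) {K : KanMap k} {f f' : T3 → T3} {h h' : T2 × ℝ → ℝ}
    (H : IsHeightLift K f h) (H' : IsHeightLift K f' h') {z : T2 × ℝ} (e : f (cyc z) = f' (cyc z)) :
    h z = h' z := by
  obtain ⟨i, hi, hi'⟩ := K.exists_τ_le z.2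
  have hlt := K.τ_lt_add_one hk i
  have bnd : ∀ {f h}, IsHeightLift K f h → K.τ i ≤ h z ∧ h z < K.τ (i + 1) := by
    intro f h H
    refine ⟨?_, H.lt_of_lt z _ hi'⟩
    rcases hi.eq_or_lt with h0 | h0
    · have : z = (z.1, K.τ i) := by ext <;> simp [h0]
      rw [this, H.fix]
    · exact (H.lt_of_gt z _ h0).le
  have b1 := bnd H
  have b2 := bnd H'
  refine coe_injOn ?_ (abs_lt.2 ⟨by linarith, by linarith⟩)
  rw [H.coe_eq, H'.coe_eq, e]

/-! ### Existence of height lifts -/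

section HeightLift

variable {k : ℕ} {K : KanMap k} {f : TorusDiffeo}

theorem mem_torus_iff (hf : ∀ i, f '' K.torus i = K.torus i)
    (z : T3) (i : ℤ) : f z ∈ K.torus i ↔ z ∈ K.torus i := by
  constructor
  · intro h
    rw [← hf i] at h
    obtain ⟨w, hw, e⟩ := h
    rwa [← f.toPerm.injective e]
  · intro h
    rw [← hf i]; exact mem_image_of_mem _ h

theorem lift_eq_τ_iff (hf : ∀ i, f '' K.torus i = K.torus i)
    (v : E3) (i : ℤ) :
    (∃ n : ℤ, (f.lift v).2 = K.τ (i + n * k)) ↔ ∃ n : ℤ, v.2 = K.τ (i + n * k) := by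
  rw [← K.coe_eq_t_iff, ← K.coe_eq_t_iff]
  have h1 := mem_torus_iff hf (proj v) i
  rw [← f.proj_lift] at h1
  exact h1

theorem lift_ne_τ (hf : ∀ i, f '' K.torus i = K.torus i)
    {v : E3} {i : ℤ} (h1 : K.τ i < v.2) (h2 : v.2 < K.τ (i + 1)) (l : ℤ) :
    (f.lift v).2 ≠ K.τ l := by
  intro h
  obtain ⟨n, hn⟩ := (lift_eq_τ_iff hf v l).1 ⟨0, by simpa using h⟩
  rw [hn] at h1 h2
  have h1' := K.τ_strictMono.lt_iff_lt.1 h1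
  have h2' := K.τ_strictMono.lt_iff_lt.1 h2
  omega

theorem continuous_lift_vertical (f : TorusDiffeo) (x : E2) : Continuous fun a : ℝ => (f.lift (x, a)).2 :=
  continuous_snd.comp (f.lift_smooth.continuous.comp (by fun_prop))

/-- On a vertical line, the lift moves all levels `τ i` by the same integer. -/
theorem exists_shift_vertical (hk : 2 < k) (hf : ∀ i, f '' K.torus i = K.torus i)
    (x : E2) :
    ∃ n : ℤ, ∀ i, (f.lift (x, K.τ i)).2 = K.τ i + n := by
  have h0 : ∀ i, ∃ n : ℤ, (f.lift (x, K.τ i)).2 = K.τ (i + n * k) := fun i =>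
    (lift_eq_τ_iff hf (x, K.τ i) i).2 ⟨0, by simp⟩
  choose n hn using h0
  have step : ∀ i, n (i + 1) = n i := by
    intro i
    have hc := (continuous_lift_vertical f x).continuousOn (s := Icc (K.τ i) (K.τ (i + 1)))
    have hlt := K.τ_lt_succ i
    rcases lt_trichotomy (n (i + 1)) (n i) with h | h | h
    · exfalso
      -- The index of the upper image level drops by at least `k`, and `k > 2` leaves room for
      -- another level strictly between the two images. By the intermediate value theorem, an
      -- interior point of the gap would be sent to that level.
      have hmem : K.τ (i + n i * k - 1) ∈ Ioo (f.lift (x, K.τ (i + 1))).2 (f.lift (x, K.τ i)).2 := by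
        rw [hn, hn]
        constructor
        · apply K.τ_strictMono; nlinarith
        · apply K.τ_strictMono; omega
      obtain ⟨a, ha, he⟩ := intermediate_value_Ioo' hlt.le hc hmem
      exact lift_ne_τ hf (v := (x, a)) ha.1 ha.2 _ he
    · exact h
    · exfalso
      have hmem : K.τ (i + n i * k + 1) ∈ Ioo (f.lift (x, K.τ i)).2 (f.lift (x, K.τ (i + 1))).2 := by
        rw [hn, hn]
        constructor
        · apply K.τ_strictMono; omega
        · apply K.τ_strictMono; nlinarith
      obtain ⟨a, ha, he⟩ := intermediate_value_Ioo hlt.le hc hmem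
      exact lift_ne_τ hf (v := (x, a)) ha.1 ha.2 _ he
  have hall : ∀ i, n i = n 0 := by
    intro i
    induction i using Int.induction_on with
    | zero => rfl
    | succ i ih => rw [step, ih]
    | pred i ih => rw [← ih, ← step]; congr 1; ring
  exact ⟨n 0, fun i => by rw [hn, hall, K.τ_add_mul]⟩

/-- If an interior point of a gap were sent out of the translated gap, the intermediate value
theorem would give an interior point sent exactly to a level, which `lift_ne_τ` excludes. -/
theorem lift_gap (hf : ∀ i, f '' K.torus i = K.torus i)
    {x : E2} {n : ℤ} (hn : ∀ i, (f.lift (x, K.τ i)).2 = K.τ i + n) {a : ℝ} {i : ℤ}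
    (h1 : K.τ i < a) (h2 : a < K.τ (i + 1)) :
    K.τ i + n < (f.lift (x, a)).2 ∧ (f.lift (x, a)).2 < K.τ (i + 1) + n := by
  have hc := continuous_lift_vertical f x
  have hne := lift_ne_τ hf (v := (x, a)) h1 h2
  constructor
  · by_contra! h
    have h' : (f.lift (x, a)).2 < K.τ i + n :=
      lt_of_le_of_ne h (by rw [← K.τ_add_mul]; exact hne _)
    have hmem : K.τ i + n ∈ Ioo (f.lift (x, a)).2 (f.lift (x, K.τ (i + 1))).2 :=
      ⟨h', by rw [hn]; linarith [K.τ_lt_succ i]⟩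
    obtain ⟨b, hb, he⟩ := intermediate_value_Ioo h2.le hc.continuousOn hmem
    refine lift_ne_τ hf (v := (x, b)) (h1.trans hb.1) hb.2 _ (he.trans (K.τ_add_mul _ _).symm)
  · by_contra! h
    have h' : K.τ (i + 1) + n < (f.lift (x, a)).2 :=
      lt_of_le_of_ne h (by rw [← K.τ_add_mul]; exact (hne _).symm)
    have hmem : K.τ (i + 1) + n ∈ Ioo (f.lift (x, K.τ i)).2 (f.lift (x, a)).2 :=
      ⟨by rw [hn]; linarith [K.τ_lt_succ i], h'⟩
    obtain ⟨b, hb, he⟩ := intermediate_value_Ioo h1.le hc.continuousOn hmem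
    refine lift_ne_τ hf (v := (x, b)) hb.1 (hb.2.trans h2) _ (he.trans (K.τ_add_mul _ _).symm)

/-- A diffeomorphism that preserves the tori `T² × {t_i}` has a height lift. -/
theorem exists_isHeightLift (hk : 2 < k) (hf : ∀ i, f '' K.torus i = K.torus i) :
    ∃ h : T2 × ℝ → ℝ, IsHeightLift K f h ∧ ∀ v : E2, ∃ n : ℤ, ∀ a : ℝ,
      h (proj2 v, a) = (f.lift (v, a)).2 - n := by
  choose n hn using fun x : E2 => exists_shift_vertical hk hf x
  have bnd : ∀ (v : E2) (a : ℝ) (i : ℤ), K.τ i ≤ a → a < K.τ (i + 1) →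
      K.τ i ≤ (f.lift (v, a)).2 - n v ∧ (f.lift (v, a)).2 - n v < K.τ (i + 1) := by
    intro v a i h1 h2
    rcases h1.eq_or_lt with h0 | h0
    · rw [← h0, hn]; have := K.τ_lt_succ i
      constructor <;> linarith
    · have := lift_gap hf (hn v) h0 h2
      constructor <;> linarith [this.1, this.2]
  have coe : ∀ (v : E2) (a : ℝ), (((f.lift (v, a)).2 - n v : ℝ) : S1) = (f (proj2 v, (a : S1))).2 := by
    intro v a
    have h1 : f (proj2 v, (a : S1)) = proj (f.lift (v, a)) := (f.proj_lift (v, a)).symm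
    rw [h1]
    exact coe_eq_coe_iff.2 ⟨-n v, by push_cast; ring⟩
  have wd : ∀ (v w : E2) (a : ℝ), proj2 v = proj2 w →
      (f.lift (v, a)).2 - n v = (f.lift (w, a)).2 - n w := by
    intro v w a e
    obtain ⟨i, hi, hi'⟩ := K.exists_τ_le a
    have b1 := bnd v a i hi hi'
    have b2 := bnd w a i hi hi'
    have hlt := K.τ_lt_add_one (by omega) i
    refine coe_injOn ?_ (abs_lt.2 ⟨by linarith, by linarith⟩)
    rw [coe, coe, e]
  -- The section is only set-theoretic. By `wd` the normalized height does not depend on it, and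
  -- continuity is checked upstairs through the quotient map.
  obtain ⟨sec, hsec⟩ := isOpenQuotientMap_proj2.surjective.hasRightInverse
  have key : ∀ (v : E2) (a : ℝ),
      (f.lift (sec (proj2 v), a)).2 - n (sec (proj2 v)) = (f.lift (v, a)).2 - n v :=
    fun v a => wd _ _ a (hsec _)
  have bnd' : ∀ (x : T2) (a : ℝ) (i : ℤ), K.τ i ≤ a → a < K.τ (i + 1) →
      K.τ i ≤ (f.lift (sec x, a)).2 - n (sec x) ∧ (f.lift (sec x, a)).2 - n (sec x) < K.τ (i + 1) :=
    fun x a i h1 h2 => bnd _ _ _ h1 h2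
  have hq : IsOpenQuotientMap (Prod.map proj2 (id : ℝ → ℝ)) :=
    isOpenQuotientMap_proj2.prodMap IsOpenQuotientMap.id
  -- The shift is a continuous integer-valued function on the connected plane.
  have nconst : ∀ v w : E2, n v = n w := by
    have hcont : Continuous fun v : E2 => (n v : ℝ) := by
      have : (fun v : E2 => (n v : ℝ)) = fun v => (f.lift (v, K.τ 0)).2 - K.τ 0 := by
        ext v; rw [hn]; ring
      rw [this]
      exact (continuous_snd.comp (f.lift_smooth.continuous.comp (by fun_prop))).sub continuous_const
    have hcn : Continuous n := by
      refine continuous_discrete_rng.2 fun b => ?_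
      have : n ⁻¹' {b} = (fun v : E2 => (n v : ℝ)) ⁻¹' (Ioo (b - 1 : ℝ) (b + 1)) := by
        ext v
        simp only [mem_preimage, mem_singleton_iff, mem_Ioo]
        constructor
        · rintro rfl; constructor <;> linarith
        · rintro ⟨h1, h2⟩
          have h1' : b - 1 < n v := by exact_mod_cast h1
          have h2' : n v < b + 1 := by exact_mod_cast h2
          omega
      rw [this]
      exact isOpen_Ioo.preimage hcont
    exact fun v w => PreconnectedSpace.constant inferInstance hcn
  refine ⟨fun z => (f.lift (sec z.1, z.2)).2 - n (sec z.1), ⟨?_, ?_, ?_, ?_, ?_⟩, ?_⟩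
  · rw [hq.isQuotientMap.continuous_iff]
    have : (fun z : T2 × ℝ => (f.lift (sec z.1, z.2)).2 - n (sec z.1)) ∘ Prod.map proj2 (id : ℝ → ℝ)
        = fun v : E3 => (f.lift v).2 - n 0 := by
      ext v
      simp only [Function.comp, Prod.map, id]
      rw [key, nconst v.1 0]
    rw [this]
    exact (continuous_snd.comp f.lift_smooth.continuous).sub continuous_const
  · intro z
    rw [coe, hsec]; rfl
  · intro x i
    simp [hn]
  · intro z i hz
    obtain ⟨l, hl, hl'⟩ := K.exists_τ_le z.2
    refine (bnd' z.1 z.2 l hl hl').2.trans_le ?_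
    have := K.τ_strictMono.lt_iff_lt.1 (hl.trans_lt hz)
    exact K.τ_strictMono.monotone (by omega)
  · intro z i hz
    obtain ⟨l, hl, hl'⟩ := K.exists_τ_le z.2
    rcases hl.eq_or_lt with h0 | h0
    · have : K.τ i < K.τ l := by rw [h0]; exact hz
      simpa [← h0, hn] using this
    · have h1 := lift_gap hf (hn (sec z.1)) h0 hl'
      have h2 : i < l + 1 := K.τ_strictMono.lt_iff_lt.1 (hz.trans hl')
      have h3 : K.τ i ≤ K.τ l := K.τ_strictMono.monotone (by omega)
      linarith [h1.1]
  · exact fun v => ⟨n v, fun a => key v a⟩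

end HeightLift

/-! ### Periodicity of the named points and separation of the balls -/

namespace KanMap

variable {k : ℕ} (K : KanMap k)

theorem p_add_two (i : ℤ) : K.p (i + 2) = K.p i := by rw [K.p_q i, K.q_p i]

theorem q_add_two (i : ℤ) : K.q (i + 2) = K.q i := by
  have h1 := K.p_q (i - 1)
  have h2 := K.p_q (i + 1)
  have h3 := K.p_add_two (i - 1)
  rw [show i - 1 + 1 = i by ring] at h1
  rw [show i + 1 + 1 = i + 2 by ring] at h2
  rw [show i - 1 + 2 = i + 1 by ring] at h3
  rw [← h2, h3, h1]

theorem r1_add_three (i : ℤ) : K.r1 (i + 3) = K.r1 i := by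
  rw [← K.rm_r1, ← K.r0_rm, ← K.r1_r0]

theorem r0_add_three (i : ℤ) : K.r0 (i + 3) = K.r0 i := by
  have h1 := K.r1_r0 (i - 1)
  have h2 := K.r1_r0 (i + 2)
  have h3 := K.r1_add_three (i - 1)
  rw [show i - 1 + 1 = i by ring] at h1
  rw [show i + 2 + 1 = i + 3 by ring] at h2
  rw [show i - 1 + 3 = i + 2 by ring] at h3
  rw [← h2, h3, h1]

theorem q_add_mul (hk6 : 6 ∣ k) (i n : ℤ) : K.q (i + n * k) = K.q i := by
  obtain ⟨m, rfl⟩ := hk6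
  have h : Function.Periodic K.q 2 := K.q_add_two
  have := h.int_mul (n * (3 * m)) i
  rw [← this]; congr 1; push_cast; ring

theorem r0_add_mul (hk6 : 6 ∣ k) (i n : ℤ) : K.r0 (i + n * k) = K.r0 i := by
  obtain ⟨m, rfl⟩ := hk6
  have h : Function.Periodic K.r0 3 := K.r0_add_three
  have := h.int_mul (n * (2 * m)) i
  rw [← this]; congr 1; push_cast; ring

theorem R0_add_mul (hk6 : 6 ∣ k) (i n : ℤ) : K.R0 (i + n * k) = K.R0 i := by
  simp only [R0, K.r0_add_mul hk6, K.t_add_mul]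

theorem Q_add_mul (hk6 : 6 ∣ k) (i n : ℤ) : K.Q (i + n * k) = K.Q i := by
  simp only [Q, K.q_add_mul hk6, K.t_add_mul]

/-- The family `q` has period 2 and `p l = q (l + 1)`, so the parity of `i - l` decides. This lets
separations stated at a single index be used for all pairs of indices. -/
theorem q_eq_or (i l : ℤ) : K.q i = K.q l ∨ K.q i = K.p l := by
  have h : Function.Periodic K.q 2 := K.q_add_two
  rcases Int.even_or_odd' (i - l) with ⟨n, hn | hn⟩
  · left
    have := h.int_mul n l
    rw [← this]; congr 1; push_cast; linarith
  · right
    have := h.int_mul n (l + 1)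
    rw [K.p_q, ← this]; congr 1; push_cast; linarith

theorem fix_p (i : ℤ) : K.N.g (K.p i) = K.p i := K.named_fixed i _ (by simp)
theorem fix_q (i : ℤ) : K.N.g (K.q i) = K.q i := K.named_fixed i _ (by simp)
theorem fix_rm (i : ℤ) : K.N.g (K.rm i) = K.rm i := K.named_fixed i _ (by simp)
theorem fix_r0 (i : ℤ) : K.N.g (K.r0 i) = K.r0 i := K.named_fixed i _ (by simp)
theorem fix_r1 (i : ℤ) : K.N.g (K.r1 i) = K.r1 i := K.named_fixed i _ (by simp)

theorem image_torus (i : ℤ) : K.f₀ '' K.torus i = K.torus i := by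
  have key : ∀ z ∈ K.torus i, K.f₀ z ∈ K.torus i := by
    rintro ⟨x, t⟩ hz
    have ht : t = K.t i := hz
    rw [K.fibered, ht]
    exact K.φ_fix x i
  refine Subset.antisymm (image_subset_iff.2 key) ?_
  rintro ⟨x, t⟩ hz
  have ht : t = (K.τ i : S1) := hz
  obtain ⟨⟨y, s⟩, hys⟩ := K.f₀.toPerm.surjective (x, t)
  have h1 : K.f₀ (y, (K.τ i : S1)) = (x, t) := by
    rw [K.fibered] at hys ⊢
    rw [K.φ_fix, ht]
    exact Prod.ext (Prod.ext_iff.1 hys).1 rfl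
  exact ⟨_, rfl, h1⟩

end KanMap

namespace FirstModification

variable {k : ℕ} {K : KanMap k} (M : FirstModification K)

theorem ε_pos : 0 < M.ε := by linarith [M.ε'_pos, M.ε'_le]

theorem ε_lt (hk : 1 < k) : M.ε < 1 / 10 := by
  linarith [M.ε_tori 0, K.τ_lt_add_one hk 0]

theorem abs_τ_sub {a b : ℤ} (h : a ≠ b) : 10 * M.ε < |K.τ a - K.τ b| := by
  wlog hab : b < a generalizing a b
  · rw [abs_sub_comm]; exact this h.symm (by omega)
  have h1 := M.ε_tori b
  have h2 : K.τ (b + 1) ≤ K.τ a := K.τ_strictMono.monotone (by omega)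
  rw [abs_of_pos (by linarith [K.τ_lt_succ b])]
  linarith

/-- The circle distance is `|τ l - (τ i + n)|` with `n` the nearest integer, and `τ i + n` is again
a level, namely `τ (i + n * k)`. Distinct levels are more than `10ε` apart. -/
theorem eq_add_mul_or_sep (l i : ℤ) : (∃ n : ℤ, l = i + n * k) ∨ 10 * M.ε < ‖K.t l - K.t i‖ := by
  unfold KanMap.t
  rw [← AddCircle.coe_sub, UnitAddCircle.norm_eq, sub_sub, ← K.τ_add_mul]
  by_cases h : l = i + round (K.τ l - K.τ i) * k
  · exact Or.inl ⟨_, h⟩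
  · exact Or.inr (M.abs_τ_sub h)

theorem R0_eq_or_sep (hk6 : 6 ∣ k) (l i : ℤ) :
    K.R0 l = K.R0 i ∨ 10 * M.ε < dist3 (K.R0 l) (K.R0 i) := by
  rcases M.eq_add_mul_or_sep l i with ⟨n, rfl⟩ | h
  · exact Or.inl (K.R0_add_mul hk6 i n)
  · exact Or.inr (h.trans_le (norm_snd_le_dist3 (K.R0 l) (K.R0 i)))

theorem points_sep (i : ℤ) :
    10 * M.ε < dist2 (K.p i) (K.r0 i) ∧ 10 * M.ε < dist2 (K.q i) (K.r0 i) ∧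
    10 * M.ε < dist2 (K.rm i) (K.r0 i) ∧ 10 * M.ε < dist2 (K.r1 i) (K.r0 i) := by
  have h := M.ε_points i
  simp only [List.pairwise_cons, List.mem_cons, forall_eq_or_imp] at h
  refine ⟨h.1.2.2.1, h.2.1.2.1, h.2.2.1.1, ?_⟩
  rw [dist2_comm]; exact h.2.2.2.1.1

theorem q_sep (i l : ℤ) : 10 * M.ε < dist2 (K.q i) (K.r0 l) := by
  rcases K.q_eq_or i l with h | h <;> rw [h]
  · exact (M.points_sep l).2.1
  · exact (M.points_sep l).1

/-- The point `z` is outside the balls in which `f₁` differs from `f₀`. -/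
def Far (z : T3) : Prop := ∀ i, z ∉ ball3 (K.R0 i) M.ε

theorem f₁_eq {z : T3} (h : M.Far z) : M.f₁ z = K.f₀ z := M.eq_outside z h

theorem le_dist3_of_far {z : T3} (h : M.Far z) (i : ℤ) : M.ε ≤ dist3 z (K.R0 i) := not_lt.1 (h i)

theorem far_of_horiz {z : T3} (h : ∀ l, M.ε ≤ dist2 z.1 (K.r0 l)) : M.Far z := fun l hl =>
  absurd (lt_of_le_of_lt (dist2_le_dist3 _ _) hl) (not_lt.2 (h l))

/-- A point close to the torus `T² × {t_j}` is far from the balls if it is far from `r0 j`. -/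
theorem far_of_near_torus (hk6 : 6 ∣ k) {z : T3} {j : ℤ} (h1 : M.ε ≤ dist2 z.1 (K.r0 j))
    (h2 : ‖z.2 - K.t j‖ ≤ 5 * M.ε) : M.Far z := by
  intro l hl
  rcases M.eq_add_mul_or_sep l j with ⟨n, rfl⟩ | h
  · rw [K.R0_add_mul hk6] at hl
    exact absurd (lt_of_le_of_lt (dist2_le_dist3 _ _) hl) (not_lt.2 h1)
  · have h3 : ‖z.2 - K.t l‖ < M.ε := (norm_snd_le_dist3 z (K.R0 l)).trans_lt hl
    have h4 := norm_sub_le_norm_sub_add_norm_sub (K.t l) z.2 (K.t j)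
    rw [norm_sub_rev (K.t l) z.2] at h4
    linarith [M.ε_pos]

/-! ### The drift of the modified map along the stable direction -/

/-- The displacement has length exactly `2ε`, the diameter of an open ball of radius `ε`, so it
leaves the ball. It is too short to reach another ball, whose centre is more than `10ε` away. -/
theorem far_along_two (hk : 1 < k) (hk6 : 6 ∣ k) {z : T3} {i : ℤ} (hz : z ∈ ball3 (K.R0 i) M.ε) :
    M.Far (K.N.along z.1 (2 * M.ε), z.2) := by
  have hε := M.ε_pos
  have hε' := M.ε_lt hk
  have h1 : dist3 (K.N.along z.1 (2 * M.ε), z.2) z = 2 * M.ε := by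
    have := dist3_same_height (K.N.along z.1 (2 * M.ε)) z.1 z.2
    rw [Prod.mk.eta] at this
    rw [this, K.N.dist2_along _ (by rw [abs_of_pos] <;> linarith), abs_of_pos (by linarith)]
  have hz' : dist3 z (K.R0 i) < M.ε := hz
  intro l hl
  have hl' : dist3 (K.N.along z.1 (2 * M.ε), z.2) (K.R0 l) < M.ε := hl
  rw [dist3_comm] at hl'
  have h2 := dist3_triangle (K.R0 l) (K.N.along z.1 (2 * M.ε), z.2) z
  have h3 := dist3_triangle (K.R0 l) z (K.R0 i)
  rcases M.R0_eq_or_sep hk6 l i with h | h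
  · rw [h] at hl'
    have h5 := dist3_triangle (K.N.along z.1 (2 * M.ε), z.2) (K.R0 i) z
    rw [dist3_comm _ (K.R0 i), dist3_comm (K.R0 i) z] at h5
    linarith
  · linarith

theorem exists_far_mem_leaf (hk : 1 < k) (hk6 : 6 ∣ k) (z : T3) :
    ∃ s, M.Far (K.N.along z.1 s, z.2) := by
  by_cases h : M.Far z
  · exact ⟨0, by rwa [K.N.along_zero]⟩
  · unfold Far at h
    push Not at h
    obtain ⟨i, hi⟩ := h
    exact ⟨_, M.far_along_two hk hk6 hi⟩

/-- The map `f₀⁻¹ ∘ f₁` preserves each leaf of the centre-stable foliation. -/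
theorem symm_f₁_mem_leaf (hk : 1 < k) (hk6 : 6 ∣ k) (z : T3) :
    ∃ s, (K.f₀.toPerm.symm (M.f₁ z)).1 = K.N.along z.1 s := by
  -- The leaf of `z` contains a point where `f₁ = f₀`. As `f₁` maps leaves to leaves, the image of
  -- the whole leaf is determined by this one point.
  obtain ⟨r, hr⟩ := M.exists_far_mem_leaf hk hk6 z
  have h1 : M.f₁ (K.N.along z.1 r, z.2) ∈ K.N.csLeaf (M.f₁ z) := by
    rw [← M.leaf]; exact mem_image_of_mem _ ⟨r, rfl⟩
  rw [M.f₁_eq hr, K.fibered] at h1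
  obtain ⟨s, hs⟩ := h1
  simp only [K.N.g_along] at hs
  set y := K.f₀.toPerm.symm (M.f₁ z) with hy
  have hy1 : K.N.g y.1 = (M.f₁ z).1 := by
    have h2 : K.f₀ y = M.f₁ z := K.f₀.toPerm.apply_symm_apply _
    rw [← h2, ← Prod.mk.eta (p := y), K.fibered]
  refine ⟨r - K.N.lam * s, K.N.g_injective ?_⟩
  rw [hy1, K.N.g_along, mul_sub, ← mul_assoc, inv_mul_cancel₀ K.N.lam_pos.ne', one_mul,
    sub_eq_add_neg, ← K.N.along_along, hs, K.N.along_along, add_neg_cancel, K.N.along_zero]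

/-- The bijection `f₀⁻¹ ∘ f₁` is the identity outside the balls, so it cannot send a point of their
union outside. -/
theorem not_far_symm_f₁ {z : T3} (h : ¬ M.Far z) : ¬ M.Far (K.f₀.toPerm.symm (M.f₁ z)) := by
  intro h1
  have h2 := M.f₁_eq h1
  have h3 : K.f₀ (K.f₀.toPerm.symm (M.f₁ z)) = M.f₁ z := K.f₀.toPerm.apply_symm_apply _
  rw [h3] at h2
  have h4 := M.f₁.toPerm.injective h2
  rw [h4] at h1
  exact h h1

end FirstModification

/-- A nonconstant continuous function takes all values in some interval, which has positive measure.
It is applied to the transverse coordinate of a path whose projection stays in one stable leaf. -/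
theorem eq_of_continuous_of_countable {h : ℝ → ℝ} (hc : Continuous h) {C : Set ℝ} (hC : C.Countable)
    (hm : ∀ r, h r ∈ C) (a b : ℝ) : h a = h b := by
  by_contra hne
  wlog hlt : h a < h b generalizing a b
  · exact this b a (Ne.symm hne) (lt_of_le_of_ne (not_lt.1 hlt) (Ne.symm hne))
  have h1 : Icc (h a) (h b) ⊆ C := by
    intro y hy
    obtain ⟨r, rfl⟩ := mem_range_of_exists_le_of_exists_ge hc ⟨a, hy.1⟩ ⟨b, hy.2⟩
    exact hm r
  have h2 := (hC.mono h1).measure_zero MeasureTheory.volume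
  rw [Real.volume_Icc, ENNReal.ofReal_eq_zero] at h2
  linarith

namespace FirstModification

variable {k : ℕ} {K : KanMap k} (M : FirstModification K)

/-- The path `f₀⁻¹ f₁ (x + r es, t)` is a continuous path in the stable leaf of `x`. -/
theorem exists_leaf_path (hk : 1 < k) (hk6 : 6 ∣ k) (z : T3) {r₀ : ℝ}
    (h₀ : M.Far (K.N.along z.1 r₀, z.2)) :
    ∃ μ : ℝ → ℝ, Continuous μ ∧ μ r₀ = r₀ ∧
      ∀ r, (K.f₀.toPerm.symm (M.f₁ (K.N.along z.1 r, z.2))).1 = K.N.along z.1 (μ r) := by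
  obtain ⟨⟨v, a⟩, rfl⟩ := isOpenQuotientMap_proj.surjective z
  obtain ⟨G, hG, hGp⟩ := K.f₀.inv_smooth
  set P : ℝ → E3 := fun r => G (M.f₁.lift (v + r • K.N.es, a)) with hP
  have hPc : Continuous P :=
    hG.continuous.comp (M.f₁.lift_smooth.continuous.comp (by fun_prop))
  have hPp : ∀ r, proj (P r) = K.f₀.toPerm.symm (M.f₁ (K.N.along (proj (v, a)).1 r, (proj (v, a)).2)) := by
    intro r
    rw [hP, hGp, M.f₁.proj_lift]
    simp only [proj, ToralAnosov.along, proj2_add]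
  have hex : ∀ r, ∃ (s : ℝ) (n : Fin 2 → ℤ), (P r).1 = v + s • K.N.es + fun i => (n i : ℝ) := by
    intro r
    obtain ⟨s, hs⟩ := M.symm_f₁_mem_leaf hk hk6 (K.N.along (proj (v, a)).1 r, (proj (v, a)).2)
    rw [← hPp] at hs
    simp only [K.N.along_along] at hs
    have : proj2 (P r).1 = proj2 (v + (r + s) • K.N.es) := by
      rw [proj2_add]; exact hs
    obtain ⟨n, hn⟩ := proj2_eq_iff.1 this
    exact ⟨_, n, hn⟩
  -- The preimage of the leaf in the plane is a countable union of parallel lines, so the continuous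
  -- path `P` stays in one of them.
  have hconst : ∀ r, K.N.uCoord (P r).1 = K.N.uCoord (P r₀).1 := by
    intro r
    refine eq_of_continuous_of_countable (h := fun r => K.N.uCoord (P r).1)
      (K.N.continuous_uCoord.comp (continuous_fst.comp hPc))
      (countable_range fun n : Fin 2 → ℤ => K.N.uCoord (v + fun i => (n i : ℝ))) ?_ r r₀
    intro r
    obtain ⟨s, n, h⟩ := hex r
    refine ⟨n, ?_⟩
    simp only
    rw [h, add_right_comm, K.N.uCoord_add_smul]
  have h₀' : proj2 (P r₀).1 = proj2 (v + r₀ • K.N.es) := by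
    have h1 := hPp r₀
    rw [M.f₁_eq h₀, Equiv.symm_apply_apply] at h1
    rw [proj2_add]
    exact congrArg Prod.fst h1
  obtain ⟨n, hn⟩ := proj2_eq_iff.1 h₀'
  -- The integer translate of `v` as seen from which the lifted path has coordinate exactly `r₀` at
  -- the parameter `r₀`.
  set w : E2 := v + fun i => (n i : ℝ) with hw
  have hn' : (P r₀).1 = w + r₀ • K.N.es := by rw [hn, hw, add_right_comm]
  refine ⟨fun r => ((P r).1 0 - w 0) * K.N.es 0 + ((P r).1 1 - w 1) * K.N.es 1, by fun_prop, ?_, ?_⟩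
  · have hs := K.N.es_unit
    rw [Fin.sum_univ_two] at hs
    simp only [hn', Pi.add_apply, Pi.smul_apply, smul_eq_mul]
    linear_combination r₀ * hs
  · intro r
    rw [← hPp]
    have h2 : K.N.uCoord (P r).1 = K.N.uCoord w := by
      rw [hconst, hn', K.N.uCoord_add_smul]
    have h3 := K.N.eq_smul_of_uCoord_eq h2
    have h4 : proj2 w = proj2 v := proj2_eq_iff.2 ⟨n, rfl⟩
    simp only [proj, ToralAnosov.along]
    conv_lhs => rw [h3]
    rw [proj2_add, h4]

/-- In each leaf, `f₁` differs from the linear map by a small drift in the stable direction. -/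
theorem exists_drift (hk : 1 < k) (hk6 : 6 ∣ k) (z : T3) :
    ∃ e : ℝ, |e| ≤ 2 / 5 * M.ε ∧ (M.f₁ z).1 = K.N.along (K.N.g z.1) e := by
  have hε := M.ε_pos
  have hε' := M.ε_lt hk
  by_cases hz : M.Far z
  · refine ⟨0, by simp; linarith, ?_⟩
    rw [M.f₁_eq hz, K.N.along_zero, ← Prod.mk.eta (p := z), K.fibered]
  have hz0 := hz
  unfold Far at hz
  push Not at hz
  obtain ⟨i, hi⟩ := hz
  -- The drift is measured by continuity along the leaf, starting from the point at distance `2ε`,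
  -- where `f₁ = f₀` and there is no drift, and moving back to `z`.
  obtain ⟨μ, hμ, hμ0, hμP⟩ := M.exists_leaf_path hk hk6 z (M.far_along_two hk hk6 hi)
  set p : ℝ → T3 := fun r => K.f₀.toPerm.symm (M.f₁ (K.N.along z.1 r, z.2)) with hp
  have hi' : dist3 z (K.R0 i) < M.ε := hi
  have hpc : Continuous p := by
    refine K.f₀.continuous_symm.comp (M.f₁.continuous.comp (Continuous.prodMk ?_ continuous_const))
    exact K.N.continuous_along.comp (continuous_const.prodMk continuous_id)
  have hDc : Continuous fun r => dist3 (p r) (K.R0 i) := (continuous_dist3 _).comp hpc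
  have hnear : ∀ r, ¬ M.Far (p r) → dist3 (p r) (K.R0 i) < M.ε ∨ 9 * M.ε < dist3 (p r) (K.R0 i) := by
    intro r h
    unfold Far at h
    push Not at h
    obtain ⟨l, hl⟩ := h
    have hl' : dist3 (p r) (K.R0 l) < M.ε := hl
    rcases M.R0_eq_or_sep hk6 l i with h | h
    · left; rwa [h] at hl'
    · right
      have := dist3_triangle (K.R0 l) (p r) (K.R0 i)
      rw [dist3_comm _ (p r)] at this
      linarith
  -- The path is either undisplaced or inside some ball, and the other balls are more than `9ε`
  -- away. The gap between `3ε` and `9ε` prevents a continuous path from changing ball.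
  have hdich : ∀ r ∈ Icc 0 (2 * M.ε), dist3 (p r) (K.R0 i) ≤ 3 * M.ε ∨
      9 * M.ε < dist3 (p r) (K.R0 i) := by
    intro r hr
    by_cases h : M.Far (K.N.along z.1 r, z.2)
    · left
      have h1 : p r = (K.N.along z.1 r, z.2) := by
        simp only [hp]; rw [M.f₁_eq h, Equiv.symm_apply_apply]
      have h2 := dist3_triangle (p r) z (K.R0 i)
      have h3 : dist3 (p r) z ≤ r := by
        rw [h1]
        have := dist3_same_height (K.N.along z.1 r) z.1 z.2
        rw [Prod.mk.eta] at this
        rw [this]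
        exact (K.N.dist2_along_le _ _).trans (abs_of_nonneg hr.1).le
      linarith [hr.2]
    · rcases hnear r (M.not_far_symm_f₁ h) with h | h
      · left; linarith
      · exact Or.inr h
  have hend : dist3 (p (2 * M.ε)) (K.R0 i) ≤ 3 * M.ε := by
    have h : M.Far (K.N.along z.1 (2 * M.ε), z.2) := M.far_along_two hk hk6 hi
    have h1 : p (2 * M.ε) = (K.N.along z.1 (2 * M.ε), z.2) := by
      simp only [hp]; rw [M.f₁_eq h, Equiv.symm_apply_apply]
    have h2 := dist3_triangle (p (2 * M.ε)) z (K.R0 i)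
    have h3 : dist3 (p (2 * M.ε)) z ≤ 2 * M.ε := by
      rw [h1]
      have := dist3_same_height (K.N.along z.1 (2 * M.ε)) z.1 z.2
      rw [Prod.mk.eta] at this
      rw [this]
      exact (K.N.dist2_along_le _ _).trans (abs_of_nonneg (by linarith)).le
    linarith
  have hall : ∀ r ∈ Icc 0 (2 * M.ε), dist3 (p r) (K.R0 i) ≤ 3 * M.ε := by
    intro r hr
    refine (hdich r hr).resolve_right fun h => ?_
    have hmem : 5 * M.ε ∈ Icc (dist3 (p (2 * M.ε)) (K.R0 i)) (dist3 (p r) (K.R0 i)) :=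
      ⟨by linarith, by linarith⟩
    obtain ⟨r', hr', he⟩ := intermediate_value_Icc' hr.2 hDc.continuousOn hmem
    rcases hdich r' ⟨hr.1.trans hr'.1, hr'.2⟩ with h | h
    · simp only at he; linarith
    · simp only at he; linarith
  have hdist : ∀ r ∈ Icc 0 (2 * M.ε), dist2 (K.N.along z.1 (μ r)) z.1 ≤ 4 * M.ε := by
    intro r hr
    have h1 := hall r hr
    have h2 := dist3_triangle (p r) (K.R0 i) z
    rw [dist3_comm (K.R0 i) z] at h2
    have h3 := dist2_le_dist3 (p r) z
    rw [← hμP r]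
    simp only [hp] at h1 h2 h3 ⊢
    linarith
  have h0mem : (0 : ℝ) ∈ Icc 0 (2 * M.ε) := ⟨le_rfl, by linarith⟩
  -- The leaf returns close to `z`, so a small distance in the torus does not by itself bound `μ`.
  -- But `|μ| = 5ε < 1 / 2` would mean distance exactly `5ε`, against the bound `4ε`, so `|μ|` never
  -- crosses this value.
  have hμ5 : |μ 0| ≤ 5 * M.ε := by
    by_contra! h
    have hmem : 5 * M.ε ∈ Icc |μ (2 * M.ε)| |μ 0| := by
      rw [hμ0]
      exact ⟨by rw [abs_of_pos] <;> linarith, h.le⟩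
    obtain ⟨r, hr, he⟩ := intermediate_value_Icc' (by linarith : (0 : ℝ) ≤ 2 * M.ε)
      hμ.abs.continuousOn hmem
    have he' : |μ r| = 5 * M.ε := he
    have h1 := hdist r hr
    rw [K.N.dist2_along _ (by rw [he']; linarith), he'] at h1
    linarith
  have hlast : dist3 (p 0) (K.R0 i) < M.ε := by
    have h1 := hall 0 h0mem
    refine (hnear 0 (M.not_far_symm_f₁ ?_)).resolve_right (by linarith)
    rwa [K.N.along_zero]
  have hμ2 : |μ 0| ≤ 2 * M.ε := by
    rw [← K.N.dist2_along z.1 (by linarith), ← hμP 0]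
    have h2 := dist3_triangle (p 0) (K.R0 i) z
    rw [dist3_comm (K.R0 i) z] at h2
    have h3 := dist2_le_dist3 (p 0) z
    simp only [hp] at h2 h3 hlast ⊢
    linarith
  -- The displacement of at most `2ε` occurs before `f₀`, which contracts it by `lam⁻¹ < 1 / 5`.
  refine ⟨K.N.lam⁻¹ * μ 0, ?_, ?_⟩
  · rw [abs_mul, abs_of_pos K.N.lam_inv_pos]
    have := K.N.lam_inv_lt
    have := K.N.lam_inv_pos
    nlinarith [abs_nonneg (μ 0)]
  · rw [← K.N.g_along, ← hμP 0, K.N.along_zero]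
    have h2 : K.f₀ (K.f₀.toPerm.symm (M.f₁ z)) = M.f₁ z := K.f₀.toPerm.apply_symm_apply _
    conv_lhs => rw [← h2, ← Prod.mk.eta (p := K.f₀.toPerm.symm (M.f₁ z)), K.fibered]

end FirstModification

/-! ### Time-one maps of vertical vector fields -/

section Vertical

variable {X : T3 → ℝ} {ρ : T3 → T3}

/-- `c` is an integral curve of `X ∂/∂t` on the line above `x`. -/
def IsVertCurve (X : T3 → ℝ) (x : T2) (c : ℝ → ℝ) : Prop :=
  ∀ u, HasDerivAt c (X (x, (c u : S1))) u

/-- The derivative along the circle is periodic and continuous, hence bounded. The global Lipschitz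
bound gives uniqueness of integral curves. -/
theorem exists_lipschitz_vertical (hX : ContDiff ℝ ∞ fun v : E3 => X (proj v)) (x : T2) :
    ∃ C, LipschitzWith C fun a : ℝ => X (x, (a : S1)) := by
  obtain ⟨v, rfl⟩ := isOpenQuotientMap_proj2.surjective x
  set Ψ : ℝ → ℝ := fun a => X (proj2 v, (a : S1)) with hΨ
  have hsm : ContDiff ℝ ∞ Ψ := hX.comp (contDiff_const.prodMk contDiff_id)
  have hper : Function.Periodic Ψ 1 := fun a => by simp [hΨ]
  have hper' : Function.Periodic (deriv Ψ) 1 := fun a => by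
    rw [← deriv_comp_add_const]
    congr 1
    exact funext hper
  have hc : Continuous (deriv Ψ) := hsm.continuous_deriv (by simp)
  obtain ⟨C, hC⟩ := isCompact_Icc.exists_bound_of_continuousOn (hc.continuousOn (s := Icc (0 : ℝ) 1))
  refine ⟨C.toNNReal, lipschitzWith_of_nnnorm_deriv_le (hsm.differentiable (by simp)) fun a => ?_⟩
  obtain ⟨b, hb, e⟩ := hper'.exists_mem_Ico₀ one_pos a
  rw [e, ← NNReal.coe_le_coe]
  exact (hC b ⟨hb.1, hb.2.le⟩).trans (Real.le_coe_toNNReal C)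

theorem IsVertCurve.eq (hX : ContDiff ℝ ∞ fun v : E3 => X (proj v)) {x : T2} {c c' : ℝ → ℝ}
    (hc : IsVertCurve X x c) (hc' : IsVertCurve X x c') {u : ℝ} (h : c u = c' u) : c = c' := by
  obtain ⟨C, hC⟩ := exists_lipschitz_vertical hX x
  exact ODE_solution_unique_univ (v := fun _ a => X (x, (a : S1))) (s := fun _ => univ) (K := C)
    (fun _ => hC.lipschitzOnWith) (fun t => ⟨hc t, mem_univ _⟩) (fun t => ⟨hc' t, mem_univ _⟩) h

theorem IsVertCurve.add_int {x : T2} {c : ℝ → ℝ} (hc : IsVertCurve X x c) (n : ℤ) :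
    IsVertCurve X x fun u => c u + n := by
  intro u
  have h : ((c u + n : ℝ) : S1) = (c u : S1) := coe_eq_coe_iff.2 ⟨n, rfl⟩
  rw [h]
  exact (hc u).add_const _

theorem IsVertCurve.comp_add {x : T2} {c : ℝ → ℝ} (hc : IsVertCurve X x c) (r : ℝ) :
    IsVertCurve X x fun u => c (u + r) := fun u => (hc (u + r)).comp_add_const u r

theorem IsVertCurve.const {x : T2} {s : ℝ} (h : X (x, (s : S1)) = 0) :
    IsVertCurve X x fun _ => s := by
  intro u
  rw [h]; exact hasDerivAt_const _ _

theorem IsVertCurve.monotone (h0 : ∀ z, 0 ≤ X z) {x : T2} {c : ℝ → ℝ} (hc : IsVertCurve X x c) :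
    Monotone c :=
  monotone_of_deriv_nonneg (fun u => (hc u).differentiableAt) fun u => by
    rw [(hc u).deriv]; exact h0 _

/-- By uniform continuity of `X`, an integral curve on a nearby vertical line is an approximate
solution on the given one, and Grönwall's inequality compares them at time one. -/
theorem tendsto_timeOne (hX : ContDiff ℝ ∞ fun v : E3 => X (proj v)) {c : T2 × ℝ → ℝ → ℝ}
    (hc : ∀ z, IsVertCurve X z.1 (c z)) (hc0 : ∀ z, c z 0 = z.2) : Continuous fun z => c z 1 := by
  have hXc : Continuous X := by
    rw [isOpenQuotientMap_proj.isQuotientMap.continuous_iff]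
    exact hX.continuous
  have hu := CompactSpace.uniformContinuous_of_continuous hXc
  rw [continuous_iff_continuousAt]
  intro z₀
  obtain ⟨C, hC⟩ := exists_lipschitz_vertical hX z₀.1
  -- A nonzero constant, so that the explicit form of `gronwallBound` applies.
  set D : NNReal := C + 1
  have hD : LipschitzWith D fun a : ℝ => X (z₀.1, (a : S1)) := hC.weaken (by simp [D])
  have hD0 : (D : ℝ) ≠ 0 := by simp [D]; positivity
  have bound : ∀ ε > 0, ∀ᶠ z in 𝓝 z₀,
      dist (c z 1) (c z₀ 1) ≤ gronwallBound (dist z.2 z₀.2) D (ε + 0) (1 - 0) := by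
    intro ε hε
    obtain ⟨r, hr, hr'⟩ := Metric.uniformContinuous_iff.1 hu ε hε
    filter_upwards [Metric.ball_mem_nhds z₀ hr] with z hz
    refine dist_le_of_approx_trajectories_ODE (v := fun _ a => X (z₀.1, (a : S1)))
      (f := c z) (g := c z₀) (a := 0) (b := 1) (f' := fun u => X (z.1, (c z u : S1)))
      (g' := fun u => X (z₀.1, (c z₀ u : S1))) (fun _ => hD)
      (fun u _ => (hc z u).continuousAt.continuousWithinAt)
      (fun u _ => (hc z u).hasDerivWithinAt) ?_
      (fun u _ => (hc z₀ u).continuousAt.continuousWithinAt)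
      (fun u _ => (hc z₀ u).hasDerivWithinAt) ?_ ?_ 1 (by simp)
    · intro u _
      refine (hr' ?_).le
      rw [Prod.dist_eq, dist_self]
      rw [Metric.mem_ball, Prod.dist_eq] at hz
      exact max_lt (lt_of_le_of_lt (le_max_left _ _) hz) hr
    · intro u _
      rw [dist_self]
    · rw [hc0, hc0]
  rw [ContinuousAt, Metric.tendsto_nhds]
  intro e he
  have hE : 0 < Real.exp D := Real.exp_pos _
  have hD0' : (0 : ℝ) < D := lt_of_le_of_ne D.2 hD0.symm
  -- Chosen so that the approximation term `ε / D * (exp D - 1)` is at most `e / 2`.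
  set ε : ℝ := e / 2 * D / Real.exp D with hεdef
  have hε : 0 < ε := by positivity
  have hd : ∀ᶠ z in 𝓝 z₀, dist z.2 z₀.2 < e / 2 / Real.exp D :=
    (continuous_snd.tendsto z₀).eventually (Metric.ball_mem_nhds z₀.2 (by positivity))
  filter_upwards [bound ε hε, hd] with z h1 h2
  refine h1.trans_lt ?_
  rw [gronwallBound_of_K_ne_0 hD0]
  simp only [add_zero, sub_zero, mul_one]
  have h3 : dist z.2 z₀.2 * Real.exp D < e / 2 := by rwa [lt_div_iff₀ hE] at h2
  have h4 : ε / D * (Real.exp D - 1) ≤ e / 2 := by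
    have : ε / D * Real.exp D = e / 2 := by rw [hεdef]; field_simp
    have : 0 < ε / D := by positivity
    nlinarith
  linarith

/-- The time-one map of a nonnegative vertical vector field lifts to `T² × ℝ`. -/
theorem exists_push (hX : ContDiff ℝ ∞ fun v : E3 => X (proj v)) (h0 : ∀ z, 0 ≤ X z)
    (hρ : IsVerticalTimeOneMap X ρ) :
    IsOpenMap ρ ∧ ∃ h : T2 × ℝ → ℝ, Continuous h ∧ (∀ z, ρ (cyc z) = cyc (z.1, h z)) ∧
      (∀ z, z.2 ≤ h z) ∧ (∀ z, X (cyc z) = 0 → h z = z.2) ∧ (∀ z, 0 < X (cyc z) → z.2 < h z) ∧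
      ∀ x, StrictMono fun a => h (x, a) := by
  choose c hc0 hc hcρ using fun z : T2 × ℝ => hρ z.1 z.2
  have hc' : ∀ z, IsVertCurve X z.1 (c z) := hc
  have hcont : Continuous fun z => c z 1 := tendsto_timeOne hX hc' hc0
  have hinj : ∀ x, Function.Injective fun a => c (x, a) 1 := by
    intro x a b hab
    have := congrFun ((hc' (x, a)).eq hX (hc' (x, b)) (u := 1) hab) 0
    rwa [hc0, hc0] at this
  have hle : ∀ z, z.2 ≤ c z 1 := fun z => by
    have := (hc' z).monotone h0 (zero_le_one)
    rwa [hc0] at this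
  have hint : ∀ x a (n : ℤ), c (x, a + n) 1 = c (x, a) 1 + n := by
    intro x a n
    have h1 := (hc' (x, a + n)).eq hX ((hc' (x, a)).add_int n) (u := 0) (by simp [hc0])
    exact congrFun h1 1
  have hmono : ∀ x, StrictMono fun a => c (x, a) 1 := by
    intro x
    have hcx : Continuous fun a => c (x, a) 1 := hcont.comp (by fun_prop : Continuous fun a : ℝ => (x, a))
    -- A decreasing map cannot commute with the translation by `1`.
    refine (hcx.strictMono_of_inj (hinj x)).resolve_right fun h => ?_
    have h1 := h (zero_lt_one (α := ℝ))
    have h2 := hint x 0 1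
    simp only [zero_add, Int.cast_one] at h1 h2
    linarith
  have hρcyc : ∀ z, ρ (cyc z) = cyc (z.1, c z 1) := hcρ
  have hρc : Continuous ρ := by
    rw [isOpenQuotientMap_cyc.isQuotientMap.continuous_iff]
    have : ρ ∘ cyc = cyc ∘ fun z => (z.1, c z 1) := funext hρcyc
    rw [this]
    exact continuous_cyc.comp (continuous_fst.prodMk hcont)
  have hρi : Function.Injective ρ := by
    intro z w hzw
    obtain ⟨⟨x, a⟩, rfl⟩ := isOpenQuotientMap_cyc.surjective z
    obtain ⟨⟨y, b⟩, rfl⟩ := isOpenQuotientMap_cyc.surjective w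
    rw [hρcyc, hρcyc] at hzw
    have h1 : x = y := congrArg Prod.fst hzw
    have h2 : ((c (x, a) 1 : ℝ) : S1) = (c (y, b) 1 : ℝ) := congrArg Prod.snd hzw
    subst h1
    obtain ⟨n, hn⟩ := coe_eq_coe_iff.1 h2
    rw [← hint] at hn
    have h3 := hinj x hn
    exact Prod.ext rfl (coe_eq_coe_iff.2 ⟨n, h3⟩)
  have hρs : Function.Surjective ρ := by
    intro z
    obtain ⟨⟨x, a⟩, rfl⟩ := isOpenQuotientMap_cyc.surjective z
    refine ⟨cyc (x, c (x, a) (-1)), ?_⟩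
    rw [hρcyc]
    have h1 := (hc' (x, c (x, a) (-1))).eq hX ((hc' (x, a)).comp_add (-1)) (u := 0) (by simp [hc0])
    have h2 := congrFun h1 1
    simp only [add_neg_cancel, hc0] at h2
    simp only [h2]
  refine ⟨?_, fun z => c z 1, hcont, hρcyc, hle, ?_, ?_, hmono⟩
  · exact (hρc.homeoOfEquivCompactToT2 (f := Equiv.ofBijective ρ ⟨hρi, hρs⟩)).isOpenMap
  · intro z hz
    have := (hc' z).eq hX (IsVertCurve.const (x := z.1) (s := z.2) hz) (u := 0) (hc0 z)
    exact congrFun this 1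
  · intro z hz
    refine lt_of_le_of_ne (hle z) fun h => ?_
    have hm := (hc' z).monotone h0
    -- A nondecreasing curve with equal values at times 0 and 1 is constant in between, so its
    -- derivative at the interior time `1 / 2` vanishes, although `X` is positive there.
    have hcst : ∀ u ∈ Icc (0 : ℝ) 1, c z u = z.2 := fun u hu =>
      le_antisymm ((hm hu.2).trans h.symm.le) ((hc0 z).symm.le.trans (hm hu.1))
    have h1 : HasDerivAt (c z) 0 (1 / 2) := by
      refine (hasDerivAt_const (1 / 2 : ℝ) z.2).congr_of_eventuallyEq ?_
      filter_upwards [Icc_mem_nhds (show (0 : ℝ) < 1 / 2 by norm_num) (show (1 / 2 : ℝ) < 1 by norm_num)]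
        with u hu using hcst u hu
    have h2 := h1.unique (hc' z (1 / 2))
    rw [hcst (1 / 2) ⟨by norm_num, by norm_num⟩] at h2
    exact hz.ne h2

end Vertical

/-- The covering is injective on an interval shorter than `1`. Every cluster point of the lifted
sequence projects to the limit, hence equals `b`, and compactness gives convergence. -/
theorem tendsto_of_tendsto_coe {α β b : ℝ} (hαβ : β - α < 1) (hb : b ∈ Icc α β) {a : ℕ → ℝ}
    (ha : ∀ n, a n ∈ Icc α β) (h : Tendsto (fun n => (a n : S1)) atTop (𝓝 (b : S1))) :
    Tendsto a atTop (𝓝 b) := by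
  refine isCompact_Icc.tendsto_nhds_of_unique_mapClusterPt (Eventually.of_forall ha) fun y hy hcl => ?_
  have h1 : MapClusterPt (y : S1) atTop (fun n => (a n : S1)) :=
    hcl.continuousAt_comp (isOpenQuotientMap_coe.continuous.continuousAt)
  have h2 : (y : S1) = (b : S1) := by
    by_contra hne
    have h3 := h1.clusterPt.mono h
    rw [ClusterPt, (disjoint_nhds_nhds.2 hne).eq_bot] at h3
    exact h3.ne rfl
  exact coe_injOn h2 (abs_lt.2 ⟨by linarith [hy.1, hb.2], by linarith [hy.2, hb.1]⟩)

/-! ### The lift of the fibered map -/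

/-- A height lift of `f₀`, with its derivative along the fibers. -/
structure IsFiberLift {k : ℕ} (K : KanMap k) (h : T2 × ℝ → ℝ) : Prop extends
    IsHeightLift K K.f₀ h where
  hasDerivAt : ∀ (v : E2) (a : ℝ), HasDerivAt (fun a => h (proj2 v, a)) (K.f₀.fiberDeriv (v, a)) a

theorem exists_isFiberLift {k : ℕ} (hk : 2 < k) (K : KanMap k) : ∃ h, IsFiberLift K h := by
  obtain ⟨h, hh, hl⟩ := exists_isHeightLift hk K.image_torus
  refine ⟨h, hh, fun v a => ?_⟩
  obtain ⟨n, hn⟩ := hl v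
  have h1 : HasFDerivAt K.f₀.lift (K.f₀.D (v, a)) (v, a) :=
    (K.f₀.lift_smooth.differentiable (by simp)).differentiableAt.hasFDerivAt
  have h2 : HasDerivAt (fun a : ℝ => ((v, a) : E3)) (0, 1) a :=
    (hasDerivAt_const a v).prodMk (hasDerivAt_id a)
  have h3 : HasDerivAt (fun a : ℝ => (K.f₀.lift (v, a)).2) (K.f₀.D (v, a) (0, 1)).2 a :=
    (ContinuousLinearMap.snd ℝ E2 ℝ).hasFDerivAt.comp_hasDerivAt a (h1.comp_hasDerivAt a h2)
  rw [funext hn]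
  exact h3.sub_const _

namespace IsFiberLift

variable {k : ℕ} {K : KanMap k} {h : T2 × ℝ → ℝ}

/-- Rolle's theorem and the lower bound `1 / 2` on the fiber derivative give injectivity, and the
fixed levels exclude a decreasing map. -/
theorem strictMono (H : IsFiberLift K h) (x : T2) : StrictMono fun a => h (x, a) := by
  obtain ⟨v, rfl⟩ := isOpenQuotientMap_proj2.surjective x
  have hinj : Function.Injective fun a => h (proj2 v, a) := by
    have key : ∀ a b, a < b → h (proj2 v, a) ≠ h (proj2 v, b) := by
      intro a b hab e
      obtain ⟨c, -, hc⟩ := exists_hasDerivAt_eq_zero hab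
        (fun x _ => (H.hasDerivAt v x).continuousAt.continuousWithinAt) e fun x _ => H.hasDerivAt v x
      have := (K.fiberDeriv_bounds (v, c)).1
      rw [hc, abs_zero] at this
      linarith
    intro a b e
    rcases lt_trichotomy a b with hab | hab | hab
    · exact absurd e (key _ _ hab)
    · exact hab
    · exact absurd e.symm (key _ _ hab)
  have hc : Continuous fun a => h (proj2 v, a) :=
    H.continuous.comp (by fun_prop : Continuous fun a : ℝ => (proj2 v, a))
  refine (hc.strictMono_of_inj hinj).resolve_right fun hanti => ?_
  have h1 := hanti (K.τ_lt_succ 0)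
  simp only [H.fix] at h1
  exact absurd (K.τ_lt_succ 0) (not_lt.2 h1.le)

theorem cyc_eq (H : IsFiberLift K h) (z : T2 × ℝ) : cyc (K.N.g z.1, h z) = K.f₀ (cyc z) := by
  have h1 := H.coe_eq z
  unfold cyc at h1 ⊢
  rw [K.fibered] at h1 ⊢
  rw [h1]

/-- Over a fixed point of the base, orbits under the lift are lifts of orbits. -/
theorem iterate_fiber (H : IsFiberLift K h) {x : T2} (hx : K.N.g x = x) (a : ℝ) (n : ℕ) :
    K.f₀^[n] (x, (a : S1)) = (x, (((fun a => h (x, a))^[n] a : ℝ) : S1)) := by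
  induction n with
  | zero => rfl
  | succ n ih =>
    rw [Function.iterate_succ_apply', ih, Function.iterate_succ_apply']
    have := H.cyc_eq (x, (fun a => h (x, a))^[n] a)
    simp only [cyc, hx] at this
    exact this.symm

theorem iterate_mem_Ioo (H : IsFiberLift K h) (x : T2) {i l : ℤ} {a : ℝ} (ha : a ∈ Ioo (K.τ i) (K.τ l)) (n : ℕ) :
    (fun a => h (x, a))^[n] a ∈ Ioo (K.τ i) (K.τ l) := by
  induction n with
  | zero => exact ha
  | succ n ih =>
    rw [Function.iterate_succ_apply']
    exact ⟨H.lt_of_gt (x, _) _ ih.1, H.lt_of_lt (x, _) _ ih.2⟩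

theorem tendsto_iterate (H : IsFiberLift K h) (hk : 1 < k) {x : T2} (hx : K.N.g x = x) {i l : ℤ} {a : ℝ}
    (ha : a ∈ Ioo (K.τ i) (K.τ (i + 1))) (hl : K.τ l ∈ Icc (K.τ i) (K.τ (i + 1)))
    (hs : (x, (a : S1)) ∈ stableSet K.f₀ (x, (K.τ l : S1))) :
    Tendsto (fun n => (fun a => h (x, a))^[n] a) atTop (𝓝 (K.τ l)) := by
  have hlt := K.τ_lt_add_one hk i
  refine tendsto_of_tendsto_coe (α := K.τ i) (β := K.τ (i + 1)) (by linarith) hl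
    (fun n => Ioo_subset_Icc_self (H.iterate_mem_Ioo x ha n)) ?_
  have h1 : Tendsto (fun n => (K.f₀^[n] (x, (a : S1))).2) atTop (𝓝 (K.τ l : S1)) :=
    (continuous_snd.tendsto _).comp hs
  simpa only [H.iterate_fiber hx] using h1

/-- By monotonicity, a point that does not move up has its whole orbit below itself, so this orbit
cannot converge to a higher point. -/
theorem lt_of_tendsto_right (H : IsFiberLift K h) {x : T2} {a b : ℝ} (hab : a < b)
    (ht : Tendsto (fun n => (fun a => h (x, a))^[n] a) atTop (𝓝 b)) : a < h (x, a) := by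
  by_contra! hle
  have hall : ∀ n, (fun a => h (x, a))^[n] a ≤ a := by
    intro n
    induction n with
    | zero => exact le_rfl
    | succ n ih =>
      rw [Function.iterate_succ_apply']
      exact ((H.strictMono x).monotone ih).trans hle
  exact absurd hab (not_lt.2 (le_of_tendsto' ht hall))

end IsFiberLift

theorem mem_arc {a α β : ℝ} (h : a ∈ Ioo α β) : (a : S1) ∈ arc α β := mem_image_of_mem _ h

namespace IsFiberLift

variable {k : ℕ} {K : KanMap k} {h : T2 × ℝ → ℝ}

/-- On the circle over `r0 j`, points between `τ (j - 1)` and `τ (j + 1)` move up, except `τ j`. -/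
theorem lt_on_circle (H : IsFiberLift K h) (hk : 1 < k) {j : ℤ} {a : ℝ} (ha : a ∈ Ioo (K.τ (j - 1)) (K.τ (j + 1)))
    (hne : a ≠ K.τ j) : a < h (K.r0 j, a) := by
  have hj := K.τ_lt_succ j
  have hj' := K.τ_lt_succ (j - 1)
  -- One circle plays three roles: `r1 (j - 1)` below, `r0 j` in the middle, `rm (j + 1)` above. The
  -- connections `connect_d` and `connect_c` cover the two arcs.
  have hrm : K.rm (j + 1) = K.r0 j := by
    have := K.r0_rm (j - 1)
    rw [show j - 1 + 1 = j by ring, show j - 1 + 2 = j + 1 by ring] at this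
    exact this.symm
  have hr1 : K.r1 (j - 1) = K.r0 j := by
    have := K.r1_r0 (j - 1)
    rwa [show j - 1 + 1 = j by ring] at this
  rw [show j - 1 + 1 = j by ring] at hj'
  rcases lt_or_gt_of_ne hne with hlt | hgt
  · have hm : a ∈ Ioo (K.τ (j - 1)) (K.τ (j - 1 + 1)) := ⟨ha.1, by simpa using hlt⟩
    have h1 := (K.connect_d (j - 1) a (mem_arc hm)).2
    rw [hr1, show j - 1 + 1 = j by ring] at h1
    exact H.lt_of_tendsto_right hlt (H.tendsto_iterate hk (K.fix_r0 j) hm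
      (by simpa using hj'.le) h1)
  · have hm : a ∈ Ioo (K.τ j) (K.τ (j + 1)) := ⟨hgt, ha.2⟩
    have h1 := (K.connect_c j a (mem_arc hm)).2
    rw [hrm] at h1
    exact H.lt_of_tendsto_right ha.2 (H.tendsto_iterate hk (K.fix_r0 j) hm
      (by simpa using hj.le) h1)

/-- On the circle over `q i`, points between `τ (i - 1)` and `τ (i + 1)` converge to `τ i`. -/
theorem tendsto_on_q_circle (H : IsFiberLift K h) (hk : 1 < k) {i : ℤ} {a : ℝ} (ha : a ∈ Ioo (K.τ (i - 1)) (K.τ (i + 1))) :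
    Tendsto (fun n => (fun a => h (K.q i, a))^[n] a) atTop (𝓝 (K.τ i)) := by
  have hj := K.τ_lt_succ i
  have hj' := K.τ_lt_succ (i - 1)
  have hp : K.p (i - 1) = K.q i := by
    have := K.p_q (i - 1)
    rwa [show i - 1 + 1 = i by ring] at this
  rw [show i - 1 + 1 = i by ring] at hj'
  rcases lt_trichotomy a (K.τ i) with hlt | rfl | hgt
  · have hm : a ∈ Ioo (K.τ (i - 1)) (K.τ (i - 1 + 1)) := ⟨ha.1, by simpa using hlt⟩
    have h1 := (K.connect_a (i - 1) a (mem_arc hm)).2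
    rw [hp, show i - 1 + 1 = i by ring] at h1
    exact H.tendsto_iterate hk (K.fix_q i) hm (by simpa using hj'.le) h1
  · have : ∀ n, (fun a => h (K.q i, a))^[n] (K.τ i) = K.τ i :=
      fun n => Function.iterate_fixed (H.fix _ _) n
    simp only [this, tendsto_const_nhds]
  · have hm : a ∈ Ioo (K.τ i) (K.τ (i + 1)) := ⟨hgt, ha.2⟩
    have h1 := (K.connect_b i a (mem_arc hm)).1
    exact H.tendsto_iterate hk (K.fix_q i) hm (by simpa using hj.le) h1

end IsFiberLift

/-! ### The lift of the perturbed map -/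

/-- The properties of a lift `F` to `T² × ℝ` of the perturbed map `f` that are used in the study of
its dynamics; `h` is the height lift of `f₀`. -/
structure IsLift {k : ℕ} {K : KanMap k} (M : FirstModification K) (h : T2 × ℝ → ℝ)
    (f : T3 → T3) (F : T2 × ℝ → T2 × ℝ) : Prop where
  isOpenMap : IsOpenMap f
  continuous : Continuous F
  cyc_eq : ∀ z, cyc (F z) = f (cyc z)
  drift : ∀ z, ∃ e : ℝ, |e| ≤ 2 / 5 * M.ε ∧ (F z).1 = K.N.along (K.N.g z.1) e
  above : ∀ z i, K.τ i < z.2 → K.τ i < (F z).2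
  far : ∀ z, M.Far (cyc z) → M.Far (K.f₀ (cyc z)) → F z = (K.N.g z.1, h z)
  attractor : ∀ j x (n : ℕ), (x, K.t j) ∉ unstableSet M.f₁ (K.R0 j) → (F^[n] (x, K.τ j)).2 = K.τ j
  circle : ∀ j a, a ∈ Ioo (K.τ (j - 1)) (K.τ (j + 1)) →
    (F (K.r0 j, a)).1 = K.r0 j ∧ a < (F (K.r0 j, a)).2 ∧ (F (K.r0 j, a)).2 < K.τ (j + 1)

section Perturbation

variable {k : ℕ} {K : KanMap k} {M : FirstModification K} {η : Fin k → T3 → ℝ}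

theorem sum_bump_eq_zero (hη : ∀ j : Fin k, IsBump (K.R0 (j : ℕ)) M.ε' (η j)) {z : T3}
    (hz : ∀ i, z ∉ ball3 (K.R0 i) M.ε') : ∑ j, η j z = 0 :=
  Finset.sum_eq_zero fun j _ => (hη j).2.2.2 z (hz _)

theorem FirstModification.Far.notMem {z : T3} (h : M.Far z) (i : ℤ) : z ∉ ball3 (K.R0 i) M.ε' := by
  intro hi
  have h1 : dist3 z (K.R0 i) < M.ε' := hi
  have h2 := M.le_dist3_of_far h i
  linarith [M.ε'_le, M.ε'_pos]

theorem notMem_of_torus (hk6 : 6 ∣ k) {z : T3} {j : ℤ} (hz : z ∈ K.torus j \ ball3 (K.R0 j) M.ε')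
    (i : ℤ) : z ∉ ball3 (K.R0 i) M.ε' := by
  intro hi
  rcases M.eq_add_mul_or_sep j i with ⟨n, rfl⟩ | h
  · rw [K.R0_add_mul hk6] at hz; exact hz.2 hi
  · have h1 : dist3 z (K.R0 i) < M.ε' := hi
    have h2 := norm_snd_le_dist3 z (K.R0 i)
    have h3 : z.2 = K.t j := hz.1
    rw [h3] at h2
    have h4 : (K.R0 i).2 = K.t i := rfl
    rw [h4] at h2
    linarith [M.ε'_le, M.ε'_pos]

theorem sum_bump_pos (hk6 : 6 ∣ k) (hk : 0 < k)
    (hη : ∀ j : Fin k, IsBump (K.R0 (j : ℕ)) M.ε' (η j)) (i : ℤ) : 0 < ∑ j, η j (K.R0 i) := by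
  have hk0 : (0 : ℤ) < k := by exact_mod_cast hk
  have h1 := Int.emod_nonneg i hk0.ne'
  have h2 := Int.emod_lt_of_pos i hk0
  set j : Fin k := ⟨(i % k).toNat, by omega⟩ with hj
  have hji : K.R0 ((j : ℕ) : ℤ) = K.R0 i := by
    have h3 : (((j : ℕ) : ℤ)) = i % k := by simp [hj, h1]
    rw [h3, ← K.R0_add_mul hk6 (i % k) (i / k)]
    congr 1
    have := Int.mul_ediv_add_emod i k
    linarith
  refine Finset.sum_pos' (fun l _ => ((hη l).2.1 _).1) ⟨j, Finset.mem_univ _, ?_⟩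
  rw [(hη j).2.2.1 (K.R0 i)]
  · exact one_pos
  · change dist3 (K.R0 i) _ < _
    rw [hji, dist3_self]
    linarith [M.ε'_pos]

/-- The top of the circle arc over `r0 j` is outside the balls. -/
theorem far_top (M : FirstModification K) (hk6 : 6 ∣ k) (j : ℤ) : M.Far (K.r0 j, K.t (j + 1)) := by
  refine M.far_of_near_torus hk6 (j := j + 1) ?_ ?_
  · rw [← K.r1_r0, dist2_comm]
    linarith [(M.points_sep j).2.2.2, M.ε_pos]
  · simp only [sub_self, norm_zero]; linarith [M.ε_pos]

/-- The attractor hypothesis keeps the whole orbit outside the balls that support `ρ`, so there `f`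
acts as `f₁` and the torus stays invariant along this orbit. -/
theorem iterate_f₁_mem {j : ℤ} {x : T2} (hx : (x, K.t j) ∉ unstableSet M.f₁ (K.R0 j)) (n : ℕ) :
    M.f₁^[n] (x, K.t j) ∈ K.torus j \ ball3 (K.R0 j) M.ε' := by
  have h1 : (x, K.t j) ∈ K.torus j \ unstableSet M.f₁ (K.R0 j) := ⟨rfl, hx⟩
  rw [← M.attractor] at h1
  have h2 := h1 n
  rwa [zpow_natCast, ← Equiv.Perm.iterate_eq_pow] at h2

/-- The lift of `f` combines the height lift `h₁` of `f₁` with the push `w` of `ρ`, in the order of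
composition. On the circle over `r0 j` one has `f₁ = f₀`, which moves up every point between the
neighbouring levels except `τ j`. At `τ j` the push is strictly positive, while it fixes `τ (j +
1)`, so the rise is strict and bounded. -/
theorem exists_isLift (hk : 2 < k) (hk6 : 6 ∣ k)
    (hη : ∀ j : Fin k, IsBump (K.R0 (j : ℕ)) M.ε' (η j)) {δ : ℝ} (hδ : 0 < δ) {ρ f : T3 → T3}
    (hρ : IsVerticalTimeOneMap (fun z => δ * ∑ j, η j z) ρ) (hf : f = ρ ∘ M.f₁ ∨ f = M.f₁ ∘ ρ)
    {h : T2 × ℝ → ℝ} (H : IsFiberLift K h) : ∃ F, IsLift M h f F := by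
  set X : T3 → ℝ := fun z => δ * ∑ j, η j z with hX
  have hXs : ContDiff ℝ ∞ fun v : E3 => X (proj v) :=
    contDiff_const.mul (ContDiff.sum fun j _ => (hη j).1)
  have hX0 : ∀ z, 0 ≤ X z := fun z =>
    mul_nonneg hδ.le (Finset.sum_nonneg fun j _ => ((hη j).2.1 z).1)
  have hXz : ∀ z, (∀ i, z ∉ ball3 (K.R0 i) M.ε') → X z = 0 := fun z hz => by
    simp [hX, sum_bump_eq_zero hη hz]
  have hXp : ∀ i, 0 < X (K.R0 i) := fun i => mul_pos hδ (sum_bump_pos hk6 (by omega) hη i)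
  obtain ⟨hρo, w, hwc, hwρ, hwle, hw0, hwlt, hwm⟩ := exists_push hXs hX0 hρ
  obtain ⟨h₁, H₁, -⟩ := exists_isHeightLift hk M.torus_inv
  have hk1 : 1 < k := by omega
  have hcirc : ∀ j a, M.f₁ (cyc (K.r0 j, a)) = K.f₀ (cyc (K.r0 j, a)) := fun j a => M.circle j _
  have hcirc1 : ∀ j a, (M.f₁ (cyc (K.r0 j, a))).1 = K.r0 j := fun j a => by
    rw [hcirc j a]
    unfold cyc
    rw [K.fibered, K.fix_r0]
  have hcirch : ∀ j a, h₁ (K.r0 j, a) = h (K.r0 j, a) := fun j a =>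
    H₁.eq_of_eq hk1 H.toIsHeightLift (hcirc j a)
  have htop : ∀ j, w (K.r0 j, K.τ (j + 1)) = K.τ (j + 1) := fun j =>
    hw0 _ (hXz _ (far_top M hk6 j).notMem)
  have hmid : ∀ j, K.τ j < w (K.r0 j, K.τ j) := fun j => hwlt (K.r0 j, K.τ j) (hXp j)
  have hup : ∀ j a, a ∈ Ioo (K.τ (j - 1)) (K.τ (j + 1)) → a ≤ h (K.r0 j, a) := by
    intro j a ha
    by_cases hne : a = K.τ j
    · rw [hne, H.fix]
    · exact (H.lt_on_circle hk1 ha hne).le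
  have hcont₁ : Continuous fun z : T2 × ℝ => (M.f₁ (cyc z)).1 :=
    continuous_fst.comp (M.f₁.continuous.comp continuous_cyc)
  have hcyc₁ : ∀ z, cyc ((M.f₁ (cyc z)).1, h₁ z) = M.f₁ (cyc z) := fun z =>
    Prod.ext rfl (H₁.coe_eq z)
  have hfarz : ∀ z, M.Far (cyc z) → ((M.f₁ (cyc z)).1, h₁ z) = (K.N.g z.1, h z) := by
    intro z hz
    rw [H₁.eq_of_eq hk1 H.toIsHeightLift (M.f₁_eq hz), M.f₁_eq hz, ← H.cyc_eq]; rfl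
  -- Both a point of the orbit and its image avoid the support of `ρ`. Requiring both conditions
  -- covers the two orders of composition at once.
  have hatt : ∀ j x (n : ℕ), (x, K.t j) ∉ unstableSet M.f₁ (K.R0 j) → ∀ F : T2 × ℝ → T2 × ℝ,
      (∀ y, (y, K.t j) ∈ K.torus j \ ball3 (K.R0 j) M.ε' →
        M.f₁ (y, K.t j) ∈ K.torus j \ ball3 (K.R0 j) M.ε' →
        F (y, K.τ j) = ((M.f₁ (y, K.t j)).1, K.τ j)) →
      F^[n] (x, K.τ j) = ((M.f₁^[n] (x, K.t j)).1, K.τ j) := by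
    intro j x n hx F hF
    induction n with
    | zero => rfl
    | succ n ih =>
      have m1 := iterate_f₁_mem hx n
      have m2 := iterate_f₁_mem hx (n + 1)
      rw [Function.iterate_succ_apply'] at m2
      rw [Function.iterate_succ_apply', ih, Function.iterate_succ_apply']
      have e : M.f₁^[n] (x, K.t j) = ((M.f₁^[n] (x, K.t j)).1, K.t j) := Prod.ext rfl m1.1
      rw [e] at m1 m2
      rw [hF _ m1 m2, ← e]
  rcases hf with rfl | rfl
  · refine ⟨fun z => ((M.f₁ (cyc z)).1, w ((M.f₁ (cyc z)).1, h₁ z)), hρo.comp M.f₁.isOpenMap,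
      hcont₁.prodMk (hwc.comp (hcont₁.prodMk H₁.continuous)), ?_, ?_, ?_, ?_, ?_, ?_⟩
    · intro z
      have := hwρ ((M.f₁ (cyc z)).1, h₁ z)
      rw [hcyc₁] at this
      exact this.symm
    · intro z
      exact M.exists_drift hk1 hk6 (cyc z)
    · intro z i hz
      exact (H₁.lt_of_gt z i hz).trans_le (hwle (_, h₁ z))
    · intro z hz hz'
      have e := hfarz z hz
      have e1 : (M.f₁ (cyc z)).1 = K.N.g z.1 := congrArg Prod.fst e
      rw [e, e1, hw0 _ (hXz _ _)]
      rw [H.cyc_eq]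
      exact hz'.notMem
    · intro j x n hx
      rw [hatt j x n hx]
      intro y hy hy'
      have e : M.f₁ (cyc (y, K.τ j)) = cyc ((M.f₁ (y, K.t j)).1, K.τ j) := Prod.ext rfl hy'.1
      have e2 : cyc (y, K.τ j) = (y, K.t j) := rfl
      simp only [H₁.fix]
      rw [e2, hw0 _ (hXz _ _)]
      rw [← e]
      exact notMem_of_torus hk6 hy'
    · intro j a ha
      simp only [hcirc1, hcirch, true_and]
      have hj := hup j a ha
      have hlt : h (K.r0 j, a) < K.τ (j + 1) := H.lt_of_lt (K.r0 j, a) _ ha.2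
      constructor
      · by_cases hne : a = K.τ j
        · rw [hne, H.fix]; exact hmid j
        · exact (H.lt_on_circle hk1 ha hne).trans_le (hwle (K.r0 j, h (K.r0 j, a)))
      · have := hwm (K.r0 j) hlt
        simpa only [htop] using this
  · have hwcyc : Continuous fun z : T2 × ℝ => (z.1, w z) := continuous_fst.prodMk hwc
    refine ⟨fun z => ((M.f₁ (cyc (z.1, w z))).1, h₁ (z.1, w z)), M.f₁.isOpenMap.comp hρo,
      (hcont₁.comp hwcyc).prodMk (H₁.continuous.comp hwcyc), ?_, ?_, ?_, ?_, ?_, ?_⟩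
    · intro z
      rw [Function.comp_apply, hwρ]
      exact hcyc₁ _
    · intro z
      exact M.exists_drift hk1 hk6 (cyc (z.1, w z))
    · intro z i hz
      exact H₁.lt_of_gt _ i (hz.trans_le (hwle _))
    · intro z hz hz'
      have e : (z.1, w z) = z := Prod.ext rfl (hw0 z (hXz _ hz.notMem))
      simp only [e]
      exact hfarz z hz
    · intro j x n hx
      rw [hatt j x n hx]
      intro y hy hy'
      have e : w (y, K.τ j) = K.τ j := hw0 (y, K.τ j) (hXz _ (notMem_of_torus hk6 hy))
      simp only [e, H₁.fix]
      rfl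
    · intro j a ha
      simp only [hcirc1, hcirch, true_and]
      have hlt : w (K.r0 j, a) < K.τ (j + 1) := by
        have := hwm (K.r0 j) ha.2
        simpa only [htop] using this
      have hle := hwle (K.r0 j, a)
      have hm : w (K.r0 j, a) ∈ Ioo (K.τ (j - 1)) (K.τ (j + 1)) := ⟨ha.1.trans_le hle, hlt⟩
      refine ⟨?_, H.lt_of_lt (K.r0 j, _) _ hlt⟩
      by_cases hne : a = K.τ j
      · have := hmid j
        rw [← hne] at this
        exact this.trans_le (hup j _ hm)
      · rcases hle.eq_or_lt with e | e
        · simp only at e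
          rw [← e]; exact H.lt_on_circle hk1 ha hne
        · exact lt_of_lt_of_le e (hup j _ hm)

end Perturbation

/-! ### Contraction and expansion along the fibers -/

theorem TorusDiffeo.continuous_fiberDeriv (f : TorusDiffeo) : Continuous f.fiberDeriv := by
  have h1 : Continuous fun v => fderiv ℝ f.lift v := f.lift_smooth.continuous_fderiv (by simp)
  exact continuous_snd.comp (h1.clm_apply continuous_const)

namespace IsFiberLift

variable {k : ℕ} {K : KanMap k} {h : T2 × ℝ → ℝ}

theorem abs_sub_le (H : IsFiberLift K h) (x : T2) (a : ℝ) (j : ℤ) :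
    |h (x, a) - K.τ j| ≤ 3 / 2 * |a - K.τ j| := by
  obtain ⟨v, rfl⟩ := isOpenQuotientMap_proj2.surjective x
  have := Convex.norm_image_sub_le_of_norm_hasDerivWithin_le (s := univ)
    (fun b _ => (H.hasDerivAt v b).hasDerivWithinAt)
    (fun b _ => (K.fiberDeriv_bounds (v, b)).2.le) convex_univ (mem_univ (K.τ j)) (mem_univ a)
  simpa only [H.fix, Real.norm_eq_abs] using this

theorem eventually_fiberDeriv (K : KanMap k) {v : E2} {j : ℤ} {O : Set ℝ} (hO : IsOpen O)
    (hv : |K.f₀.fiberDeriv (v, K.τ j)| ∈ O) :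
    ∃ κ > 0, ∀ s u a : ℝ, |s| ≤ κ → |u| ≤ κ → |a - K.τ j| ≤ κ →
      |K.f₀.fiberDeriv (v + u • K.N.eu + s • K.N.es, a)| ∈ O := by
  have hcont : Continuous fun p : ℝ × ℝ × ℝ =>
      |K.f₀.fiberDeriv (v + p.2.1 • K.N.eu + p.1 • K.N.es, p.2.2)| :=
    (K.f₀.continuous_fiberDeriv.comp (by fun_prop)).abs
  have hmem := hcont.continuousAt.preimage_mem_nhds (x := ((0 : ℝ), (0 : ℝ), K.τ j))
    (hO.mem_nhds (by simpa using hv))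
  obtain ⟨κ, hκ, hsub⟩ := Metric.nhds_basis_closedBall.mem_iff.1 hmem
  refine ⟨κ, hκ, fun s u a hs hu ha => ?_⟩
  refine hsub (show (s, u, a) ∈ _ from ?_)
  simp only [Metric.mem_closedBall, Prod.dist_eq, Real.dist_eq, sub_zero]
  exact max_le hs (max_le hu ha)

/-- By continuity the derivative bound persists in a box in unstable, stable and vertical
coordinates, and the mean value inequality is applied from the fixed level. -/
theorem exists_contraction (H : IsFiberLift K h) {c : T2} {j : ℤ}
    (hc : ∀ v, proj v = (c, K.t j) → |K.f₀.fiberDeriv v| < 1) :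
    ∃ κ > 0, ∃ θ : ℝ, 0 ≤ θ ∧ θ < 1 ∧ ∀ s u a : ℝ, |s| ≤ κ → |u| ≤ κ → |a - K.τ j| ≤ κ →
      |h (K.N.along (K.N.alongU c u) s, a) - K.τ j| ≤ θ * |a - K.τ j| := by
  obtain ⟨v, rfl⟩ := isOpenQuotientMap_proj2.surjective c
  obtain ⟨θ, hθ, hθ1⟩ := exists_between (hc (v, K.τ j) rfl)
  obtain ⟨κ, hκ, hv⟩ := eventually_fiberDeriv K (O := Iio θ) isOpen_Iio hθ
  refine ⟨κ, hκ, θ, (abs_nonneg _).trans hθ.le, hθ1, fun s u a hs hu ha => ?_⟩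
  have e : K.N.along (K.N.alongU (proj2 v) u) s = proj2 (v + u • K.N.eu + s • K.N.es) := by
    simp only [ToralAnosov.along, ToralAnosov.alongU, proj2_add]
  have := Convex.norm_image_sub_le_of_norm_hasDerivWithin_le (s := Metric.closedBall (K.τ j) κ)
    (fun b _ => (H.hasDerivAt (v + u • K.N.eu + s • K.N.es) b).hasDerivWithinAt)
    (fun b hb => (hv s u b hs hu hb).le) (convex_closedBall _ _)
    (Metric.mem_closedBall_self hκ.le) (show a ∈ Metric.closedBall (K.τ j) κ from ha)
  rw [e]
  simpa only [H.fix, Real.norm_eq_abs] using this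

/-- On either side of the fixed level, a secant slope is equal to a derivative, whose absolute value
exceeds `θ` near `(c, t_j)`. -/
theorem exists_expansion (H : IsFiberLift K h) {c : T2} {j : ℤ}
    (hc : ∀ v, proj v = (c, K.t j) → 1 < |K.f₀.fiberDeriv v|) :
    ∃ κ > 0, ∃ θ : ℝ, 1 < θ ∧ ∀ s a : ℝ, |s| ≤ κ → |a - K.τ j| ≤ κ →
      θ * |a - K.τ j| ≤ |h (K.N.along c s, a) - K.τ j| := by
  obtain ⟨v, rfl⟩ := isOpenQuotientMap_proj2.surjective c
  obtain ⟨θ, hθ1, hθ⟩ := exists_between (hc (v, K.τ j) rfl)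
  obtain ⟨κ, hκ, hv⟩ := eventually_fiberDeriv K (O := Ioi θ) isOpen_Ioi hθ
  refine ⟨κ, hκ, θ, hθ1, fun s a hs ha => ?_⟩
  have e : K.N.along (proj2 v) s = proj2 (v + s • K.N.es) := by
    simp only [ToralAnosov.along, proj2_add]
  rw [e]
  have hv' : ∀ b, |b - K.τ j| ≤ κ → θ < |K.f₀.fiberDeriv (v + s • K.N.es, b)| := fun b hb => by
    have := hv s 0 b hs (by simpa using hκ.le) hb
    simpa using this
  have hd := H.hasDerivAt (v + s • K.N.es)
  have hcont : Continuous fun a => h (proj2 (v + s • K.N.es), a) :=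
    continuous_iff_continuousAt.2 fun b => (hd b).continuousAt
  obtain ⟨hl, hr⟩ := abs_le.1 ha
  have slope : ∀ {b d : ℝ}, b < d → (∀ y ∈ Ioo b d, |y - K.τ j| ≤ κ) →
      θ * (d - b) ≤ |h (proj2 (v + s • K.N.es), d) - h (proj2 (v + s • K.N.es), b)| := by
    intro b d hbd hy
    obtain ⟨y, hy1, hy2⟩ := exists_hasDerivAt_eq_slope _ _ hbd hcont.continuousOn fun y _ => hd y
    have h1 := hv' y (hy y hy1)
    rw [hy2, abs_div, abs_of_pos (sub_pos.2 hbd), lt_div_iff₀ (sub_pos.2 hbd)] at h1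
    exact h1.le
  rcases lt_trichotomy a (K.τ j) with hlt | heq | hgt
  · have := slope hlt fun y hy => abs_le.2 ⟨by linarith [hy.1], by linarith [hy.2]⟩
    rw [H.fix, abs_sub_comm (K.τ j)] at this
    rwa [abs_of_neg (sub_neg.2 hlt), neg_sub]
  · simp [heq]
  · have := slope hgt fun y hy => abs_le.2 ⟨by linarith [hy.1], by linarith [hy.2]⟩
    rw [H.fix] at this
    rwa [abs_of_pos (sub_pos.2 hgt)]

end IsFiberLift

/-! ### Iterates of the lift and accumulated drift -/

theorem tendsto_inv_lam_pow (N : ToralAnosov) (s : ℝ) :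
    Tendsto (fun n : ℕ => N.lam⁻¹ ^ n * s) atTop (𝓝 0) := by
  have := (tendsto_pow_atTop_nhds_zero_of_lt_one N.lam_inv_pos.le
    (by linarith [N.lam_inv_lt])).mul_const s
  simpa using this

theorem abs_inv_lam_pow_mul_le (N : ToralAnosov) (n : ℕ) (s : ℝ) : |N.lam⁻¹ ^ n * s| ≤ |s| := by
  rw [abs_mul, abs_of_nonneg (pow_nonneg N.lam_inv_pos.le n)]
  exact mul_le_of_le_one_left (abs_nonneg s)
    (pow_le_one₀ N.lam_inv_pos.le (by linarith [N.lam_inv_lt]))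

namespace IsLift

variable {k : ℕ} {K : KanMap k} {M : FirstModification K} {h : T2 × ℝ → ℝ} {f : T3 → T3}
  {F : T2 × ℝ → T2 × ℝ}

theorem cyc_iterate (L : IsLift M h f F) (n : ℕ) (z : T2 × ℝ) : cyc (F^[n] z) = f^[n] (cyc z) := by
  have : Function.Semiconj cyc F f := L.cyc_eq
  exact this.iterate_right n z

theorem isOpen_iterate (L : IsLift M h f F) (n : ℕ) {U : Set T3} (hU : IsOpen U) :
    IsOpen (f^[n] '' U) := by
  induction n with
  | zero => simpa using hU
  | succ n ih => rw [Function.iterate_succ', image_comp]; exact L.isOpenMap _ ih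

/-- The bound `ε / 2` is the fixed value of `S ↦ S / 5 + 2ε / 5`: each step contracts the earlier
displacement by more than 5 and adds a new one. -/
theorem iterate_drift (L : IsLift M h f F) (n : ℕ) (z : T2 × ℝ) :
    ∃ S : ℝ, |S| ≤ M.ε / 2 ∧ (F^[n] z).1 = K.N.along (K.N.g^[n] z.1) S := by
  induction n with
  | zero => exact ⟨0, by simpa using (half_pos M.ε_pos).le, by simp [K.N.along_zero]⟩
  | succ n ih =>
    obtain ⟨S, hS, e⟩ := ih
    obtain ⟨d, hd, e'⟩ := L.drift (F^[n] z)
    refine ⟨K.N.lam⁻¹ * S + d, ?_, ?_⟩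
    · have h1 : |K.N.lam⁻¹ * S| ≤ 1 / 5 * (M.ε / 2) := by
        rw [abs_mul, abs_of_pos K.N.lam_inv_pos]
        have := K.N.lam_inv_lt
        gcongr
      have := abs_add_le (K.N.lam⁻¹ * S) d
      linarith
    · rw [Function.iterate_succ_apply', Function.iterate_succ_apply', e', e, K.N.g_along,
        K.N.along_along]

theorem iterate_above (L : IsLift M h f F) {z : T2 × ℝ} {i : ℤ} (hz : K.τ i < z.2) (n : ℕ) :
    K.τ i < (F^[n] z).2 := by
  induction n with
  | zero => exact hz
  | succ n ih => rw [Function.iterate_succ_apply']; exact L.above _ _ ih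

theorem continuous_iterate (L : IsLift M h f F) (n : ℕ) : Continuous F^[n] := L.continuous.iterate n

end IsLift

/-! ### Points whose stable set is open in its centre-stable leaf -/

/-- The fixed point `(c, t_j)` is attracting along its circle, and far from `r0 j`. -/
structure IsSink {k : ℕ} {K : KanMap k} (M : FirstModification K) (c : T2) (j : ℤ) : Prop where
  fix : K.N.g c = c
  deriv : ∀ v, proj v = (c, K.t j) → |K.f₀.fiberDeriv v| < 1
  sep : 10 * M.ε < dist2 c (K.r0 j)

section Sink

variable {k : ℕ} {K : KanMap k} {M : FirstModification K} {h : T2 × ℝ → ℝ} {f : T3 → T3}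
  {F : T2 × ℝ → T2 × ℝ}

theorem isSink_q (M : FirstModification K) (j : ℤ) : IsSink M (K.q j) j :=
  ⟨K.fix_q j, K.deriv_q j, (M.points_sep j).2.1⟩

theorem isSink_rm (M : FirstModification K) (j : ℤ) : IsSink M (K.rm j) j :=
  ⟨K.fix_rm j, K.deriv_rm j, (M.points_sep j).2.2.1⟩

theorem far_near (hk6 : 6 ∣ k) {c : T2} {j : ℤ} (hsep : 10 * M.ε < dist2 c (K.r0 j)) {s u a : ℝ}
    (hs : |s| ≤ 2 * M.ε) (hu : |u| ≤ M.ε) (ha : |a - K.τ j| ≤ 5 * M.ε) :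
    M.Far (cyc (K.N.along (K.N.alongU c u) s, a)) := by
  refine M.far_of_near_torus hk6 (j := j) ?_ ?_
  · have h1 := K.N.dist2_along_le (K.N.alongU c u) s
    have h2 := K.N.dist2_alongU_le c u
    have h3 := dist2_triangle c (K.N.alongU c u) (K.r0 j)
    have h4 := dist2_triangle (K.N.alongU c u) (K.N.along (K.N.alongU c u) s) (K.r0 j)
    rw [dist2_comm] at h1 h2
    have := M.ε_pos
    simp only [cyc]
    linarith
  · have : (cyc (K.N.along (K.N.alongU c u) s, a)).2 - K.t j = ((a - K.τ j : ℝ) : S1) := by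
      simp [cyc, KanMap.t]
    rw [this]
    exact (norm_coe_le_abs _).trans ha

/-- Near a sink the lift is linear in the base and contracts heights towards `τ j`. The condition
`lam * κ ≤ ε` keeps the image away from the balls too, as the field `far` of `IsLift` requires. -/
theorem IsSink.exists_box (hk6 : 6 ∣ k) (H : IsFiberLift K h) (L : IsLift M h f F) {c : T2} {j : ℤ}
    (hc : IsSink M c j) :
    ∃ κ > 0, κ ≤ M.ε ∧ K.N.lam * κ ≤ M.ε ∧ ∃ θ : ℝ, 0 ≤ θ ∧ θ < 1 ∧ ∀ s u a : ℝ,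
      |s| ≤ κ → |u| ≤ κ → |a - K.τ j| ≤ κ → ∃ b : ℝ, |b - K.τ j| ≤ θ * |a - K.τ j| ∧
      F (K.N.along (K.N.alongU c u) s, a) =
        (K.N.along (K.N.alongU c (K.N.lam * u)) (K.N.lam⁻¹ * s), b) := by
  obtain ⟨κ₀, hκ₀, θ, hθ0, hθ1, hθ⟩ := H.exists_contraction hc.deriv
  have hε := M.ε_pos
  have hl := K.N.lam_pos
  have hl5 := K.N.lam_gt
  set κ := min κ₀ (M.ε / K.N.lam) with hκ
  have hκpos : 0 < κ := lt_min hκ₀ (div_pos hε hl)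
  have hlκ : K.N.lam * κ ≤ M.ε := by
    have := min_le_right κ₀ (M.ε / K.N.lam)
    rw [← hκ, le_div_iff₀ hl] at this
    linarith
  have hκε : κ ≤ M.ε := by nlinarith
  refine ⟨κ, hκpos, hκε, hlκ, θ, hθ0, hθ1, fun s u a hs hu ha => ?_⟩
  have hb := hθ s u a (hs.trans (min_le_left _ _)) (hu.trans (min_le_left _ _))
    (ha.trans (min_le_left _ _))
  have hg : K.N.g (K.N.along (K.N.alongU c u) s) =
      K.N.along (K.N.alongU c (K.N.lam * u)) (K.N.lam⁻¹ * s) := by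
    rw [K.N.g_along, K.N.g_alongU, hc.fix]
  refine ⟨_, hb, ?_⟩
  rw [L.far _ (far_near hk6 hc.sep (by linarith) (by linarith) (by linarith)), hg]
  rw [← H.cyc_eq, hg]
  refine far_near hk6 hc.sep ?_ ?_ ?_
  · have := abs_inv_lam_pow_mul_le K.N 1 s
    rw [pow_one] at this
    linarith
  · rw [abs_mul, abs_of_pos hl]; nlinarith
  · have : θ * |a - K.τ j| ≤ |a - K.τ j| := mul_le_of_le_one_left (abs_nonneg _) hθ1.le
    linarith

/-- The unstable leaf of `(c, t_j)` in the torus is disjoint from the unstable set of the source. -/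
theorem IsSink.notMem_unstableSet (hk6 : 6 ∣ k) {c : T2} {j : ℤ} (hc : IsSink M c j) {u : ℝ}
    (hu : |u| ≤ M.ε) : (K.N.alongU c u, K.t j) ∉ unstableSet M.f₁ (K.R0 j) := by
  intro hmem
  have hl := K.N.lam_pos
  -- Backwards, `f₁` contracts this leaf linearly to `(c, t_j)`, so the backward orbit cannot
  -- converge to the source.
  have hstep : ∀ u : ℝ, |u| ≤ M.ε →
      M.f₁.toPerm.symm (K.N.alongU c u, K.t j) = (K.N.alongU c (K.N.lam⁻¹ * u), K.t j) := by
    intro u hu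
    rw [Equiv.symm_apply_eq]
    have hu' : |K.N.lam⁻¹ * u| ≤ M.ε := by
      have := abs_inv_lam_pow_mul_le K.N 1 u
      rw [pow_one] at this
      linarith
    have hfar : M.Far (K.N.alongU c (K.N.lam⁻¹ * u), K.t j) := by
      have := far_near hk6 hc.sep (s := 0) (a := K.τ j) (by simp; linarith [M.ε_pos]) hu'
        (by simp; linarith [M.ε_pos])
      rwa [K.N.along_zero] at this
    rw [M.f₁_eq hfar, K.fibered, K.N.g_alongU, hc.fix, mul_inv_cancel_left₀ hl.ne']
    exact Prod.ext rfl (K.φ_fix _ j).symm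
  have hit : ∀ n : ℕ, M.f₁.toPerm.symm^[n] (K.N.alongU c u, K.t j) =
      (K.N.alongU c (K.N.lam⁻¹ ^ n * u), K.t j) := by
    intro n
    induction n with
    | zero => simp
    | succ n ih =>
      rw [Function.iterate_succ_apply', ih,
        hstep _ ((abs_inv_lam_pow_mul_le K.N n u).trans hu), pow_succ', mul_assoc]
  have hlim : Tendsto (fun n : ℕ => M.f₁.toPerm.symm^[n] (K.N.alongU c u, K.t j)) atTop
      (𝓝 (c, K.t j)) := by
    simp only [hit]
    have h2 := (K.N.continuous_alongU.tendsto (c, 0)).comp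
      (tendsto_const_nhds.prodMk_nhds (tendsto_inv_lam_pow K.N u))
    rw [K.N.alongU_zero] at h2
    exact h2.prodMk_nhds tendsto_const_nhds
  have := tendsto_nhds_unique hlim hmem
  have h3 : c = K.r0 j := congrArg Prod.fst this
  have h4 := hc.sep
  rw [h3, dist2_self] at h4
  linarith [M.ε_pos]

/-- An open set that meets the local stable set of a sink accumulates on its unstable leaf, hence
its iterates meet the stable leaf of any fixed point `x` of `g` close to the torus. -/
theorem IsSink.exists_push (hk6 : 6 ∣ k) (H : IsFiberLift K h) (L : IsLift M h f F) {c : T2} {j : ℤ}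
    (hc : IsSink M c j) :
    ∃ κ > 0, ∀ (V : Set T3) (s a : ℝ), IsOpen V → |s| ≤ κ → |a - K.τ j| ≤ κ →
      cyc (K.N.along c s, a) ∈ V → ∀ x, K.N.g x = x → ∀ r > 0, ∃ (n : ℕ) (s' a' : ℝ),
        |s'| ≤ 2 * M.ε ∧ |a' - K.τ j| < r ∧ cyc (K.N.along x s', a') ∈ f^[n] '' V ∧
        (K.τ j < a → K.τ j < a') := by
  obtain ⟨κ, hκ, hκε, -, θ, hθ0, hθ1, hbox⟩ := hc.exists_box hk6 H L
  refine ⟨κ, hκ, fun V s a hV hs ha hmem x hx r hr => ?_⟩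
  have hl := K.N.lam_pos
  have hε := M.ε_pos
  -- From a crossing of the two leaves, `m₁` forward iterates bring it within `ε / 2` of `x` along
  -- the stable leaf, and `m₂` backward iterates bring it into the box at `c`.
  obtain ⟨u₀, s₀, hus⟩ := K.N.exists_alongU_eq_along c x
  obtain ⟨m₁, hm₁⟩ := ((tendsto_inv_lam_pow K.N s₀).abs.eventually
    (ge_mem_nhds (show |(0 : ℝ)| < M.ε / 2 by simpa using half_pos hε))).exists
  obtain ⟨m₂, hm₂⟩ := ((tendsto_inv_lam_pow K.N u₀).abs.eventually
    (ge_mem_nhds (show |(0 : ℝ)| < κ by simpa using hκ))).exists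
  set u := K.N.lam⁻¹ ^ m₂ * u₀ with hu
  have hx' : K.N.alongU c (K.N.lam ^ (m₁ + m₂) * u) = K.N.along x (K.N.lam⁻¹ ^ m₁ * s₀) := by
    have h1 : K.N.lam ^ (m₁ + m₂) * u = K.N.lam ^ m₁ * u₀ := by
      rw [hu, pow_add, mul_assoc, ← mul_assoc (K.N.lam ^ m₂), ← mul_pow, mul_inv_cancel₀ hl.ne',
        one_pow, one_mul]
    have h2 := K.N.iterate_g_alongU c u₀ m₁
    rw [hus, K.N.iterate_g_along, Function.iterate_fixed hx, Function.iterate_fixed hc.fix] at h2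
    rw [h1, ← h2]
  -- Start at unstable coordinate `lam⁻¹ ^ m * u` near the given point of `V`. After `m` steps the
  -- coordinate is `u`, while the stable coordinate and the height deviation have decayed
  -- geometrically.
  have hit : ∀ m n : ℕ, n ≤ m → ∃ b : ℝ, |b - K.τ j| ≤ θ ^ n * κ ∧
      F^[n] (K.N.along (K.N.alongU c (K.N.lam⁻¹ ^ m * u)) s, a) =
        (K.N.along (K.N.alongU c (K.N.lam⁻¹ ^ (m - n) * u)) (K.N.lam⁻¹ ^ n * s), b) := by
    intro m n
    induction n with
    | zero => intro _; exact ⟨a, by simpa using ha, by simp⟩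
    | succ n ih =>
      intro hn
      obtain ⟨b, hb, e⟩ := ih (by omega)
      have hb' : |b - K.τ j| ≤ κ :=
        hb.trans (mul_le_of_le_one_left hκ.le (pow_le_one₀ hθ0 hθ1.le))
      obtain ⟨b', hb1, e'⟩ := hbox (K.N.lam⁻¹ ^ n * s) (K.N.lam⁻¹ ^ (m - n) * u) b
        ((abs_inv_lam_pow_mul_le _ _ _).trans hs) ((abs_inv_lam_pow_mul_le _ _ _).trans hm₂) hb'
      refine ⟨b', ?_, ?_⟩
      · rw [pow_succ', mul_assoc]
        exact hb1.trans (mul_le_mul_of_nonneg_left hb hθ0)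
      · have e1 : K.N.lam * (K.N.lam⁻¹ ^ (m - n) * u) = K.N.lam⁻¹ ^ (m - (n + 1)) * u := by
          rw [show m - n = (m - (n + 1)) + 1 by omega, pow_succ', mul_assoc,
            mul_inv_cancel_left₀ hl.ne']
        rw [Function.iterate_succ_apply', e, e', e1, pow_succ', mul_assoc]
  choose b hb e using fun m : ℕ => hit m m le_rfl
  have hblim : Tendsto b atTop (𝓝 (K.τ j)) := by
    rw [tendsto_iff_dist_tendsto_zero]
    refine squeeze_zero (fun _ => dist_nonneg) hb ?_
    simpa using (tendsto_pow_atTop_nhds_zero_of_lt_one hθ0 hθ1).mul_const κ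
  have hylim : Tendsto (fun m : ℕ => (K.N.along (K.N.alongU c u) (K.N.lam⁻¹ ^ m * s), b m)) atTop
      (𝓝 (K.N.alongU c u, K.τ j)) := by
    have h2 := (K.N.continuous_along.tendsto (K.N.alongU c u, 0)).comp
      (tendsto_const_nhds.prodMk_nhds (tendsto_inv_lam_pow K.N s))
    rw [K.N.along_zero] at h2
    exact h2.prodMk_nhds hblim
  have hFlim := ((continuous_snd.comp (L.continuous_iterate (m₁ + m₂))).tendsto _).comp hylim
  simp only [Function.comp_def] at hFlim
  -- The limit point lies on the unstable leaf of `c`, in the attractor, so the remaining `m₁ + m₂`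
  -- iterates keep its height exactly `τ j`. Continuity gives the height bound for nearby orbits.
  rw [L.attractor j _ _ (hc.notMem_unstableSet hk6 (hm₂.trans hκε))] at hFlim
  have hVlim : Tendsto (fun m : ℕ => cyc (K.N.along (K.N.alongU c (K.N.lam⁻¹ ^ m * u)) s, a)) atTop
      (𝓝 (cyc (K.N.along c s, a))) := by
    have h2 := (K.N.continuous_alongU.tendsto (c, 0)).comp
      (tendsto_const_nhds.prodMk_nhds (tendsto_inv_lam_pow K.N u))
    rw [K.N.alongU_zero] at h2
    have h3 := (K.N.continuous_along.tendsto (c, s)).comp (h2.prodMk_nhds tendsto_const_nhds)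
    exact (continuous_cyc.tendsto _).comp (h3.prodMk_nhds tendsto_const_nhds)
  obtain ⟨m, hm1, hm2⟩ := ((hFlim.eventually (Metric.ball_mem_nhds _ hr)).and
    (hVlim.eventually (hV.mem_nhds hmem))).exists
  set z := (K.N.along (K.N.alongU c (K.N.lam⁻¹ ^ m * u)) s, a) with hz
  have ez : F^[m] z = (K.N.along (K.N.alongU c u) (K.N.lam⁻¹ ^ m * s), b m) := by
    have := e m
    rw [Nat.sub_self, pow_zero, one_mul] at this
    exact this
  obtain ⟨S, hS, eS⟩ := L.iterate_drift (m₁ + m₂) (F^[m] z)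
  rw [ez, K.N.iterate_g_along, K.N.iterate_g_alongU, Function.iterate_fixed hc.fix, hx',
    K.N.along_along, K.N.along_along, ← ez] at eS
  refine ⟨(m₁ + m₂) + m, K.N.lam⁻¹ ^ m₁ * s₀ + (K.N.lam⁻¹ ^ (m₁ + m₂) * (K.N.lam⁻¹ ^ m * s) + S),
    (F^[m₁ + m₂] (F^[m] z)).2, ?_, ?_, ⟨cyc z, hm2, ?_⟩, ?_⟩
  -- The three terms are at most `ε / 2`, `κ ≤ ε` and `ε / 2`.
  · have h1 := abs_add_three (K.N.lam⁻¹ ^ m₁ * s₀) (K.N.lam⁻¹ ^ (m₁ + m₂) * (K.N.lam⁻¹ ^ m * s)) S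
    rw [add_assoc] at h1
    have h2 := (abs_inv_lam_pow_mul_le K.N (m₁ + m₂) (K.N.lam⁻¹ ^ m * s)).trans
      (abs_inv_lam_pow_mul_le K.N m s)
    linarith
  · rw [ez]; exact hm1
  · rw [← eS, Prod.mk.eta, Function.iterate_add_apply, L.cyc_iterate, L.cyc_iterate]
  · intro hlt
    exact L.iterate_above (L.iterate_above (z := z) hlt m) _

end Sink

namespace IsLift

variable {k : ℕ} {K : KanMap k} {M : FirstModification K} {h : T2 × ℝ → ℝ} {f : T3 → T3}
  {F : T2 × ℝ → T2 × ℝ}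

/-! ### The stable strip of `q i` -/

/-- At every height the strip is far from all balls, since `q i` is more than `10ε` from every `r0
l`. So here `F` is the lift of `f₀`. -/
theorem apply_strip (H : IsFiberLift K h) (L : IsLift M h f F) (i : ℤ) {s : ℝ} (hs : |s| ≤ 2 * M.ε)
    (a : ℝ) : F (K.N.along (K.q i) s, a) = (K.N.along (K.q i) (K.N.lam⁻¹ * s), h (K.N.along (K.q i) s, a)) := by
  have hfar : ∀ (s a : ℝ), |s| ≤ 2 * M.ε → M.Far (cyc (K.N.along (K.q i) s, a)) := by
    intro s a hs
    refine M.far_of_horiz fun l => ?_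
    have h1 := K.N.dist2_along_le (K.q i) s
    have h2 := dist2_triangle (K.q i) (K.N.along (K.q i) s) (K.r0 l)
    have h3 := M.q_sep i l
    rw [dist2_comm] at h1
    simp only [cyc]
    linarith [M.ε_pos]
  have hg : K.N.g (K.N.along (K.q i) s) = K.N.along (K.q i) (K.N.lam⁻¹ * s) := by
    rw [K.N.g_along, K.fix_q]
  rw [L.far _ (hfar s a hs), hg]
  rw [← H.cyc_eq, hg]
  refine hfar _ _ ?_
  have := abs_inv_lam_pow_mul_le K.N 1 s
  rw [pow_one] at this
  linarith

theorem iterate_strip (H : IsFiberLift K h) (L : IsLift M h f F) (i : ℤ) {s : ℝ} (hs : |s| ≤ 2 * M.ε)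
    (a : ℝ) (n : ℕ) : (F^[n] (K.N.along (K.q i) s, a)).1 = K.N.along (K.q i) (K.N.lam⁻¹ ^ n * s) := by
  induction n with
  | zero => simp
  | succ n ih =>
    rw [Function.iterate_succ_apply', ← Prod.mk.eta (p := F^[n] (K.N.along (K.q i) s, a)), ih,
      L.apply_strip H i ((abs_inv_lam_pow_mul_le K.N n s).trans hs), pow_succ', mul_assoc]

theorem snd_iterate_strip_succ (H : IsFiberLift K h) (L : IsLift M h f F) (i : ℤ) {s : ℝ}
    (hs : |s| ≤ 2 * M.ε) (a : ℝ) (n : ℕ) : (F^[n + 1] (K.N.along (K.q i) s, a)).2 =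
      h (K.N.along (K.q i) (K.N.lam⁻¹ ^ n * s), (F^[n] (K.N.along (K.q i) s, a)).2) := by
  rw [Function.iterate_succ_apply', ← Prod.mk.eta (p := F^[n] (K.N.along (K.q i) s, a)),
    L.iterate_strip H i hs, L.apply_strip H i ((abs_inv_lam_pow_mul_le K.N n s).trans hs)]

theorem iterate_strip_zero (H : IsFiberLift K h) (L : IsLift M h f F) (i : ℤ) (a : ℝ) (n : ℕ) :
    F^[n] (K.q i, a) = (K.q i, (fun a => h (K.q i, a))^[n] a) := by
  have h0 : |(0 : ℝ)| ≤ 2 * M.ε := by simpa using M.ε_pos.le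
  induction n with
  | zero => rfl
  | succ n ih =>
    rw [Function.iterate_succ_apply', ih, Function.iterate_succ_apply']
    have := L.apply_strip H i h0 ((fun a => h (K.q i, a))^[n] a)
    rwa [mul_zero, K.N.along_zero] at this

theorem iterate_strip_mem (H : IsFiberLift K h) (L : IsLift M h f F) (i : ℤ) {s a : ℝ}
    (hs : |s| ≤ 2 * M.ε) {l m : ℤ} (ha : a ∈ Ioo (K.τ l) (K.τ m)) (n : ℕ) :
    (F^[n] (K.N.along (K.q i) s, a)).2 ∈ Ioo (K.τ l) (K.τ m) := by
  induction n with
  | zero => exact ha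
  | succ n ih =>
    rw [L.snd_iterate_strip_succ H i hs]
    exact ⟨H.lt_of_gt (_, _) _ ih.1, H.lt_of_lt (_, _) _ ih.2⟩

/-- Orbits in the strip over `q i` do not converge to a level at which the circle is expanded. -/
theorem not_tendsto_strip (H : IsFiberLift K h) (L : IsLift M h f F) (i : ℤ) {e : ℤ} {s a : ℝ}
    (he : ∀ v, proj v = (K.q i, K.t e) → 1 < |K.f₀.fiberDeriv v|) (hs : |s| ≤ 2 * M.ε)
    (hne : ∀ n, (F^[n] (K.N.along (K.q i) s, a)).2 ≠ K.τ e) :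
    ¬ Tendsto (fun n => (F^[n] (K.N.along (K.q i) s, a)).2) atTop (𝓝 (K.τ e)) := by
  intro ht
  obtain ⟨κ, hκ, θ, hθ, hexp⟩ := H.exists_expansion he
  have h1 := (tendsto_inv_lam_pow K.N s).abs.eventually
    (ge_mem_nhds (show |(0 : ℝ)| < κ by simpa using hκ))
  have h2 := ht.eventually (Metric.closedBall_mem_nhds _ hκ)
  obtain ⟨n₀, hn₀⟩ := eventually_atTop.1 (h1.and h2)
  set d : ℕ → ℝ := fun n => |(F^[n] (K.N.along (K.q i) s, a)).2 - K.τ e| with hd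
  -- Once the orbit is in the expanding box, the positive distance to the level cannot decrease, so
  -- it does not tend to zero.
  have hpos : ∀ n, 0 < d n := fun n => abs_pos.2 (sub_ne_zero.2 (hne n))
  have hinc : ∀ n, n₀ ≤ n → d n₀ ≤ d n := by
    intro n hn
    induction n, hn using Nat.le_induction with
    | base => exact le_rfl
    | succ n hn ih =>
      refine ih.trans ?_
      have h3 := hexp _ _ (hn₀ n hn).1 (hn₀ n hn).2
      have h4 : d (n + 1) = |h (K.N.along (K.q i) (K.N.lam⁻¹ ^ n * s),
          (F^[n] (K.N.along (K.q i) s, a)).2) - K.τ e| := by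
        simp only [hd]; rw [L.snd_iterate_strip_succ H i hs]
      rw [h4]
      refine le_trans ?_ h3
      exact le_mul_of_one_le_left (hpos n).le hθ.le
  have h5 : Tendsto d atTop (𝓝 0) := by
    have := (ht.sub_const (K.τ e)).abs
    simpa using this
  exact absurd (hpos n₀) (not_lt.2 (ge_of_tendsto h5 (eventually_atTop.2 ⟨n₀, hinc⟩)))

/-- Otherwise the heights cannot accumulate at any `y` strictly between the end levels: the orbit of
`(q i, y)` tends to `τ i`, and nearby orbits follow it. The heights then converge to an end level,
where the circle over `q i = p (i ± 1)` is expanding. -/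
theorem exists_near_of_strip (hk : 2 < k) (H : IsFiberLift K h) (L : IsLift M h f F) (i : ℤ)
    {s a : ℝ} (hs : |s| ≤ 2 * M.ε) (ha : a ∈ Ioo (K.τ (i - 1)) (K.τ (i + 1))) {κ : ℝ} (hκ : 0 < κ) :
    ∃ n, |K.N.lam⁻¹ ^ n * s| ≤ κ ∧ |(F^[n] (K.N.along (K.q i) s, a)).2 - K.τ i| ≤ κ := by
  by_contra! hcon
  obtain ⟨n₀, hn₀⟩ := eventually_atTop.1 ((tendsto_inv_lam_pow K.N s).abs.eventually
    (ge_mem_nhds (show |(0 : ℝ)| < κ by simpa using hκ)))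
  set z := (K.N.along (K.q i) s, a) with hz
  have hfar : ∀ n, n₀ ≤ n → κ < |(F^[n] z).2 - K.τ i| := fun n hn => hcon n (hn₀ n hn)
  have hxlim : Tendsto (fun n => (F^[n] z).1) atTop (𝓝 (K.q i)) := by
    simp only [hz, L.iterate_strip H i hs]
    have h2 := (K.N.continuous_along.tendsto (K.q i, 0)).comp
      (tendsto_const_nhds.prodMk_nhds (tendsto_inv_lam_pow K.N s))
    rwa [K.N.along_zero] at h2
  have hclus : ∀ y, MapClusterPt y atTop (fun n => (F^[n] z).2) →
      y ∉ Ioo (K.τ (i - 1)) (K.τ (i + 1)) := by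
    intro y hy hmem
    obtain ⟨m, hm⟩ := ((H.tendsto_on_q_circle (by omega) hmem).eventually
      (Metric.ball_mem_nhds _ hκ)).exists
    have hc : ContinuousAt (fun w : T2 × ℝ => (F^[m] w).2) (K.q i, y) :=
      (continuous_snd.comp (L.continuous_iterate m)).continuousAt
    have hlt : |(F^[m] (K.q i, y)).2 - K.τ i| < κ := by
      rw [L.iterate_strip_zero H]; exact hm
    have hnear : {w : T2 × ℝ | |(F^[m] w).2 - K.τ i| < κ} ∈ 𝓝 (K.q i, y) :=
      (hc.sub continuousAt_const).abs.eventually_lt continuousAt_const hlt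
    rw [nhds_prod_eq, mem_prod_iff] at hnear
    obtain ⟨A, hA, B, hB, hAB⟩ := hnear
    have h1 := hy.frequently hB
    have h2 := hxlim.eventually hA
    obtain ⟨n, ⟨hn1, hn2⟩, hn3⟩ := ((h1.and_eventually h2).and_eventually
      (eventually_ge_atTop n₀)).exists
    have h4 : |(F^[m] (F^[n] z)).2 - K.τ i| < κ := hAB (show F^[n] z ∈ A ×ˢ B from ⟨hn2, hn1⟩)
    rw [← Function.iterate_add_apply] at h4
    exact absurd h4 (not_lt.2 (hfar (m + n) (by omega)).le)
  have hIoo := fun n => L.iterate_strip_mem H i hs ha n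
  have hq1 : K.q i = K.p (i + 1) := by
    have := K.q_p (i - 1)
    rwa [show i - 1 + 1 = i by ring, show i - 1 + 2 = i + 1 by ring] at this
  have hq2 : K.q i = K.p (i - 1) := by
    have := K.p_q (i - 1)
    rw [show i - 1 + 1 = i by ring] at this
    exact this.symm
  -- The orbit stays on one side of `τ i`, which leaves a single end level as possible limit.
  rcases lt_or_ge (F^[n₀] z).2 (K.τ i) with hside | hside
  · have hlt : ∀ n, n₀ ≤ n → (F^[n] z).2 < K.τ i := by
      intro n hn
      induction n, hn using Nat.le_induction with
      | base => exact hside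
      | succ n hn ih =>
        rw [L.snd_iterate_strip_succ H i hs]
        exact H.lt_of_lt (_, _) _ ih
    refine L.not_tendsto_strip H i (e := i - 1) (by rw [hq2]; exact K.deriv_p _) hs
      (fun n => (hIoo n).1.ne') ?_
    refine (isCompact_Icc (a := K.τ (i - 1)) (b := K.τ i)).tendsto_nhds_of_unique_mapClusterPt
      (eventually_atTop.2 ⟨n₀, fun n hn => ⟨(hIoo n).1.le, (hlt n hn).le⟩⟩) fun y hy hcl => ?_
    by_contra hne
    exact hclus y hcl ⟨lt_of_le_of_ne hy.1 (Ne.symm hne), hy.2.trans_lt (K.τ_lt_succ i)⟩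
  · have hlt : ∀ n, n₀ ≤ n → K.τ i < (F^[n] z).2 := by
      intro n hn
      induction n, hn using Nat.le_induction with
      | base =>
        refine lt_of_le_of_ne hside fun he => ?_
        have := hfar n₀ le_rfl
        rw [← he, sub_self, abs_zero] at this
        exact absurd hκ (not_lt.2 this.le)
      | succ n hn ih =>
        rw [L.snd_iterate_strip_succ H i hs]
        exact H.lt_of_gt (_, _) _ ih
    refine L.not_tendsto_strip H i (e := i + 1) (by rw [hq1]; exact K.deriv_p _) hs
      (fun n => (hIoo n).2.ne) ?_
    refine (isCompact_Icc (a := K.τ i) (b := K.τ (i + 1))).tendsto_nhds_of_unique_mapClusterPt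
      (eventually_atTop.2 ⟨n₀, fun n hn => ⟨(hlt n hn).le, (hIoo n).2.le⟩⟩) fun y hy hcl => ?_
    by_contra hne
    have hlt' : K.τ (i - 1) < K.τ i := K.τ_strictMono (by omega)
    exact hclus y hcl ⟨hlt'.trans_le hy.1, lt_of_le_of_ne hy.2 hne⟩

/-- The strip over `q i` between the two neighbouring tori is contained in the stable set. -/
theorem tendsto_strip (hk : 2 < k) (hk6 : 6 ∣ k) (H : IsFiberLift K h) (L : IsLift M h f F) (i : ℤ)
    {s a : ℝ} (hs : |s| ≤ 2 * M.ε) (ha : a ∈ Ioo (K.τ (i - 1)) (K.τ (i + 1))) :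
    Tendsto (fun n => F^[n] (K.N.along (K.q i) s, a)) atTop (𝓝 (K.q i, K.τ i)) := by
  obtain ⟨κ, hκ, -, -, θ, hθ0, hθ1, hbox⟩ := (isSink_q M i).exists_box hk6 H L
  obtain ⟨n₀, h1, h2⟩ := L.exists_near_of_strip hk H i hs ha hκ
  set z := (K.N.along (K.q i) s, a) with hz
  have hgeo : ∀ m, |(F^[m + n₀] z).2 - K.τ i| ≤ θ ^ m * κ := by
    intro m
    induction m with
    | zero => simpa using h2
    | succ m ih =>
      have e1 := L.iterate_strip H i hs a (m + n₀)
      rw [← hz] at e1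
      have h3 : |K.N.lam⁻¹ ^ (m + n₀) * s| ≤ κ := by
        rw [pow_add, mul_assoc]; exact (abs_inv_lam_pow_mul_le _ _ _).trans h1
      obtain ⟨b, hb, e⟩ := hbox (K.N.lam⁻¹ ^ (m + n₀) * s) 0 (F^[m + n₀] z).2 h3
        (by simpa using hκ.le) (ih.trans (mul_le_of_le_one_left hκ.le (pow_le_one₀ hθ0 hθ1.le)))
      rw [K.N.alongU_zero, ← e1, Prod.mk.eta] at e
      rw [show m + 1 + n₀ = (m + n₀) + 1 by ring, Function.iterate_succ_apply', e, pow_succ',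
        mul_assoc]
      exact hb.trans (mul_le_mul_of_nonneg_left ih hθ0)
  have hy : Tendsto (fun n => (F^[n] z).2) atTop (𝓝 (K.τ i)) := by
    rw [← tendsto_add_atTop_iff_nat n₀, tendsto_iff_dist_tendsto_zero]
    refine squeeze_zero (fun _ => dist_nonneg) hgeo ?_
    simpa using (tendsto_pow_atTop_nhds_zero_of_lt_one hθ0 hθ1).mul_const κ
  have hxlim : Tendsto (fun n => (F^[n] z).1) atTop (𝓝 (K.q i)) := by
    simp only [hz, L.iterate_strip H i hs]
    have h2 := (K.N.continuous_along.tendsto (K.q i, 0)).comp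
      (tendsto_const_nhds.prodMk_nhds (tendsto_inv_lam_pow K.N s))
    rwa [K.N.along_zero] at h2
  exact hxlim.prodMk_nhds hy

end IsLift

namespace IsLift

variable {k : ℕ} {K : KanMap k} {M : FirstModification K} {h : T2 × ℝ → ℝ} {f : T3 → T3}
  {F : T2 × ℝ → T2 × ℝ}

/-! ### The passage through the torus along the circle over `r0 j` -/

/-- On the circle over `r0 j`, orbits cross the level `τ j` and converge to `τ (j + 1)`. -/
theorem tendsto_circle (L : IsLift M h f F) (j : ℤ) {a : ℝ}
    (ha : a ∈ Ioo (K.τ (j - 1)) (K.τ (j + 1))) :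
    Tendsto (fun n => F^[n] (K.r0 j, a)) atTop (𝓝 (K.r0 j, K.τ (j + 1))) := by
  set b : ℕ → ℝ := fun n => (F^[n] (K.r0 j, a)).2 with hb
  have key : ∀ n, F^[n] (K.r0 j, a) = (K.r0 j, b n) ∧ b n ∈ Ioo (K.τ (j - 1)) (K.τ (j + 1)) := by
    intro n
    induction n with
    | zero => exact ⟨rfl, ha⟩
    | succ n ih =>
      obtain ⟨e1, e2, e3⟩ := L.circle j _ ih.2
      have e : F^[n + 1] (K.r0 j, a) = F (K.r0 j, b n) := by
        rw [Function.iterate_succ_apply', ih.1]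
      have eb : b (n + 1) = (F (K.r0 j, b n)).2 := by simp only [hb] at e ⊢; rw [e]
      exact ⟨by rw [e, eb]; exact Prod.ext e1 rfl, by rw [eb]; exact ⟨ih.2.1.trans e2, e3⟩⟩
  have hstep : ∀ n, b (n + 1) = (F (K.r0 j, b n)).2 := fun n => by
    simp only [hb]
    rw [Function.iterate_succ_apply', (key n).1]
  -- The heights increase and are bounded by `τ (j + 1)`. Their limit is a fixed height, and strict
  -- rise leaves only `τ (j + 1)`.
  have hmono : Monotone b := monotone_nat_of_le_succ fun n => by
    rw [hstep]; exact (L.circle j _ (key n).2).2.1.le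
  have hbdd : BddAbove (range b) := ⟨K.τ (j + 1), by rintro _ ⟨n, rfl⟩; exact (key n).2.2.le⟩
  have hlim := tendsto_atTop_ciSup hmono hbdd
  set y := ⨆ n, b n with hy
  have hfix : y = (F (K.r0 j, y)).2 := by
    have h1 : Tendsto (fun n => (F (K.r0 j, b n)).2) atTop (𝓝 (F (K.r0 j, y)).2) :=
      ((continuous_snd.comp L.continuous).tendsto _).comp (tendsto_const_nhds.prodMk_nhds hlim)
    have h2 := (tendsto_add_atTop_iff_nat 1).2 hlim
    simp only [hstep] at h2
    exact tendsto_nhds_unique h2 h1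
  have hy1 : K.τ (j - 1) < y := (key 0).2.1.trans_le (le_ciSup hbdd 0)
  have hy2 : y ≤ K.τ (j + 1) := ciSup_le fun n => (key n).2.2.le
  have hyeq : y = K.τ (j + 1) := by
    by_contra hne
    have := (L.circle j y ⟨hy1, lt_of_le_of_ne hy2 hne⟩).2.1
    rw [← hfix] at this
    exact lt_irrefl _ this
  rw [← hyeq]
  have : (fun n => F^[n] (K.r0 j, a)) = fun n => (K.r0 j, b n) := funext fun n => (key n).1
  rw [this]
  exact tendsto_const_nhds.prodMk_nhds hlim

/-- Near `r1 j`, the lift is the lift of `f₀`. -/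
theorem apply_near_r1 (hk6 : 6 ∣ k) (H : IsFiberLift K h) (L : IsLift M h f F) (j : ℤ) {s a : ℝ}
    (hs : |s| ≤ 2 * M.ε) (ha : |a - K.τ j| ≤ M.ε) :
    F (K.N.along (K.r1 j) s, a) =
      (K.N.along (K.r1 j) (K.N.lam⁻¹ * s), h (K.N.along (K.r1 j) s, a)) := by
  have hfar : ∀ (s a : ℝ), |s| ≤ 2 * M.ε → |a - K.τ j| ≤ 5 * M.ε →
      M.Far (cyc (K.N.along (K.r1 j) s, a)) := by
    intro s a hs ha
    have := far_near hk6 (M.points_sep j).2.2.2 (u := 0) hs (by simpa using M.ε_pos.le) ha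
    rwa [K.N.alongU_zero] at this
  have hg : K.N.g (K.N.along (K.r1 j) s) = K.N.along (K.r1 j) (K.N.lam⁻¹ * s) := by
    rw [K.N.g_along, K.fix_r1]
  have hε := M.ε_pos
  rw [L.far _ (hfar s a hs (by linarith)), hg]
  rw [← H.cyc_eq, hg]
  refine hfar _ _ ?_ ?_
  · have := abs_inv_lam_pow_mul_le K.N 1 s
    rw [pow_one] at this
    linarith
  · have := H.abs_sub_le (K.N.along (K.r1 j) s) a j
    linarith

theorem iterate_near_r1 (hk6 : 6 ∣ k) (H : IsFiberLift K h) (L : IsLift M h f F) (j : ℤ) {s a : ℝ}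
    (hs : |s| ≤ 2 * M.ε) {n : ℕ}
    (hn : ∀ m < n, |(F^[m] (K.N.along (K.r1 j) s, a)).2 - K.τ j| ≤ M.ε) :
    (F^[n] (K.N.along (K.r1 j) s, a)).1 = K.N.along (K.r1 j) (K.N.lam⁻¹ ^ n * s) ∧
    ∀ m < n, (F^[m + 1] (K.N.along (K.r1 j) s, a)).2 =
      h (K.N.along (K.r1 j) (K.N.lam⁻¹ ^ m * s), (F^[m] (K.N.along (K.r1 j) s, a)).2) := by
  induction n with
  | zero => simp
  | succ n ih =>
    obtain ⟨e1, e2⟩ := ih fun m hm => hn m (by omega)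
    have e3 := L.apply_near_r1 hk6 H j ((abs_inv_lam_pow_mul_le K.N n s).trans hs) (hn n (by omega))
    rw [← e1, Prod.mk.eta, ← Function.iterate_succ_apply' (f := F)] at e3
    refine ⟨by rw [e3, pow_succ', mul_assoc], fun m hm => ?_⟩
    rcases Nat.lt_succ_iff_lt_or_eq.1 hm with hm | rfl
    · exact e2 m hm
    · rw [e3, ← e1, Prod.mk.eta]

/-- The points slightly above the torus in the stable leaf of `r1 j` are sent close to the fixed
point over `rm (j + 2)`. -/
theorem exists_exit (hk : 2 < k) (hk6 : 6 ∣ k) (H : IsFiberLift K h) (L : IsLift M h f F) (j : ℤ)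
    {κ' : ℝ} (hκ' : 0 < κ') :
    ∃ r > 0, ∀ s a : ℝ, |s| ≤ 2 * M.ε → K.τ j < a → a < K.τ j + r → ∃ (n : ℕ) (s' a' : ℝ),
      F^[n] (K.N.along (K.r1 j) s, a) = (K.N.along (K.rm (j + 2)) s', a') ∧ |s'| ≤ κ' ∧
      |a' - K.τ (j + 2)| ≤ κ' := by
  have hε := M.ε_pos
  have hε' := M.ε_lt (by omega)
  obtain ⟨κ₀, hκ₀, θ, hθ, hexp⟩ := H.exists_expansion (K.deriv_r1 j)
  set κ := min κ₀ M.ε with hκdef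
  have hκ : 0 < κ := lt_min hκ₀ hε
  have hκε : κ ≤ M.ε := min_le_right _ _
  have hrm : K.rm (j + 2) = K.r1 j := by rw [← K.r0_rm, ← K.r1_r0]
  have hr0 : K.r0 (j + 1) = K.r1 j := (K.r1_r0 j).symm
  rw [hrm]
  set c := K.r1 j with hc
  -- the points of the leaf whose orbit enters the box
  set W : Set (ℝ × ℝ) := {p | ∃ n : ℕ, dist2 (F^[n] (K.N.along c p.1, p.2)).1 c < κ' ∧
    |(F^[n] (K.N.along c p.1, p.2)).2 - K.τ (j + 2)| < κ'} with hW
  have hWo : IsOpen W := by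
    have : W = ⋃ n : ℕ, {p : ℝ × ℝ | dist2 (F^[n] (K.N.along c p.1, p.2)).1 c < κ' ∧
        |(F^[n] (K.N.along c p.1, p.2)).2 - K.τ (j + 2)| < κ'} := by
      ext p; simp [hW]
    rw [this]
    refine isOpen_iUnion fun n => ?_
    have hcont : Continuous fun p : ℝ × ℝ => F^[n] (K.N.along c p.1, p.2) :=
      (L.continuous_iterate n).comp
        ((K.N.continuous_along.comp (continuous_const.prodMk continuous_fst)).prodMk continuous_snd)
    exact (isOpen_lt ((continuous_dist2 c).comp (continuous_fst.comp hcont)) continuous_const).inter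
      (isOpen_lt ((continuous_snd.comp hcont).sub continuous_const).abs continuous_const)
  -- The interval from `κ / 2` to `3κ / 4` is a fundamental domain for leaving the level: heights
  -- grow by at most the factor `3 / 2` per step, so an orbit passing `κ / 2` cannot jump over it.
  have hsub : ({0} : Set ℝ) ×ˢ Icc (K.τ j + κ / 2) (K.τ j + 3 / 4 * κ) ⊆ W := by
    rintro ⟨s, d⟩ ⟨hs, hd⟩
    have hs : s = 0 := hs
    subst hs
    have hgap := M.ε_tori j
    have hgap' := K.τ_lt_succ (j + 1)
    rw [show j + 1 + 1 = j + 2 by ring] at hgap'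
    have hmem : d ∈ Ioo (K.τ (j + 1 - 1)) (K.τ (j + 1 + 1)) := by
      rw [show j + 1 - 1 = j by ring, show j + 1 + 1 = j + 2 by ring]
      exact ⟨by linarith [hd.1], by linarith [hd.2]⟩
    have ht := L.tendsto_circle (j + 1) hmem
    rw [hr0, show j + 1 + 1 = j + 2 by ring] at ht
    have h1 := (((continuous_dist2 c).comp continuous_fst).tendsto _).comp ht
    have h2 := ((continuous_snd.sub continuous_const).abs.tendsto
      ((c, K.τ (j + 2)) : T2 × ℝ) (f := fun z : T2 × ℝ => |z.2 - K.τ (j + 2)|)).comp ht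
    simp only [Function.comp_def, dist2_self, sub_self, abs_zero] at h1 h2
    obtain ⟨n, hn1, hn2⟩ := ((h1.eventually (gt_mem_nhds hκ')).and
      (h2.eventually (gt_mem_nhds hκ'))).exists
    refine ⟨n, ?_⟩
    simp only [K.N.along_zero]
    exact ⟨hn1, hn2⟩
  -- The tube lemma gives one neighbourhood of the stable coordinate 0 valid for all heights of the
  -- fundamental domain.
  obtain ⟨A, B, hAo, -, hA, hB, hAB⟩ := generalized_tube_lemma isCompact_singleton isCompact_Icc hWo hsub
  obtain ⟨n₁, hn₁⟩ : ∃ n₁ : ℕ, ∀ n ≥ n₁, ∀ s : ℝ, |s| ≤ 2 * M.ε →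
      K.N.lam⁻¹ ^ n * s ∈ A ∧ |K.N.lam⁻¹ ^ n * s| ≤ κ := by
    obtain ⟨r, hr, hrA⟩ := Metric.isOpen_iff.1 hAo 0 (hA rfl)
    have ht := (tendsto_inv_lam_pow K.N (2 * M.ε)).eventually (gt_mem_nhds (lt_min hr hκ))
    obtain ⟨n₁, hn₁⟩ := eventually_atTop.1 ht
    refine ⟨n₁, fun n hn s hs => ?_⟩
    have h1 : |K.N.lam⁻¹ ^ n * s| ≤ K.N.lam⁻¹ ^ n * (2 * M.ε) := by
      rw [abs_mul, abs_of_nonneg (pow_nonneg K.N.lam_inv_pos.le n)]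
      exact mul_le_mul_of_nonneg_left hs (pow_nonneg K.N.lam_inv_pos.le n)
    have h2 := h1.trans_lt (hn₁ n hn)
    refine ⟨hrA ?_, (h2.trans_le (min_le_right _ _)).le⟩
    rw [Metric.mem_ball, Real.dist_eq, sub_zero]
    exact h2.trans_le (min_le_left _ _)
  -- From so low, more than `n₁` steps are needed to reach height `κ / 2`, enough for the stable
  -- coordinate to contract into `A`.
  refine ⟨κ / 2 / (3 / 2) ^ n₁, by positivity, fun s a hs ha1 ha2 => ?_⟩
  set z := (K.N.along c s, a) with hz
  set d : ℕ → ℝ := fun n => (F^[n] z).2 - K.τ j with hd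
  have hdpos : ∀ n, 0 < d n := fun n => sub_pos.2 (L.iterate_above (z := z) ha1 n)
  have hsmall : ∀ {n : ℕ}, (∀ m < n, d m < κ / 2) → ∀ m < n, |(F^[m] z).2 - K.τ j| ≤ M.ε := by
    intro n hn m hm
    have h1 := hn m hm
    have h2 := hdpos m
    rw [abs_of_pos h2]
    linarith
  have hsucc : ∀ {n : ℕ}, (∀ m < n, d m < κ / 2) → ∀ m < n, d (m + 1) ≤ 3 / 2 * d m := by
    intro n hn m hm
    have e := (L.iterate_near_r1 hk6 H j hs (hsmall hn)).2 m hm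
    have h1 := H.abs_sub_le (K.N.along c (K.N.lam⁻¹ ^ m * s)) (F^[m] z).2 j
    rw [← e] at h1
    have h2 := hdpos m
    have h3 := hdpos (m + 1)
    simp only [hd] at h2 h3 ⊢
    rwa [abs_of_pos h2, abs_of_pos h3] at h1
  have hgrow : ∀ {n : ℕ}, (∀ m < n, d m < κ / 2) → d n ≤ (3 / 2) ^ n * d 0 := by
    intro n
    induction n with
    | zero => intro _; simp
    | succ n ih =>
      intro hn
      have h1 := ih fun m hm => hn m (by omega)
      have h2 := hsucc hn n (by omega)
      rw [pow_succ', mul_assoc]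
      linarith
  -- After `n₁` steps the orbit is in the expanding box, so its height would grow like `θ ^ m` if it
  -- never left.
  have hex : ∃ n, κ / 2 ≤ d n := by
    by_contra! hall
    have hinc : ∀ m, θ ^ m * d n₁ ≤ d (m + n₁) := by
      intro m
      induction m with
      | zero => simp
      | succ m ih =>
        have e := (L.iterate_near_r1 hk6 H j hs (hsmall (n := m + n₁ + 1) fun m _ => hall m)).2
          (m + n₁) (by omega)
        have h1 := (hn₁ (m + n₁) (by omega) s hs).2
        have h2 := hdpos (m + n₁)
        have h3 := hexp (K.N.lam⁻¹ ^ (m + n₁) * s) (F^[m + n₁] z).2 (h1.trans (min_le_left _ _)) (by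
          have := hall (m + n₁)
          have h5 := min_le_left κ₀ M.ε
          rw [← hκdef] at h5
          change |d (m + n₁)| ≤ _
          rw [abs_of_pos h2]
          linarith)
        rw [← e] at h3
        have h4 : θ * d (m + n₁) ≤ d (m + n₁ + 1) := by
          have h6 := hdpos (m + n₁ + 1)
          simp only [hd] at h2 h6 ⊢
          rwa [abs_of_pos h2, abs_of_pos h6] at h3
        rw [pow_succ', mul_assoc, show m + 1 + n₁ = m + n₁ + 1 by ring]
        exact (mul_le_mul_of_nonneg_left ih (by linarith)).trans h4
    obtain ⟨m, hm⟩ := ((tendsto_pow_atTop_atTop_of_one_lt hθ).eventually_gt_atTop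
      (κ / 2 / d n₁)).exists
    rw [div_lt_iff₀ (hdpos n₁)] at hm
    linarith [hinc m, hall (m + n₁)]
  classical
  set n := Nat.find hex with hn
  have hn1 : κ / 2 ≤ d n := Nat.find_spec hex
  have hn2 : ∀ m < n, d m < κ / 2 := fun m hm => not_le.1 (Nat.find_min hex hm)
  have hd0 : d 0 < κ / 2 / (3 / 2) ^ n₁ := by
    simp only [hd, Function.iterate_zero, id, hz]; linarith
  have hd0' : (3 / 2 : ℝ) ^ n₁ * d 0 < κ / 2 := by
    rw [lt_div_iff₀ (by positivity)] at hd0; linarith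
  have hnn : n₁ < n := by
    by_contra! hle
    have h1 := hgrow hn2
    have h2 : (3 / 2 : ℝ) ^ n ≤ (3 / 2) ^ n₁ := pow_le_pow_right₀ (by norm_num) hle
    have h3 := mul_le_mul_of_nonneg_right h2 (hdpos 0).le
    linarith
  have hn3 : d n ≤ 3 / 4 * κ := by
    have h1 := hsucc hn2 (n - 1) (by omega)
    rw [Nat.sub_add_cancel (by omega)] at h1
    linarith [hn2 (n - 1) (by omega)]
  have e1 := (L.iterate_near_r1 hk6 H j hs (hsmall hn2)).1
  have hmemW : (K.N.lam⁻¹ ^ n * s, (F^[n] z).2) ∈ W := by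
    refine hAB ⟨(hn₁ n hnn.le s hs).1, hB ⟨?_, ?_⟩⟩
    · simp only [hd] at hn1; linarith
    · simp only [hd] at hn3; linarith
  obtain ⟨m, hm1, hm2⟩ := hmemW
  simp only at hm1 hm2
  rw [← e1, Prod.mk.eta, ← Function.iterate_add_apply] at hm1 hm2
  obtain ⟨S, hS, eS⟩ := L.iterate_drift (m + n) z
  rw [hz, K.N.iterate_g_along, Function.iterate_fixed (K.fix_r1 j), K.N.along_along, ← hz] at eS
  refine ⟨m + n, _, (F^[m + n] z).2, Prod.ext eS rfl, ?_, hm2.le⟩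
  have h1 := abs_add_le (K.N.lam⁻¹ ^ (m + n) * s) S
  have h2 := abs_inv_lam_pow_mul_le K.N (m + n) s
  -- The leaf coordinate is at most `2ε + ε / 2 < 1 / 2`, so it is bounded by the distance in the
  -- torus.
  rw [eS, K.N.dist2_along _ (by linarith)] at hm1
  exact hm1.le

/-! ### Iterates of open sets -/

/-- Some iterate of `U` meets the stable strip of `q j`. -/
def Reaches {k : ℕ} {K : KanMap k} (M : FirstModification K) (f : T3 → T3) (U : Set T3) (j : ℤ) : Prop :=
  ∃ (n : ℕ) (s a : ℝ), |s| ≤ 2 * M.ε ∧ a ∈ Ioo (K.τ (j - 1)) (K.τ (j + 1)) ∧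
    cyc (K.N.along (K.q j) s, a) ∈ f^[n] '' U

theorem image_iterate_image (m n : ℕ) (U : Set T3) : f^[m] '' (f^[n] '' U) = f^[m + n] '' U := by
  rw [Function.iterate_add, image_comp]

/-- An open set that meets the stable strip of `q j` is sent into the local stable set. -/
theorem exists_local (hk : 2 < k) (H : IsFiberLift K h) (L : IsLift M h f F) {U : Set T3} {j : ℤ}
    {n : ℕ} {s a : ℝ} (hs : |s| ≤ 2 * M.ε) (ha : a ∈ Ioo (K.τ (j - 1)) (K.τ (j + 1)))
    (hU : cyc (K.N.along (K.q j) s, a) ∈ f^[n] '' U) {κ : ℝ} (hκ : 0 < κ) :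
    ∃ (n' : ℕ) (s' a' : ℝ), |s'| ≤ κ ∧ |a' - K.τ j| ≤ κ ∧
      cyc (K.N.along (K.q j) s', a') ∈ f^[n'] '' U ∧ (K.τ j < a → K.τ j < a') := by
  obtain ⟨m, h1, h2⟩ := L.exists_near_of_strip hk H j hs ha hκ
  refine ⟨m + n, _, _, h1, h2, ?_, fun hlt => L.iterate_above (z := (_, a)) hlt m⟩
  rw [← L.iterate_strip H j hs a m, Prod.mk.eta, L.cyc_iterate, ← image_iterate_image]
  exact mem_image_of_mem _ hU

/-- From above the torus `T² × {t_j}`, iterates reach the strip of `q (j + 2)`. -/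
theorem reaches_add_two (hk : 2 < k) (hk6 : 6 ∣ k) (H : IsFiberLift K h) (L : IsLift M h f F)
    {U : Set T3} (hU : IsOpen U) {j : ℤ} {n : ℕ} {s a : ℝ} (hs : |s| ≤ 2 * M.ε)
    (ha : a ∈ Ioo (K.τ j) (K.τ (j + 1))) (hmem : cyc (K.N.along (K.q j) s, a) ∈ f^[n] '' U) :
    Reaches M f U (j + 2) := by
  obtain ⟨κ, hκ, hpush⟩ := (isSink_q M j).exists_push hk6 H L
  obtain ⟨κ', hκ', hpush'⟩ := (isSink_rm M (j + 2)).exists_push hk6 H L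
  obtain ⟨r, hr, hexit⟩ := L.exists_exit hk hk6 H j hκ'
  have hj : K.τ (j - 1) < K.τ j := K.τ_strictMono (by omega)
  obtain ⟨n₁, s₁, a₁, hs₁, ha₁, hm₁, hlt₁⟩ :=
    L.exists_local hk H hs ⟨hj.trans ha.1, ha.2⟩ hmem hκ
  -- The height must come within `r` of the level, as `exists_exit` requires, and remain above it.
  obtain ⟨n₂, s₂, a₂, hs₂, ha₂, hm₂, hlt₂⟩ := hpush _ s₁ a₁ (L.isOpen_iterate n₁ hU) hs₁ ha₁ hm₁
    (K.r1 j) (K.fix_r1 j) r hr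
  have h2 := hlt₂ (hlt₁ ha.1)
  rw [abs_lt] at ha₂
  obtain ⟨n₃, s₃, a₃, e₃, hs₃, ha₃⟩ := hexit s₂ a₂ hs₂ h2 (by linarith)
  have hm₃ : cyc (K.N.along (K.rm (j + 2)) s₃, a₃) ∈ f^[n₃] '' (f^[n₂] '' (f^[n₁] '' U)) := by
    rw [← e₃, L.cyc_iterate]; exact mem_image_of_mem _ hm₂
  rw [image_iterate_image, image_iterate_image] at hm₃
  -- A precision of `10ε` suffices, since consecutive levels are further apart.
  obtain ⟨n₄, s₄, a₄, hs₄, ha₄, hm₄, -⟩ := hpush' _ s₃ a₃ (L.isOpen_iterate _ hU) hs₃ ha₃ hm₃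
    (K.q (j + 2)) (K.fix_q _) (10 * M.ε) (by linarith [M.ε_pos])
  rw [image_iterate_image] at hm₄
  rw [abs_lt] at ha₄
  have g1 := M.ε_tori (j + 1)
  have g2 := M.ε_tori (j + 2)
  rw [show j + 1 + 1 = j + 2 by ring] at g1
  refine ⟨_, s₄, a₄, hs₄, ⟨?_, ?_⟩, hm₄⟩
  · rw [show j + 2 - 1 = j + 1 by ring]; linarith
  · linarith

/-- After a push to the leaf of `p j`, near level `τ j`, the index depends on the side. Above, `p j
= q (j + 1)` gives the strip directly. Below, `p j = q (j - 1)`, and `reaches_add_two` crosses the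
torus from `j - 1` to `j + 1`. -/
theorem reaches_succ (hk : 2 < k) (hk6 : 6 ∣ k) (H : IsFiberLift K h) (L : IsLift M h f F)
    {U : Set T3} (hU : IsOpen U) {j : ℤ} (hR : Reaches M f U j) : Reaches M f U (j + 1) := by
  obtain ⟨n, s, a, hs, ha, hmem⟩ := hR
  obtain ⟨κ, hκ, hpush⟩ := (isSink_q M j).exists_push hk6 H L
  obtain ⟨n₁, s₁, a₁, hs₁, ha₁, hm₁, -⟩ := L.exists_local hk H hs ha hmem hκ
  obtain ⟨n₂, s₂, a₂, hs₂, ha₂, hm₂, -⟩ := hpush _ s₁ a₁ (L.isOpen_iterate n₁ hU) hs₁ ha₁ hm₁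
    (K.p j) (K.fix_p j) (10 * M.ε) (by linarith [M.ε_pos])
  rw [image_iterate_image] at hm₂
  rw [abs_lt] at ha₂
  have g1 := M.ε_tori (j - 1)
  have g2 := M.ε_tori j
  rw [show j - 1 + 1 = j by ring] at g1
  rcases lt_or_ge a₂ (K.τ j) with hlt | hge
  · have hp : K.p j = K.q (j - 1) := by
      have h1 := K.q_p (j - 2)
      rw [show j - 2 + 1 = j - 1 by ring, show j - 2 + 2 = j by ring] at h1
      exact h1.symm
    rw [hp] at hm₂
    have := L.reaches_add_two hk hk6 H hU (j := j - 1) hs₂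
      ⟨by linarith, by rwa [show j - 1 + 1 = j by ring]⟩ hm₂
    rwa [show j - 1 + 2 = j + 1 by ring] at this
  · rw [K.p_q j] at hm₂
    have hcont : Continuous fun b : ℝ => cyc (K.N.along (K.q (j + 1)) s₂, b) :=
      continuous_cyc.comp (by fun_prop)
    -- The height may equal `τ j`, which is not in the open strip. Openness allows raising it
    -- slightly.
    have hev := hcont.continuousAt.eventually ((L.isOpen_iterate (n₂ + n₁) hU).mem_nhds hm₂)
    have hev2 : ∀ᶠ b in 𝓝 a₂, b < K.τ (j + 1) := gt_mem_nhds (by linarith)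
    obtain ⟨b, ⟨hb1, hb2⟩, hb3⟩ := (((hev.and hev2).filter_mono nhdsWithin_le_nhds).and
      (self_mem_nhdsWithin (s := Ioi a₂))).exists
    refine ⟨_, s₂, b, hs₂, ⟨?_, ?_⟩, hb1⟩
    · rw [show j + 1 - 1 = j by ring]; exact hge.trans_lt hb3
    · exact hb2.trans (K.τ_lt_succ (j + 1))

/-- The dense stable leaf of `q 0` meets a horizontal slice of `U`. Iteration contracts the leaf
coordinate below `ε`, and the drift adds at most `ε / 2`. -/
theorem exists_reaches (L : IsLift M h f F)
    {U : Set T3} (hU : IsOpen U) (hne : U.Nonempty) : ∃ j, Reaches M f U j := by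
  obtain ⟨⟨x, t⟩, hxt⟩ := hne
  have hε := M.ε_pos
  have hcont : Continuous fun x : T2 => (x, t) := by fun_prop
  obtain ⟨s, hs⟩ := K.N.exists_along_mem (K.fix_q 0) (hU.preimage hcont) ⟨x, hxt⟩
  obtain ⟨n, hn⟩ := ((tendsto_inv_lam_pow K.N s).abs.eventually
    (ge_mem_nhds (show |(0 : ℝ)| < M.ε by simpa using hε))).exists
  obtain ⟨a, rfl⟩ := isOpenQuotientMap_coe.surjective t
  obtain ⟨S, hS, eS⟩ := L.iterate_drift n (K.N.along (K.q 0) s, a)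
  rw [K.N.iterate_g_along, Function.iterate_fixed (K.fix_q 0), K.N.along_along] at eS
  set s' := K.N.lam⁻¹ ^ n * s + S with hs'
  have hs2 : |s'| ≤ 2 * M.ε := by
    have := abs_add_le (K.N.lam⁻¹ ^ n * s) S
    linarith
  set b := (F^[n] (K.N.along (K.q 0) s, a)).2 with hb
  have hmem : cyc (K.N.along (K.q 0) s', b) ∈ f^[n] '' U := by
    rw [← eS, hb, Prod.mk.eta, L.cyc_iterate]
    exact mem_image_of_mem _ hs
  obtain ⟨i, hi1, hi2⟩ := K.exists_τ_le b
  have hc2 : Continuous fun b : ℝ => cyc (K.N.along (K.q 0) s', b) :=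
    continuous_cyc.comp (by fun_prop)
  have hev := hc2.continuousAt.eventually ((L.isOpen_iterate n hU).mem_nhds hmem)
  have hev2 : ∀ᶠ b in 𝓝 b, b < K.τ (i + 1) := gt_mem_nhds hi2
  obtain ⟨d, ⟨hd1, hd2⟩, hd3⟩ := (((hev.and hev2).filter_mono nhdsWithin_le_nhds).and
    (self_mem_nhdsWithin (s := Ioi b))).exists
  have hd3' : K.τ i < d := hi1.trans_lt hd3
  have g1 : K.τ (i - 1) < K.τ i := K.τ_strictMono (by omega)
  have g2 := K.τ_lt_succ (i + 1)
  -- Between `τ i` and `τ (i + 1)` the strips of `q i` and `q (i + 1)` are both available, and `q 0`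
  -- is one of these two points.
  rcases K.q_eq_or 0 i with hq | hq
  · exact ⟨i, n, s', d, hs2, ⟨g1.trans hd3', hd2⟩, by rw [← hq]; exact hd1⟩
  · rw [K.p_q] at hq
    refine ⟨i + 1, n, s', d, hs2, ⟨?_, hd2.trans g2⟩, by rw [← hq]; exact hd1⟩
    rw [show i + 1 - 1 = i by ring]; exact hd3'

theorem dense_stableSet (hk : 2 < k) (hk6 : 6 ∣ k) (H : IsFiberLift K h) (L : IsLift M h f F)
    (i : ℤ) : Dense (stableSet f (K.Q i)) := by
  rw [dense_iff_inter_open]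
  intro U hU hne
  obtain ⟨j, hj⟩ := L.exists_reaches hU hne
  have hall : ∀ m : ℕ, Reaches M f U (j + m) := by
    intro m
    induction m with
    | zero => simpa using hj
    | succ m ih =>
      have := L.reaches_succ hk hk6 H hU ih
      rwa [add_assoc] at this
  obtain ⟨l, m, hlm⟩ : ∃ (l : ℤ) (m : ℕ), j + m = i + l * k := by
    have hk0 : (0 : ℤ) < k := by omega
    -- As `k ≥ 1`, this many turns bring `i` to an index at least `j`.
    refine ⟨|j - i|, (i + |j - i| * k - j).toNat, ?_⟩
    rw [Int.toNat_of_nonneg]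
    · ring
    · have h1 := le_abs_self (j - i)
      have h2 := abs_nonneg (j - i)
      nlinarith
  obtain ⟨n, s, a, hs, ha, u, hu, e⟩ := hall m
  rw [hlm] at ha e
  refine ⟨u, hu, ?_⟩
  have ht := L.tendsto_strip hk hk6 H (i + l * k) hs ha
  have h1 := (continuous_cyc.tendsto _).comp ht
  have h2 : cyc (K.q (i + l * k), K.τ (i + l * k)) = K.Q i := K.Q_add_mul hk6 i l
  rw [h2] at h1
  change Tendsto (fun n => f^[n] u) atTop (𝓝 (K.Q i))
  rw [← tendsto_add_atTop_iff_nat n]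
  refine h1.congr fun p => ?_
  rw [Function.comp_apply, L.cyc_iterate, ← e, Function.iterate_add_apply]

end IsLift

end IntermingledBasins
end

theorem mainTheorem3 {k : ℕ} (hk : 0 < k) (hk6 : 6 ∣ k)
    (K : IntermingledBasins.KanMap k) (M : IntermingledBasins.FirstModification K)
    (η : Fin k → IntermingledBasins.T3 → ℝ)
    (hη : ∀ j : Fin k, IntermingledBasins.IsBump (K.R0 (j : ℕ)) M.ε' (η j)) :
    ∃ δ₀ > 0, ∀ δ : ℝ, 0 < δ → δ < δ₀ →
      ∀ ρ : IntermingledBasins.T3 → IntermingledBasins.T3,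
        IntermingledBasins.IsVerticalTimeOneMap (fun z => δ * ∑ j, η j z) ρ →
      ∀ f : IntermingledBasins.T3 → IntermingledBasins.T3,
        (f = ρ ∘ M.f₁ ∨ f = M.f₁ ∘ ρ) →
      ∀ i : ℤ, Dense (IntermingledBasins.stableSet f (K.Q i)) := by
  have hk2 : 2 < k := lt_of_lt_of_le (by norm_num) (Nat.le_of_dvd hk hk6)
  obtain ⟨h, H⟩ := IntermingledBasins.exists_isFiberLift hk2 K
  -- The argument works for every positive `δ`, and the value 1 is arbitrary.
  refine ⟨1, one_pos, fun δ hδ _ ρ hρ f hf i => ?_⟩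
  obtain ⟨F, L⟩ := IntermingledBasins.exists_isLift hk2 hk6 hη hδ hρ hf H
  exact L.dense_stableSet hk2 hk6 H i
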